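/- **Setting.** For each sample size $n\in\mathbb N$ let $d_n,r_n,m_n,p_n$ be positive integers with $p_n\to\infty$, let $\mathcal X_n=\{1,\dots,r_n\}^{d_n}$, $\varphi_n:\mathcal X_n\to\mathbb R^{p_n}$, and consider the exponential family Markov random field $$p_n(x\mid\theta)=\frac{e^{\theta^\top\varphi_n(x)}}{C_n(\theta)},\qquad C_n(\theta)=\sum_{x\in\mathcal X_n}e^{\theta^\top\varphi_n(x)},\qquad \theta\in\mathbb R^{p_n}.$$ Let $x_1,\dots,x_n$ be i.i.d. from $p_n(\cdot\mid\theta_n^*)$. Let $Y_1,\dots,Y_{m_n}$ be a Markov chain on $\mathcal X_n$ with transition matrix $P_n$, stationary mass function $h_n>0$ and initial mass function $q_n$. Let $\kappa_n$ be the operator norm of $P_n$ on the mean-zero functions in $L^2(h_n)$, so that $1-\kappa_n$ is the absolute spectral gap. Assume that $\sup_n\kappa_n<1$, $\sup_n\max_y p_n(y\mid\theta_n^*)/h_n(y)<\infty$, and $q_n\le Q\,h_n$ for a constant $Q$ (with $Q=1$ if the chain is stationary). The index $n$ is dropped below; "constant" means independent of $n$; $a_n\gtrsim b_n$ means $a_n\ge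 c\,b_n$ for a constant $c>0$ and all large $n$, and $a_n\asymp b_n$ means $a_n\gtrsim b_n$ and $b_n\gtrsim a_n$. Put $$\mathcal L_n(\theta)=-\frac1n\sum_{i=1}^n\log p(x_i\mid\theta),\qquad \mathcal L_n^m(\theta)=-\frac1n\sum_{i=1}^n\theta^\top\varphi(x_i)+\log\Big(\frac1m\sum_{i=1}^m\frac{e^{\theta^\top\varphi(Y_i)}}{h(Y_i)}\Big),$$ $H^*=\operatorname{cov}_{\theta^*}(\varphi(X))$, and write $\theta=(\alpha,\beta^\top)^\top$ with $\alpha\in\mathbb R$ the first coordinate, with the corresponding blocks of gradients and Hessians ($H^*_{\alpha\beta}$ and $\nabla^2_{\alpha\beta}$ being column vectors). For $\lambda_1,\lambda_2,\lambda'>0$ let $$\widehat\theta=(\widehat\alpha,\widehat\beta^\top)^\top=\arg\min_\theta\ \mathcal L_n^m(\theta)+\lambda_1\|\theta\|_1+\lambda_2\|\theta\|_2^2,$$ let $\widehat w$ be any (measurable) minimizer over $w\in\mathbb R^{p-1}$ of $$\tfrac12w^\top\nabla^2_{\beta\beta}\mathcal L_n^m(\widehat\theta)w-w^\top\nabla^2_{\alpha\beta}\mathcal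 L_n^m(\widehat\theta)+\lambda'\|w\|_1,$$ let $w^*=\arg\min_w \mathrm E[\nabla_\alpha\mathcal L_n(\theta^*)-w^\top\nabla_\beta\mathcal L_n(\theta^*)]^2$, and define $$\widehat U(\alpha,\beta)=\nabla_\alpha\mathcal L_n^m(\alpha,\beta)-\widehat w^\top\nabla_\beta\mathcal L_n^m(\alpha,\beta).$$ **Assumptions.** There are constants $K,C_{\min},\lambda_{\min}>0$, $B,D,\lambda_{\max}$ and $s_0$ such that for every $n$: (i) $\|\varphi(x)\|_\infty\le K$ for all $x\in\mathcal X$; (ii) for every $T\subseteq\{1,\dots,p\}$ and every $z>1$, $\ |T|\,\theta^\top H^*\theta/\|\theta_T\|_1^2\ge C_{\min}$ for all $\theta\ne0$ with $\|\theta_{T^c}\|_1\le z\|\theta_T\|_1$; (iii) $\|\theta^*\|_\infty\le B$; (iv) the eigenvalues of $H^*$ lie in $[\lambda_{\min},\lambda_{\max}]$; (v) $\|w^*\|_\infty\le D$; (vi) $\|\theta^*\|_0\le s_0$ and $\|w^*\|_0\le s_0$. The tuning parameters satisfy $$\lambda_1\asymp\sqrt{\tfrac{\log p}{n}}+\sqrt{\tfrac{\log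 p}{m}}+\tfrac{\log p}{m},\qquad \lambda_1\asymp\lambda_2\asymp\lambda'=o(1),$$ and, for some constants $\zeta>1$ and $r_1>1$, $\lambda_1>\frac{4K(\zeta+1)}{\zeta-1}\sqrt{\frac{2r_1\log p}{n}}$ for all large $n$. Moreover $$\frac{\log p}{\sqrt n}+\frac{\log p}{\sqrt m}+\frac{\log^{3/2}p}{m}=o(1),\qquad \frac mn\gtrsim\log p .$$ **Theorem.** Put $H^*_{\alpha|\beta}=H^*_{\alpha\alpha}-H^{*\top}_{\alpha\beta}H^{*-1}_{\beta\beta}H^*_{\alpha\beta}$. Then $H^*_{\alpha|\beta}=H^*_{\alpha\alpha}-w^{*\top}H^*_{\alpha\beta}>0$, and under the null hypothesis $\alpha^*=\alpha_0$, $$\sqrt n\,\widehat U(\alpha_0,\widehat\beta)\rightsquigarrow\mathcal N(0,H^*_{\alpha|\beta}).$$ Since $H^*_{\alpha|\beta}$ (and $\alpha_0$) may depend on $n$, this means that $\sqrt n\,\widehat U(\alpha_0,\widehat\beta)/\sqrt{H^*_{\alpha|\beta}}\rightsquigarrow\mathcal N(0,1)$ and that, whenever $H^*_{\alpha|\beta}\to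 v$, $\sqrt n\,\widehat U(\alpha_0,\widehat\beta)\rightsquigarrow\mathcal N(0,v)$. -/

import Mathlib

open MeasureTheory ProbabilityTheory Filter Topology Asymptotics
open scoped NNReal Matrix

noncomputable section

namespace MRF

/-- Configurations of `d` vertices, each carrying one of `r` states. -/
abbrev Config (d r : ℕ) : Type := Fin d → Fin r

section Model

variable {S : Type*} [Fintype S] {p : ℕ}

/-- Normalizing constant `C(θ) = ∑ₓ exp(θᵀφ(x))`. -/
def partitionFn (φ : S → Fin p → ℝ) (θ : Fin p → ℝ) : ℝ :=
  ∑ x, Real.exp (θ ⬝ᵥ φ x)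

/-- Probability mass function `p(x | θ) = exp(θᵀφ(x)) / C(θ)`. -/
def pmf (φ : S → Fin p → ℝ) (θ : Fin p → ℝ) (x : S) : ℝ :=
  Real.exp (θ ⬝ᵥ φ x) / partitionFn φ θ

/-- Mean vector of `φ(X)` for `X ∼ p(· | θ)`. -/
def meanVec (φ : S → Fin p → ℝ) (θ : Fin p → ℝ) (j : Fin p) : ℝ :=
  ∑ x, pmf φ θ x * φ x j

/-- Covariance matrix of `φ(X)` for `X ∼ p(· | θ)`. -/
def covMat (φ : S → Fin p → ℝ) (θ : Fin p → ℝ) : Matrix (Fin p) (Fin p) ℝ :=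
  Matrix.of fun j k =>
    ∑ x, pmf φ θ x * ((φ x j - meanVec φ θ j) * (φ x k - meanVec φ θ k))

/-- Negative log-likelihood `L_n(θ)` of the sample `x₁, …, xₙ`. -/
def negLogLik (φ : S → Fin p → ℝ) {n : ℕ} (x : Fin n → S) (θ : Fin p → ℝ) : ℝ :=
  -((1 / (n : ℝ)) * ∑ i, Real.log (pmf φ θ (x i)))

/-- MCMC negative log-likelihood `L_n^m(θ)` of the sample `x₁, …, xₙ` and the simulated path
`y₁, …, yₘ` of a chain with stationary mass function `h`. -/
def mcNegLogLik (φ : S → Fin p → ℝ) (h : S → ℝ) {n m : ℕ} (x : Fin n → S) (y : Fin m → S)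
    (θ : Fin p → ℝ) : ℝ :=
  -((1 / (n : ℝ)) * ∑ i, θ ⬝ᵥ φ (x i))
    + Real.log ((1 / (m : ℝ)) * ∑ i, Real.exp (θ ⬝ᵥ φ (y i)) / h (y i))

end Model

section Vectors

/-- The `ℓ₁`-norm. -/
def l1 {p : ℕ} (v : Fin p → ℝ) : ℝ := ∑ j, |v j|

/-- The `ℓ₀`-norm: the number of nonzero entries. -/
def l0 {p : ℕ} (v : Fin p → ℝ) : ℕ := (Finset.univ.filter fun j => v j ≠ 0).card

/-- The `j`-th partial derivative of `f` at `θ`. -/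
def partialDeriv {p : ℕ} (f : (Fin p → ℝ) → ℝ) (j : Fin p) (θ : Fin p → ℝ) : ℝ :=
  lineDeriv ℝ f θ (Pi.single j 1)

/-- The Hessian matrix of `f` at `θ`. -/
def hessian {p : ℕ} (f : (Fin p → ℝ) → ℝ) (θ : Fin p → ℝ) : Matrix (Fin p) (Fin p) ℝ :=
  Matrix.of fun j k => partialDeriv (partialDeriv f k) j θ

/-- The cone `{θ : ‖θ_{Tᶜ}‖₁ ≤ ζ ‖θ_T‖₁}`. -/
def cone {p : ℕ} (ζ : ℝ) (T : Finset (Fin p)) : Set (Fin p → ℝ) :=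
  {θ | ∑ j ∈ Tᶜ, |θ j| ≤ ζ * ∑ j ∈ T, |θ j|}

/-- The compatibility factor `inf |T| θᵀΣθ / ‖θ_T‖₁²` over the nonzero elements of the cone;
it takes values in the extended reals, so that it is `+∞` for `T = ∅`. -/
def compatFactor {p : ℕ} (ζ : ℝ) (T : Finset (Fin p)) (A : Matrix (Fin p) (Fin p) ℝ) : EReal :=
  ⨅ θ ∈ cone ζ T \ {0},
    ((((T.card : ℝ) * (θ ⬝ᵥ (A *ᵥ θ)) / (∑ j ∈ T, |θ j|) ^ 2 : ℝ)) : EReal)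

/-- For `θ = (α, β)`: the block `A_{αα}`. -/
def blockAA {b : ℕ} (A : Matrix (Fin (b + 1)) (Fin (b + 1)) ℝ) : ℝ := A 0 0

/-- The block `A_{αβ}`, a column vector. -/
def blockAB {b : ℕ} (A : Matrix (Fin (b + 1)) (Fin (b + 1)) ℝ) : Fin b → ℝ := fun j => A j.succ 0

/-- The block `A_{ββ}`. -/
def blockBB {b : ℕ} (A : Matrix (Fin (b + 1)) (Fin (b + 1)) ℝ) : Matrix (Fin b) (Fin b) ℝ :=
  A.submatrix Fin.succ Fin.succ

/-- `A_{α|β} = A_{αα} - A_{αβ}ᵀ A_{ββ}⁻¹ A_{αβ}`. -/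
def schur {b : ℕ} (A : Matrix (Fin (b + 1)) (Fin (b + 1)) ℝ) : ℝ :=
  blockAA A - blockAB A ⬝ᵥ ((blockBB A)⁻¹ *ᵥ blockAB A)

end Vectors

section Chain

variable {S : Type*} [Fintype S]

/-- `q` is a probability mass function. -/
def IsMassFn (q : S → ℝ) : Prop := (∀ y, 0 ≤ q y) ∧ ∑ y, q y = 1

/-- `P` is a transition matrix. -/
def IsTransition (P : S → S → ℝ) : Prop := ∀ y, IsMassFn (P y)

/-- `h` is a stationary mass function of `P`. -/
def IsStationary (P : S → S → ℝ) (h : S → ℝ) : Prop := ∀ x, ∑ y, h y * P y x = h x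

/-- The operator `(Pf)(y) = ∑ₓ f(x) P(y, x)`. -/
def transOp (P : S → S → ℝ) (f : S → ℝ) (y : S) : ℝ := ∑ x, f x * P y x

/-- The number `κ` for which `1 - κ` is the absolute spectral gap: the operator norm of `P` on the
mean-zero subspace of `L²(h)`. For a reversible chain it is the largest `|ρ|` over the
spectrum of `P` on that subspace. -/
def kappa (P : S → S → ℝ) (h : S → ℝ) : ℝ :=
  sSup {c : ℝ | ∃ f : S → ℝ, ∑ y, f y * h y = 0 ∧ ∑ y, f y ^ 2 * h y = 1 ∧
    c = Real.sqrt (∑ y, transOp P f y ^ 2 * h y)}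

/-- `M₂ = max_y p(y | θ) / h(y)`. -/
def chainM2 {p : ℕ} (φ : S → Fin p → ℝ) (θ : Fin p → ℝ) (h : S → ℝ) : ℝ :=
  ⨆ y, pmf φ θ y / h y

/-- Probability of the path `y₁, …, yₘ` under initial mass function `q` and transitions `P`. -/
def pathProb (q : S → ℝ) (P : S → S → ℝ) : {m : ℕ} → (Fin m → S) → ℝ
  | 0, _ => 1
  | _ + 1, y => q (y 0) * ∏ i, P (y (Fin.castSucc i)) (y (Fin.succ i))

/-- `Y₁, …, Yₘ` is a Markov chain with initial mass function `q` and transition matrix `P`. -/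
def IsMarkovChain {Ω : Type*} [MeasurableSpace Ω] (μ : Measure Ω) (q : S → ℝ) (P : S → S → ℝ)
    {m : ℕ} (Y : Fin m → Ω → S) : Prop :=
  ∀ y : Fin m → S, μ.real {ω | ∀ i, Y i ω = y i} = pathProb q P y

end Chain

section Estimators

variable {S : Type*}

/-- Elastic-net penalized MCMC criterion `L_n^m(θ) + λ₁ ‖θ‖₁ + λ₂ ‖θ‖₂²`. -/
def elasticNetCriterion {p n m : ℕ} (φ : S → Fin p → ℝ) (h : S → ℝ) (x : Fin n → S)
    (y : Fin m → S) (lam₁ lam₂ : ℝ) (θ : Fin p → ℝ) : ℝ :=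
  mcNegLogLik φ h x y θ + lam₁ * l1 θ + lam₂ * ∑ j, θ j ^ 2

/-- Lasso criterion `½ wᵀ ∇²_{ββ}L w - wᵀ ∇²_{αβ}L + λ' ‖w‖₁` with `L = L_n^m`, the Hessian being
taken at `θ`. -/
def lassoCriterion {b n m : ℕ} (φ : S → Fin (b + 1) → ℝ) (h : S → ℝ) (x : Fin n → S)
    (y : Fin m → S) (lam' : ℝ) (θ : Fin (b + 1) → ℝ) (w : Fin b → ℝ) : ℝ :=
  (1 / 2) * (w ⬝ᵥ (blockBB (hessian (mcNegLogLik φ h x y) θ) *ᵥ w))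
    - w ⬝ᵥ blockAB (hessian (mcNegLogLik φ h x y) θ) + lam' * l1 w

/-- `∇_α f(θ) - wᵀ ∇_β f(θ)`. -/
def projectedScore {b : ℕ} (f : (Fin (b + 1) → ℝ) → ℝ) (w : Fin b → ℝ)
    (θ : Fin (b + 1) → ℝ) : ℝ :=
  partialDeriv f 0 θ - ∑ j, w j * partialDeriv f (Fin.succ j) θ

/-- Decorrelated score `Û(α, β) = ∇_α L_n^m(α, β) - wᵀ ∇_β L_n^m(α, β)`. -/
def decorrelatedScore {b n m : ℕ} (φ : S → Fin (b + 1) → ℝ) (h : S → ℝ) (x : Fin n → S)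
    (y : Fin m → S) (w : Fin b → ℝ) (α : ℝ) (β : Fin b → ℝ) : ℝ :=
  projectedScore (mcNegLogLik φ h x y) w (Fin.cons α β)

/-- `√(log p / n) + √(log p / m) + log p / m`. -/
def rate (p n m : ℕ) : ℝ :=
  Real.sqrt (Real.log p / n) + Real.sqrt (Real.log p / m) + Real.log p / m

end Estimators

end MRF

end

/-!
The decorrelated score at the estimates differs from the exact score
`-(1, -w*)ᵀ (φ̄ - E φ)` along the population contrast by `o_P(1 / √n)`, and the latter is a mean of
independent bounded centred variables.

Both the exact and the MCMC log-likelihood have as log-partition function the logarithm of a finite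
weighted sum of exponentials, so their gradients and Hessians are means and covariances under
finite weights (`wmean`, `wcov`), and moving the parameter tilts these weights. Everything
deterministic rests on four estimates for a tilt by a bounded function: for means to first and
second order, for variances from below, and for covariances in terms of one standard deviation.

*Elastic net* (`exists_elasticNet_l1_error_le`). The basic inequality puts the error in a cone. The
ridge term, `λ₂` being of the order of `λ₁`, then confines it to an `ℓ₁`-ball of constant radius, on
which the log-partition function is strongly convex in the directions of the cone: `H*` is positive
definite, the MCMC Hessian at `θ*` is entrywise close to it, and the error is concentrated on
boundedly many coordinates. This gives an `ℓ₁`-error of order `λ₁`.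

*Lasso* (`exists_lasso_l1_error_le`). The Hessian is evaluated at the estimate, where it is off by
the order `λ₁` of the penalty. In the basic inequality this error only occurs multiplied by the
standard deviation of the fitted direction, so the quadratic term absorbs it up to a square, and the
`ℓ₁`-error is of order `λ₁` again.

*Score* (`exists_score_expansion_le`). The normal equations of `w*` make the contrast orthogonal, in
the inner product of `H*`, to every displacement of the nuisance parameter. All replacements thus
cost products of two errors, of order `λ₁² = O(log p / n) = o(1 / √n)`, except that of the Monte
Carlo mean along the contrast, a single average.

*Good event* (`exists_good_event`). The data enter through Hoeffding's inequality. For the simulated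
chain, a Lyapunov function consisting of the mean and a small multiple of the `L²(h)`-norm of the
fluctuation grows along the Feynman-Kac semigroup by a factor `1 + O(τ²)` at each step
(`lyapunov_step`), which yields a sub-Gaussian Chernoff bound
(`IsMarkovChain.measure_abs_sum_ge_le`). Since `m` is at least of the order `n log p`, it controls
all `O(p²)` averages at the level `1 / √n`, and the single average along the contrast at the level
`ε / √n` for every `ε > 0`.

*Limit* (`tendstoInDistribution_of_score_approximation`). The central limit theorem for triangular
arrays with bounded rows follows by comparing characteristic functions, and Slutsky's lemma is
proved in the same terms, the probability spaces being different for different `n`.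
-/

namespace MRF

/-! ### Weighted means and covariances -/

section Weighted

variable {ι : Type*} [Fintype ι]

/-- The mean of `f` under the probability weights proportional to `a`. -/
noncomputable def wmean (a f : ι → ℝ) : ℝ := (∑ k, a k * f k) / ∑ k, a k

/-- The covariance of `f` and `g` under the probability weights proportional to `a`. -/
noncomputable def wcov (a f g : ι → ℝ) : ℝ :=
  wmean a (fun k => f k * g k) - wmean a f * wmean a g

lemma wmean_add (a f g : ι → ℝ) : wmean a (fun k => f k + g k) = wmean a f + wmean a g := by
  simp only [wmean, mul_add, Finset.sum_add_distrib, add_div]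

lemma wmean_sub (a f g : ι → ℝ) : wmean a (fun k => f k - g k) = wmean a f - wmean a g := by
  simp only [wmean, mul_sub, Finset.sum_sub_distrib, sub_div]

lemma wmean_const_mul (a f : ι → ℝ) (c : ℝ) : wmean a (fun k => c * f k) = c * wmean a f := by
  simp only [wmean, mul_left_comm _ c, ← Finset.mul_sum, mul_div_assoc]

lemma wmean_mul_const (a f : ι → ℝ) (c : ℝ) : wmean a (fun k => f k * c) = wmean a f * c := by
  simp only [mul_comm _ c, wmean_const_mul]

lemma wmean_dotProduct {p : ℕ} (a : ι → ℝ) (u : Fin p → ℝ) (ψ : ι → Fin p → ℝ) :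
    wmean a (fun k => u ⬝ᵥ ψ k) = u ⬝ᵥ fun j => wmean a (fun k => ψ k j) := by
  simp only [wmean, dotProduct, Finset.mul_sum, mul_div_assoc', ← Finset.sum_div]
  rw [Finset.sum_comm]
  simp only [mul_left_comm]

lemma wmean_smul_weight (a f : ι → ℝ) {c : ℝ} (hc : c ≠ 0) :
    wmean (fun k => c * a k) f = wmean a f := by
  simp only [wmean, mul_assoc, ← Finset.mul_sum]
  exact mul_div_mul_left _ _ hc

variable {a : ι → ℝ}

lemma wmean_mono (ha : ∀ k, 0 < a k) {f g : ι → ℝ} (hfg : ∀ k, f k ≤ g k) :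
    wmean a f ≤ wmean a g :=
  div_le_div_of_nonneg_right
    (Finset.sum_le_sum fun k _ => mul_le_mul_of_nonneg_left (hfg k) (ha k).le)
    (Finset.sum_nonneg fun k _ => (ha k).le)

lemma wmean_nonneg (ha : ∀ k, 0 < a k) {f : ι → ℝ} (hf : ∀ k, 0 ≤ f k) : 0 ≤ wmean a f :=
  div_nonneg (Finset.sum_nonneg fun k _ => mul_nonneg (ha k).le (hf k))
    (Finset.sum_nonneg fun k _ => (ha k).le)

lemma abs_wmean_le_wmean_abs (ha : ∀ k, 0 < a k) (f : ι → ℝ) :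
    |wmean a f| ≤ wmean a fun k => |f k| := by
  rw [abs_le]
  constructor
  · have := wmean_mono ha (f := fun k => (-1) * |f k|) (g := f)
      (fun k => by linarith [neg_abs_le (f k)])
    rw [wmean_const_mul] at this; linarith
  · exact wmean_mono ha fun k => le_abs_self _

variable [Nonempty ι]

lemma sum_weight_pos (ha : ∀ k, 0 < a k) : 0 < ∑ k, a k :=
  Finset.sum_pos (fun k _ => ha k) Finset.univ_nonempty

lemma wmean_const (ha : ∀ k, 0 < a k) (c : ℝ) : wmean a (fun _ => c) = c := by
  rw [wmean, ← Finset.sum_mul, mul_div_cancel_left₀ _ (sum_weight_pos ha).ne']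

lemma abs_wmean_le (ha : ∀ k, 0 < a k) {f : ι → ℝ} {F : ℝ} (hf : ∀ k, |f k| ≤ F) :
    |wmean a f| ≤ F :=
  (abs_wmean_le_wmean_abs ha f).trans ((wmean_mono ha hf).trans (wmean_const ha F).le)

lemma wcov_eq_wmean_centered (ha : ∀ k, 0 < a k) (f g : ι → ℝ) (c d : ℝ) :
    wcov a f g = wmean a (fun k => (f k - c) * (g k - d))
      - (wmean a f - c) * (wmean a g - d) := by
  have : (fun k => (f k - c) * (g k - d)) =
      fun k => ((f k * g k - f k * d) - c * g k) + c * d := by funext k; ring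
  rw [this, wmean_add, wmean_sub, wmean_sub, wmean_mul_const, wmean_const_mul, wmean_const ha,
    wcov]
  ring

lemma wcov_self_eq (ha : ∀ k, 0 < a k) (f : ι → ℝ) :
    wcov a f f = wmean a fun k => (f k - wmean a f) ^ 2 := by
  rw [wcov_eq_wmean_centered ha f f (wmean a f) (wmean a f)]
  simp [sq]

lemma wcov_self_nonneg (ha : ∀ k, 0 < a k) (f : ι → ℝ) : 0 ≤ wcov a f f := by
  rw [wcov_self_eq ha]; exact wmean_nonneg ha fun k => sq_nonneg _

lemma wcov_self_le (ha : ∀ k, 0 < a k) (f : ι → ℝ) (c : ℝ) :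
    wcov a f f ≤ wmean a fun k => (f k - c) ^ 2 := by
  rw [wcov_eq_wmean_centered ha f f c c]
  simp only [← sq]
  linarith [sq_nonneg (wmean a f - c)]

lemma sq_wmean_le (ha : ∀ k, 0 < a k) (f : ι → ℝ) :
    (wmean a f) ^ 2 ≤ wmean a fun k => f k ^ 2 := by
  have := wcov_self_nonneg ha f
  simp only [wcov, ← sq] at this
  linarith

omit [Nonempty ι] in
lemma wcov_dotProduct {p : ℕ} (a : ι → ℝ) (u v : Fin p → ℝ) (ψ : ι → Fin p → ℝ) :
    wcov a (fun k => u ⬝ᵥ ψ k) (fun k => v ⬝ᵥ ψ k) =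
      u ⬝ᵥ ((Matrix.of fun i j => wcov a (fun k => ψ k i) (fun k => ψ k j)) *ᵥ v) := by
  have h1 : (fun k => (u ⬝ᵥ ψ k) * (v ⬝ᵥ ψ k)) =
      fun k => u ⬝ᵥ fun i => v ⬝ᵥ fun j => ψ k i * ψ k j := by
    funext k
    simp only [dotProduct]
    rw [Finset.sum_mul_sum]
    simp only [Finset.mul_sum]
    exact Finset.sum_congr rfl fun i _ => Finset.sum_congr rfl fun j _ => by ring
  have h2 : ∀ i, wmean a (fun k => v ⬝ᵥ fun j => ψ k i * ψ k j) =
      v ⬝ᵥ fun j => wmean a (fun k => ψ k i * ψ k j) := fun i =>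
    wmean_dotProduct a v (fun k j => ψ k i * ψ k j)
  rw [wcov, h1, wmean_dotProduct a u (fun k i => v ⬝ᵥ fun j => ψ k i * ψ k j), wmean_dotProduct,
    wmean_dotProduct]
  simp only [h2]
  simp only [dotProduct, Matrix.mulVec, Matrix.of_apply, wcov]
  rw [Finset.sum_mul_sum]
  simp only [Finset.mul_sum, ← Finset.sum_sub_distrib]
  exact Finset.sum_congr rfl fun i _ => Finset.sum_congr rfl fun j _ => by ring

omit [Nonempty ι] in
lemma wcov_comm (a f g : ι → ℝ) : wcov a f g = wcov a g f := by
  simp only [wcov, mul_comm]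

/-! ### Exponential tilting -/

/-- The weights `a` tilted by `exp (t u)`. -/
noncomputable def tilt (a u : ι → ℝ) (t : ℝ) (k : ι) : ℝ := a k * Real.exp (t * u k)

omit [Fintype ι] [Nonempty ι] in
lemma tilt_pos (ha : ∀ k, 0 < a k) (u : ι → ℝ) (t : ℝ) (k : ι) : 0 < tilt a u t k :=
  mul_pos (ha k) (Real.exp_pos _)

omit [Fintype ι] [Nonempty ι] in
lemma tilt_zero (a u : ι → ℝ) : tilt a u 0 = a := by
  funext k; simp [tilt]

omit [Nonempty ι] in
lemma hasDerivAt_log_sum_tilt (ha : ∀ k, 0 < a k) (u : ι → ℝ) (t : ℝ) :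
    HasDerivAt (fun t => Real.log (∑ k, tilt a u t k)) (wmean (tilt a u t) u) t := by
  rcases isEmpty_or_nonempty ι with hι | hι
  · simpa [wmean] using hasDerivAt_const t (0 : ℝ)
  have h1 : HasDerivAt (fun t => ∑ k, tilt a u t k) (∑ k, tilt a u t k * u k) t := by
    refine HasDerivAt.fun_sum fun k _ => ?_
    have := (((hasDerivAt_id t).mul_const (u k)).exp).const_mul (a k)
    convert! this using 1
    simp [tilt]; ring
  exact h1.log (sum_weight_pos (tilt_pos ha u t)).ne'

omit [Nonempty ι] in
lemma hasDerivAt_wmean_tilt (ha : ∀ k, 0 < a k) (u f : ι → ℝ) (t : ℝ) :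
    HasDerivAt (fun t => wmean (tilt a u t) f) (wcov (tilt a u t) f u) t := by
  rcases isEmpty_or_nonempty ι with hι | hι
  · simpa [wmean, wcov] using hasDerivAt_const t (0 : ℝ)
  have h0 : ∀ g : ι → ℝ, HasDerivAt (fun t => ∑ k, tilt a u t k * g k)
      (∑ k, tilt a u t k * (g k * u k)) t := fun g => by
    refine HasDerivAt.fun_sum fun k _ => ?_
    have := ((((hasDerivAt_id t).mul_const (u k)).exp).const_mul (a k)).mul_const (g k)
    convert! this using 1
    simp [tilt]; ring
  have h1 := h0 fun _ => 1
  simp only [mul_one, one_mul] at h1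
  have hS := (sum_weight_pos (tilt_pos ha u t)).ne'
  have := (h0 f).div h1 hS
  convert! this using 1
  simp only [wcov, wmean]
  field_simp

/-- The density, with respect to the weights `a`, of the weights tilted by `exp u`. -/
noncomputable def tiltDensity (a u : ι → ℝ) (k : ι) : ℝ :=
  Real.exp (u k) / wmean a fun k => Real.exp (u k)

lemma wmean_exp_pos (ha : ∀ k, 0 < a k) (u : ι → ℝ) : 0 < wmean a fun k => Real.exp (u k) :=
  div_pos (Finset.sum_pos (fun k _ => mul_pos (ha k) (Real.exp_pos _)) Finset.univ_nonempty)
    (sum_weight_pos ha)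

lemma wmean_tilt_one (ha : ∀ k, 0 < a k) (u f : ι → ℝ) :
    wmean (tilt a u 1) f = wmean a fun k => tiltDensity a u k * f k := by
  have h1 := (sum_weight_pos ha).ne'
  have h2 := (Finset.sum_pos (fun k _ => mul_pos (ha k) (Real.exp_pos (u k)))
    (Finset.univ_nonempty (α := ι))).ne'
  have : ∀ k, tiltDensity a u k * f k
      = (wmean a fun k => Real.exp (u k))⁻¹ * (Real.exp (u k) * f k) := fun k => by
    rw [tiltDensity]; ring
  simp only [this, wmean_const_mul]
  simp only [wmean, tilt, one_mul, mul_assoc]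
  field_simp

variable {u : ι → ℝ} {ε : ℝ}

lemma tiltDensity_mem (ha : ∀ k, 0 < a k) (hu : ∀ k, |u k| ≤ ε) (k : ι) :
    Real.exp (-(2 * ε)) ≤ tiltDensity a u k ∧ tiltDensity a u k ≤ Real.exp (2 * ε) := by
  have hpos := wmean_exp_pos ha u
  have hle : (wmean a fun k => Real.exp (u k)) ≤ Real.exp ε :=
    (wmean_mono ha fun k => Real.exp_le_exp.2 ((le_abs_self _).trans (hu k))).trans
      (wmean_const ha _).le
  have hge : Real.exp (-ε) ≤ wmean a fun k => Real.exp (u k) :=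
    (wmean_const ha _).symm.le.trans
      (wmean_mono ha fun k => Real.exp_le_exp.2 (neg_le_of_abs_le (hu k)))
  constructor
  · rw [tiltDensity, le_div_iff₀ hpos]
    calc Real.exp (-(2 * ε)) * _ ≤ Real.exp (-(2 * ε)) * Real.exp ε := by gcongr
      _ = Real.exp (-ε) := by rw [← Real.exp_add]; ring_nf
      _ ≤ _ := Real.exp_le_exp.2 (neg_le_of_abs_le (hu k))
  · rw [tiltDensity, div_le_iff₀ hpos]
    calc Real.exp (u k) ≤ Real.exp ε := Real.exp_le_exp.2 ((le_abs_self _).trans (hu k))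
      _ = Real.exp (2 * ε) * Real.exp (-ε) := by rw [← Real.exp_add]; ring_nf
      _ ≤ _ := by gcongr

lemma abs_tiltDensity_sub_one_le (ha : ∀ k, 0 < a k) (hu : ∀ k, |u k| ≤ ε) (k : ι) :
    |tiltDensity a u k - 1| ≤ Real.exp (2 * ε) - 1 := by
  obtain ⟨h1, h2⟩ := tiltDensity_mem ha hu k
  rw [abs_le]
  constructor
  · have h3 : Real.exp (-(2 * ε)) * Real.exp (2 * ε) = 1 := by rw [← Real.exp_add]; simp
    nlinarith [sq_nonneg (Real.exp (2 * ε) - Real.exp (-(2 * ε))), Real.exp_pos (2 * ε),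
      Real.exp_pos (-(2 * ε)), Real.add_one_le_exp (2 * ε), Real.add_one_le_exp (-(2 * ε))]
  · linarith

/-- Bounded tilts change means by little. -/
lemma abs_wmean_tilt_sub_le (ha : ∀ k, 0 < a k) (hu : ∀ k, |u k| ≤ ε) (f : ι → ℝ) :
    |wmean (tilt a u 1) f - wmean a f| ≤ (Real.exp (2 * ε) - 1) * wmean a fun k => |f k| := by
  rw [wmean_tilt_one ha, ← wmean_sub]
  refine (abs_wmean_le_wmean_abs ha _).trans ?_
  rw [← wmean_const_mul]
  refine wmean_mono ha fun k => ?_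
  rw [show tiltDensity a u k * f k - f k = (tiltDensity a u k - 1) * f k by ring, abs_mul]
  exact mul_le_mul_of_nonneg_right (abs_tiltDensity_sub_one_le ha hu k) (abs_nonneg _)

/-- Bounded tilts shrink variances by at most a constant factor. -/
lemma exp_mul_wcov_self_le_wcov_tilt (ha : ∀ k, 0 < a k) (hu : ∀ k, |u k| ≤ ε) (f : ι → ℝ) :
    Real.exp (-(2 * ε)) * wcov a f f ≤ wcov (tilt a u 1) f f := by
  rw [wcov_self_eq (tilt_pos ha u 1), wmean_tilt_one ha]
  set c := wmean (tilt a u 1) f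
  refine (mul_le_mul_of_nonneg_left (wcov_self_le ha f c) (Real.exp_pos _).le).trans ?_
  rw [← wmean_const_mul]
  exact wmean_mono ha fun k =>
    mul_le_mul_of_nonneg_right (tiltDensity_mem ha hu k).1 (sq_nonneg _)

/-- The change of a covariance under a bounded tilt is controlled by the standard deviation of one
of the two functions before the tilt. -/
lemma abs_wcov_tilt_sub_le (ha : ∀ k, 0 < a k) (hu : ∀ k, |u k| ≤ ε) (f : ι → ℝ) {g : ι → ℝ}
    {G : ℝ} (hg : ∀ k, |g k| ≤ G) :
    |wcov (tilt a u 1) f g - wcov a f g|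
      ≤ 2 * G * (Real.exp (2 * ε) - 1) * Real.sqrt (wcov a f f) := by
  have hι : Nonempty ι := inferInstance
  obtain ⟨k₀⟩ := hι
  have hε : 0 ≤ ε := (abs_nonneg _).trans (hu k₀)
  have hG : 0 ≤ G := (abs_nonneg _).trans (hg k₀)
  have hE : 0 ≤ Real.exp (2 * ε) - 1 := by linarith [Real.add_one_le_exp (2 * ε)]
  set c := wmean a f with hc
  have hsd : (wmean a fun k => |f k - c|) ≤ Real.sqrt (wcov a f f) := by
    refine Real.le_sqrt_of_sq_le ?_
    rw [wcov_self_eq ha]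
    simpa using sq_wmean_le ha fun k => |f k - c|
  have ha' := tilt_pos ha u 1
  have e1 := wcov_eq_wmean_centered ha' f g c 0
  have e2 := wcov_eq_wmean_centered ha f g c 0
  simp only [sub_zero] at e1 e2
  rw [← hc, sub_self, zero_mul, sub_zero] at e2
  have e3 : wmean (tilt a u 1) f - c = wmean (tilt a u 1) (fun k => f k - c)
      - wmean a (fun k => f k - c) := by
    rw [wmean_sub, wmean_sub, wmean_const ha', wmean_const ha, ← hc]; ring
  have b1 := abs_wmean_tilt_sub_le ha hu fun k => (f k - c) * g k
  have b2 := abs_wmean_tilt_sub_le ha hu fun k => f k - c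
  have b3 : (wmean a fun k => |(f k - c) * g k|) ≤ G * Real.sqrt (wcov a f f) := by
    refine le_trans ?_ (mul_le_mul_of_nonneg_left hsd hG)
    rw [← wmean_const_mul]
    refine wmean_mono ha fun k => ?_
    rw [abs_mul, mul_comm]
    exact mul_le_mul_of_nonneg_right (hg k) (abs_nonneg _)
  have b4 := abs_wmean_le ha' hg
  rw [e1, e2, e3]
  set x := wmean (tilt a u 1) (fun k => (f k - c) * g k) - wmean a (fun k => (f k - c) * g k)
  set y := wmean (tilt a u 1) (fun k => f k - c) - wmean a (fun k => f k - c)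
  set s := Real.sqrt (wcov a f f)
  have hx : |x| ≤ (Real.exp (2 * ε) - 1) * (G * s) := b1.trans (mul_le_mul_of_nonneg_left b3 hE)
  have hy : |y| ≤ (Real.exp (2 * ε) - 1) * s := b2.trans (mul_le_mul_of_nonneg_left hsd hE)
  have hyg : |y * wmean (tilt a u 1) g| ≤ (Real.exp (2 * ε) - 1) * s * G := by
    rw [abs_mul]
    exact mul_le_mul hy b4 (abs_nonneg _) (mul_nonneg hE (Real.sqrt_nonneg _))
  calc |_| = |x - y * wmean (tilt a u 1) g| := by congr 1; ring
    _ ≤ |x| + |y * wmean (tilt a u 1) g| := abs_sub _ _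
    _ ≤ _ := by linarith

omit [Fintype ι] [Nonempty ι] in
lemma tilt_eq_tilt_one (a u : ι → ℝ) (t : ℝ) : tilt a u t = tilt a (fun k => t * u k) 1 := by
  funext k; simp [tilt]

/-- Second-order expansion of the mean under a bounded tilt. -/
lemma abs_wmean_tilt_sub_sub_wcov_le (ha : ∀ k, 0 < a k) (hu : ∀ k, |u k| ≤ ε) {f : ι → ℝ}
    {F : ℝ} (hf : ∀ k, |f k| ≤ F) :
    |wmean (tilt a u 1) f - wmean a f - wcov a f u| ≤ 2 * F * (Real.exp (2 * ε) - 1) * ε := by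
  obtain ⟨k₀⟩ : Nonempty ι := inferInstance
  have hε : 0 ≤ ε := (abs_nonneg _).trans (hu k₀)
  have hF : 0 ≤ F := (abs_nonneg _).trans (hf k₀)
  obtain ⟨t, ht, hslope⟩ := exists_hasDerivAt_eq_slope (fun t => wmean (tilt a u t) f)
    (fun t => wcov (tilt a u t) f u) zero_lt_one
    (fun t _ => (hasDerivAt_wmean_tilt ha u f t).continuousAt.continuousWithinAt)
    (fun t _ => hasDerivAt_wmean_tilt ha u f t)
  simp only [tilt_zero, sub_zero, div_one] at hslope
  rw [← hslope, wcov_comm _ f u, wcov_comm _ f u, tilt_eq_tilt_one]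
  have htu : ∀ k, |t * u k| ≤ ε := fun k => by
    rw [abs_mul, abs_of_pos ht.1]
    nlinarith [hu k, abs_nonneg (u k), ht.2]
  refine (abs_wcov_tilt_sub_le ha htu u hf).trans ?_
  have hsd : Real.sqrt (wcov a u u) ≤ ε := by
    refine Real.sqrt_le_iff.2 ⟨hε, (wcov_self_le ha u 0).trans ?_⟩
    refine (wmean_mono ha fun k => ?_).trans (wmean_const ha _).le
    rw [sub_zero]; exact sq_le_sq' (neg_le_of_abs_le (hu k)) ((le_abs_self _).trans (hu k))
  have hE : 0 ≤ Real.exp (2 * ε) - 1 := by linarith [Real.add_one_le_exp (2 * ε)]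
  exact mul_le_mul_of_nonneg_left hsd (by positivity)

/-- Restricted strong convexity of the log-partition function along a bounded direction. -/
lemma log_sum_tilt_sub_ge (ha : ∀ k, 0 < a k) (hu : ∀ k, |u k| ≤ ε) :
    1 / 2 * Real.exp (-(2 * ε)) * wcov a u u
      ≤ Real.log (∑ k, tilt a u 1 k) - Real.log (∑ k, a k) - wmean a u := by
  set c := Real.exp (-(2 * ε)) * wcov a u u with hc
  have hvar : ∀ t ∈ Set.Icc (0 : ℝ) 1, c ≤ wcov (tilt a u t) u u := fun t ht => by
    rw [tilt_eq_tilt_one]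
    refine exp_mul_wcov_self_le_wcov_tilt ha (fun k => ?_) u
    rw [abs_mul, abs_of_nonneg ht.1]
    nlinarith [hu k, abs_nonneg (u k), ht.2]
  have hmean : MonotoneOn (fun t => wmean (tilt a u t) u - c * t) (Set.Icc (0 : ℝ) 1) := by
    have hd : ∀ t, HasDerivAt (fun t => wmean (tilt a u t) u - c * t)
        (wcov (tilt a u t) u u - c) t := fun t => by
      have := (hasDerivAt_wmean_tilt ha u u t).sub ((hasDerivAt_id t).const_mul c)
      rw [mul_one] at this
      exact this
    refine monotoneOn_of_deriv_nonneg (convex_Icc _ _)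
      (fun t _ => (hd t).continuousAt.continuousWithinAt)
      (fun t _ => (hd t).differentiableAt.differentiableWithinAt) fun t ht => ?_
    rw [(hd t).deriv]
    linarith [hvar t (interior_subset ht)]
  have hlog : MonotoneOn (fun t => Real.log (∑ k, tilt a u t k) - wmean a u * t - c / 2 * t ^ 2)
      (Set.Icc (0 : ℝ) 1) := by
    have hd : ∀ t, HasDerivAt
        (fun t => Real.log (∑ k, tilt a u t k) - wmean a u * t - c / 2 * t ^ 2)
        (wmean (tilt a u t) u - wmean a u - c * t) t := fun t => by
      have := ((hasDerivAt_log_sum_tilt ha u t).sub ((hasDerivAt_id t).const_mul (wmean a u))).sub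
        ((hasDerivAt_pow 2 t).const_mul (c / 2))
      convert! this using 1
      simp; ring
    refine monotoneOn_of_deriv_nonneg (convex_Icc _ _)
      (fun t _ => (hd t).continuousAt.continuousWithinAt)
      (fun t _ => (hd t).differentiableAt.differentiableWithinAt) fun t ht => ?_
    rw [(hd t).deriv]
    have ht' : t ∈ Set.Icc (0 : ℝ) 1 := interior_subset ht
    have := hmean (Set.left_mem_Icc.2 zero_le_one) ht' ht'.1
    simp only [tilt_zero, mul_zero, sub_zero] at this
    linarith
  have := hlog (Set.left_mem_Icc.2 zero_le_one) (Set.right_mem_Icc.2 zero_le_one) zero_le_one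
  simp only [tilt_zero] at this
  nlinarith [this]

end Weighted

/-! ### Scores and Hessians of the two likelihoods -/

section Derivatives

variable {S : Type*} [Fintype S] {p n m : ℕ}

/-- Sample mean of the sufficient statistic. -/
noncomputable def sampleMean (φ : S → Fin p → ℝ) (x : Fin n → S) (j : Fin p) : ℝ :=
  (1 / (n : ℝ)) * ∑ i, φ (x i) j

/-- Unnormalized Gibbs weights `exp (θᵀφ)` on the configuration space. -/
noncomputable def gibbsWeight (φ : S → Fin p → ℝ) (θ : Fin p → ℝ) (s : S) : ℝ :=
  Real.exp (θ ⬝ᵥ φ s)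

/-- Importance weights `exp (θᵀφ(yₖ)) / h(yₖ)` of the points of a simulated path. -/
noncomputable def importanceWeight (φ : S → Fin p → ℝ) (h : S → ℝ) (y : Fin m → S)
    (θ : Fin p → ℝ) (k : Fin m) : ℝ :=
  Real.exp (θ ⬝ᵥ φ (y k)) / h (y k)

omit [Fintype S] in
lemma gibbsWeight_pos (φ : S → Fin p → ℝ) (θ : Fin p → ℝ) (s : S) : 0 < gibbsWeight φ θ s :=
  Real.exp_pos _

omit [Fintype S] in
lemma importanceWeight_pos (φ : S → Fin p → ℝ) {h : S → ℝ} (hh : ∀ s, 0 < h s) (y : Fin m → S)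
    (θ : Fin p → ℝ) (k : Fin m) : 0 < importanceWeight φ h y θ k :=
  div_pos (Real.exp_pos _) (hh _)

omit [Fintype S] in
lemma gibbsWeight_add_smul (φ : S → Fin p → ℝ) (θ v : Fin p → ℝ) (t : ℝ) :
    gibbsWeight φ (θ + t • v) = tilt (gibbsWeight φ θ) (fun s => v ⬝ᵥ φ s) t := by
  funext s
  simp [gibbsWeight, tilt, add_dotProduct, Real.exp_add]

omit [Fintype S] in
lemma importanceWeight_add_smul (φ : S → Fin p → ℝ) (h : S → ℝ) (y : Fin m → S)
    (θ v : Fin p → ℝ) (t : ℝ) :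
    importanceWeight φ h y (θ + t • v)
      = tilt (importanceWeight φ h y θ) (fun k => v ⬝ᵥ φ (y k)) t := by
  funext s
  simp [importanceWeight, tilt, add_dotProduct, Real.exp_add]
  ring

omit [Fintype S] in
lemma importanceWeight_add (φ : S → Fin p → ℝ) (h : S → ℝ) (y : Fin m → S)
    (θ v : Fin p → ℝ) :
    importanceWeight φ h y (θ + v)
      = tilt (importanceWeight φ h y θ) (fun k => v ⬝ᵥ φ (y k)) 1 := by
  rw [← importanceWeight_add_smul, one_smul]

lemma pmf_eq (φ : S → Fin p → ℝ) (θ : Fin p → ℝ) (s : S) :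
    pmf φ θ s = gibbsWeight φ θ s / ∑ s, gibbsWeight φ θ s := rfl

lemma sum_pmf_mul (φ : S → Fin p → ℝ) (θ : Fin p → ℝ) (f : S → ℝ) :
    ∑ s, pmf φ θ s * f s = wmean (gibbsWeight φ θ) f := by
  simp only [pmf_eq, wmean, Finset.sum_div]
  exact Finset.sum_congr rfl fun s _ => by ring

lemma meanVec_eq (φ : S → Fin p → ℝ) (θ : Fin p → ℝ) (j : Fin p) :
    meanVec φ θ j = wmean (gibbsWeight φ θ) fun s => φ s j := sum_pmf_mul φ θ _

lemma covMat_eq [Nonempty S] (φ : S → Fin p → ℝ) (θ : Fin p → ℝ) :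
    covMat φ θ = Matrix.of fun i j =>
      wcov (gibbsWeight φ θ) (fun s => φ s i) (fun s => φ s j) := by
  ext i j
  rw [covMat, Matrix.of_apply, Matrix.of_apply,
    sum_pmf_mul φ θ fun s => (φ s i - meanVec φ θ i) * (φ s j - meanVec φ θ j),
    wcov_eq_wmean_centered (gibbsWeight_pos φ θ) _ _ (meanVec φ θ i) (meanVec φ θ j),
    ← meanVec_eq]
  simp

lemma dotProduct_covMat_mulVec [Nonempty S] (φ : S → Fin p → ℝ) (θ u v : Fin p → ℝ) :
    u ⬝ᵥ (covMat φ θ *ᵥ v)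
      = wcov (gibbsWeight φ θ) (fun s => u ⬝ᵥ φ s) (fun s => v ⬝ᵥ φ s) := by
  rw [wcov_dotProduct, covMat_eq]

lemma dotProduct_meanVec (φ : S → Fin p → ℝ) (θ u : Fin p → ℝ) :
    u ⬝ᵥ meanVec φ θ = wmean (gibbsWeight φ θ) (fun s => u ⬝ᵥ φ s) := by
  rw [wmean_dotProduct]; congr 1; funext j; exact meanVec_eq φ θ j

omit [Fintype S] in
lemma mean_dotProduct (φ : S → Fin p → ℝ) (x : Fin n → S) (θ : Fin p → ℝ) :
    (1 / (n : ℝ)) * ∑ i, θ ⬝ᵥ φ (x i) = θ ⬝ᵥ sampleMean φ x := by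
  simp only [dotProduct, sampleMean, Finset.mul_sum]
  rw [Finset.sum_comm]
  exact Finset.sum_congr rfl fun i _ => Finset.sum_congr rfl fun j _ => by ring

omit [Fintype S] in
/-- The MCMC likelihood along a line; this holds for the empty path as well, where both sides
contain `Real.log 0`. -/
lemma mcNegLogLik_add_smul (φ : S → Fin p → ℝ) (h : S → ℝ) (x : Fin n → S) (y : Fin m → S)
    (θ v : Fin p → ℝ) (t : ℝ) :
    mcNegLogLik φ h x y (θ + t • v) = -(θ ⬝ᵥ sampleMean φ x + t * (v ⬝ᵥ sampleMean φ x))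
      + Real.log (∑ k, tilt (fun k => 1 / (m : ℝ) * importanceWeight φ h y θ k)
        (fun k => v ⬝ᵥ φ (y k)) t k) := by
  rw [mcNegLogLik, mean_dotProduct, add_dotProduct, smul_dotProduct, smul_eq_mul, Finset.mul_sum]
  congr 3
  funext k
  have := congrFun (importanceWeight_add_smul φ h y θ v t) k
  rw [importanceWeight] at this
  rw [this, tilt, tilt]
  ring

omit [Fintype S] in
lemma wmean_one_div_mul_weight (a f : Fin m → ℝ) :
    wmean (fun k => 1 / (m : ℝ) * a k) f = wmean a f := by
  rcases Nat.eq_zero_or_pos m with rfl | hm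
  · simp [wmean]
  · exact wmean_smul_weight a f (by positivity)

omit [Fintype S] in
lemma hasDerivAt_mcNegLogLik (φ : S → Fin p → ℝ) {h : S → ℝ} (hh : ∀ s, 0 < h s)
    (x : Fin n → S) (y : Fin m → S) (θ v : Fin p → ℝ) :
    HasDerivAt (fun t : ℝ => mcNegLogLik φ h x y (θ + t • v))
      (-(v ⬝ᵥ sampleMean φ x) + wmean (importanceWeight φ h y θ) fun k => v ⬝ᵥ φ (y k)) 0 := by
  simp only [mcNegLogLik_add_smul]
  have hpos : ∀ k, 0 < 1 / (m : ℝ) * importanceWeight φ h y θ k := fun k =>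
    mul_pos (by have := k.pos; positivity) (importanceWeight_pos φ hh y θ k)
  have h1 := hasDerivAt_log_sum_tilt hpos (fun k => v ⬝ᵥ φ (y k)) 0
  rw [tilt_zero, wmean_one_div_mul_weight] at h1
  have h2 := (((hasDerivAt_id (0 : ℝ)).mul_const (v ⬝ᵥ sampleMean φ x)).const_add
    (θ ⬝ᵥ sampleMean φ x)).neg
  rw [one_mul] at h2
  exact h2.add h1

omit [Fintype S] in
lemma partialDeriv_mcNegLogLik (φ : S → Fin p → ℝ) {h : S → ℝ} (hh : ∀ s, 0 < h s)
    (x : Fin n → S) (y : Fin m → S) (j : Fin p) (θ : Fin p → ℝ) :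
    partialDeriv (mcNegLogLik φ h x y) j θ
      = -sampleMean φ x j + wmean (importanceWeight φ h y θ) fun k => φ (y k) j := by
  have := (hasDerivAt_mcNegLogLik φ hh x y θ (Pi.single j 1)).deriv
  simp only [single_dotProduct, one_mul] at this
  rw [partialDeriv, lineDeriv, this]

omit [Fintype S] in
lemma hessian_mcNegLogLik (φ : S → Fin p → ℝ) {h : S → ℝ} (hh : ∀ s, 0 < h s)
    (x : Fin n → S) (y : Fin m → S) (θ : Fin p → ℝ) :
    hessian (mcNegLogLik φ h x y) θ = Matrix.of fun i j =>
      wcov (importanceWeight φ h y θ) (fun k => φ (y k) i) (fun k => φ (y k) j) := by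
  ext i j
  rw [hessian, Matrix.of_apply, Matrix.of_apply, partialDeriv, lineDeriv]
  simp only [partialDeriv_mcNegLogLik φ hh, importanceWeight_add_smul, single_dotProduct, one_mul]
  have := (hasDerivAt_wmean_tilt (importanceWeight_pos φ hh y θ) (fun k => φ (y k) i)
    (fun k => φ (y k) j) 0).const_add (-sampleMean φ x j)
  rw [this.deriv, tilt_zero, wcov_comm]

/-- The score of the exact likelihood. -/
lemma partialDeriv_negLogLik [Nonempty S] (φ : S → Fin p → ℝ) (hn : 0 < n)
    (x : Fin n → S) (j : Fin p) (θ : Fin p → ℝ) :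
    partialDeriv (negLogLik φ x) j θ = -sampleMean φ x j + meanVec φ θ j := by
  have hpos := gibbsWeight_pos φ θ
  have h0 : ∀ t : ℝ, negLogLik φ x (θ + t • Pi.single j 1) =
      -(θ ⬝ᵥ sampleMean φ x + t * sampleMean φ x j)
        + Real.log (∑ s, tilt (gibbsWeight φ θ) (fun s => φ s j) t s) := fun t => by
    have h1 := gibbsWeight_add_smul φ θ (Pi.single j 1) t
    simp only [single_dotProduct, one_mul] at h1
    have h2 : ∀ i, Real.log (pmf φ (θ + t • Pi.single j 1) (x i)) =
        (θ + t • Pi.single j 1) ⬝ᵥ φ (x i)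
          - Real.log (∑ s, tilt (gibbsWeight φ θ) (fun s => φ s j) t s) := fun i => by
      rw [pmf_eq, h1, Real.log_div (tilt_pos hpos _ _ _).ne'
        (sum_weight_pos (tilt_pos hpos _ _)).ne', ← h1, gibbsWeight, Real.log_exp]
    have hn' : (n : ℝ) ≠ 0 := by positivity
    simp only [negLogLik, h2, Finset.sum_sub_distrib, mul_sub, mean_dotProduct]
    simp only [Finset.sum_const, Finset.card_univ, Fintype.card_fin, nsmul_eq_mul, add_dotProduct,
      smul_dotProduct, single_dotProduct, one_mul, smul_eq_mul]
    field_simp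
    ring
  rw [partialDeriv, lineDeriv]
  simp only [h0]
  have h1 := hasDerivAt_log_sum_tilt hpos (fun s => φ s j) 0
  rw [tilt_zero, ← meanVec_eq] at h1
  have h2 := (((hasDerivAt_id (0 : ℝ)).mul_const (sampleMean φ x j)).const_add
    (θ ⬝ᵥ sampleMean φ x)).neg
  rw [one_mul] at h2
  exact (h2.add h1).deriv

/-- The direction `(1, -w)` in which the projected score differentiates. -/
noncomputable def contrast {b : ℕ} (w : Fin b → ℝ) : Fin (b + 1) → ℝ := Fin.cons 1 (-w)

omit [Fintype S] in
/-- The projected score is the directional derivative along `(1, -w)`. -/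
lemma projectedScore_mcNegLogLik {b : ℕ} (φ : S → Fin (b + 1) → ℝ) {h : S → ℝ}
    (hh : ∀ s, 0 < h s) (x : Fin n → S) (y : Fin m → S) (w : Fin b → ℝ) (θ : Fin (b + 1) → ℝ) :
    projectedScore (mcNegLogLik φ h x y) w θ =
      -(contrast w ⬝ᵥ sampleMean φ x)
        + wmean (importanceWeight φ h y θ)
          fun k => contrast w ⬝ᵥ φ (y k) := by
  rw [wmean_dotProduct]
  simp only [contrast, projectedScore, partialDeriv_mcNegLogLik φ hh, dotProduct, Fin.sum_univ_succ,
    Fin.cons_zero, Fin.cons_succ, Pi.neg_apply, mul_add, mul_neg, neg_mul,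
    Finset.sum_add_distrib, Finset.sum_neg_distrib]
  ring

lemma projectedScore_negLogLik [Nonempty S] {b : ℕ} (φ : S → Fin (b + 1) → ℝ) (hn : 0 < n)
    (x : Fin n → S) (w : Fin b → ℝ) (θ : Fin (b + 1) → ℝ) :
    projectedScore (negLogLik φ x) w θ =
      -(contrast w ⬝ᵥ sampleMean φ x)
        + contrast w ⬝ᵥ meanVec φ θ := by
  simp only [contrast, projectedScore, partialDeriv_negLogLik φ hn, dotProduct, Fin.sum_univ_succ,
    Fin.cons_zero, Fin.cons_succ, Pi.neg_apply, mul_add, mul_neg, neg_mul,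
    Finset.sum_add_distrib, Finset.sum_neg_distrib]
  ring

end Derivatives

/-! ### Deterministic error bounds for the two estimators -/

section Deterministic

variable {p : ℕ}

lemma l1_nonneg (v : Fin p → ℝ) : 0 ≤ l1 v := Finset.sum_nonneg fun _ _ => abs_nonneg _

lemma l1_eq_add_compl (T : Finset (Fin p)) (v : Fin p → ℝ) :
    l1 v = ∑ j ∈ T, |v j| + ∑ j ∈ Tᶜ, |v j| := (Finset.sum_add_sum_compl T _).symm

lemma abs_dotProduct_le {u v : Fin p → ℝ} {c : ℝ} (hv : ∀ j, |v j| ≤ c) :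
    |u ⬝ᵥ v| ≤ l1 u * c := by
  rw [l1, Finset.sum_mul]
  refine (Finset.abs_sum_le_sum_abs _ _).trans (Finset.sum_le_sum fun j _ => ?_)
  rw [abs_mul]
  exact mul_le_mul_of_nonneg_left (hv j) (abs_nonneg _)

lemma abs_bilinear_sub_le {A H : Matrix (Fin p) (Fin p) ℝ} {η : ℝ}
    (hAH : ∀ i j, |A i j - H i j| ≤ η) (u v : Fin p → ℝ) :
    |u ⬝ᵥ (A *ᵥ v) - u ⬝ᵥ (H *ᵥ v)| ≤ η * l1 u * l1 v := by
  rw [← dotProduct_sub, ← Matrix.sub_mulVec]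
  have h1 : ∀ i, |((A - H) *ᵥ v) i| ≤ l1 v * η := fun i => by
    rw [Matrix.mulVec, dotProduct_comm]
    exact abs_dotProduct_le fun j => hAH i j
  refine (abs_dotProduct_le h1).trans (le_of_eq (by ring))

lemma sq_sum_abs_le {T : Finset (Fin p)} {s : ℝ} (hT : (T.card : ℝ) ≤ s) (v : Fin p → ℝ) :
    (∑ j ∈ T, |v j|) ^ 2 ≤ s * ∑ j, v j ^ 2 := by
  have h0 : 0 ≤ ∑ j ∈ T, v j ^ 2 := Finset.sum_nonneg fun _ _ => sq_nonneg _
  calc (∑ j ∈ T, |v j|) ^ 2 ≤ T.card * ∑ j ∈ T, |v j| ^ 2 := sq_sum_le_card_mul_sum_sq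
    _ = T.card * ∑ j ∈ T, v j ^ 2 := by simp only [sq_abs]
    _ ≤ s * ∑ j ∈ T, v j ^ 2 := mul_le_mul_of_nonneg_right hT h0
    _ ≤ s * ∑ j, v j ^ 2 := mul_le_mul_of_nonneg_left
        (Finset.sum_le_univ_sum_of_nonneg fun _ => sq_nonneg _) ((Nat.cast_nonneg _).trans hT)

/-- The `ℓ₁`-norm decomposes with respect to a set carrying the sparse vector. -/
lemma l1_add_sub_l1_ge {T : Finset (Fin p)} {θ : Fin p → ℝ} (hθ : ∀ j, j ∉ T → θ j = 0)
    (v : Fin p → ℝ) :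
    ∑ j ∈ Tᶜ, |v j| - ∑ j ∈ T, |v j| ≤ l1 (θ + v) - l1 θ := by
  rw [l1_eq_add_compl T (θ + v), l1_eq_add_compl T θ]
  have h1 : ∑ j ∈ Tᶜ, |(θ + v) j| = ∑ j ∈ Tᶜ, |v j| := Finset.sum_congr rfl fun j hj => by
    rw [Pi.add_apply, hθ j (Finset.mem_compl.1 hj), zero_add]
  have h2 : ∑ j ∈ Tᶜ, |θ j| = 0 := Finset.sum_eq_zero fun j hj => by
    rw [hθ j (Finset.mem_compl.1 hj), abs_zero]
  have h3 : ∑ j ∈ T, |θ j| ≤ ∑ j ∈ T, |(θ + v) j| + ∑ j ∈ T, |v j| := by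
    rw [← Finset.sum_add_distrib]
    refine Finset.sum_le_sum fun j _ => ?_
    have := abs_sub (θ j + v j) (v j)
    rwa [add_sub_cancel_right] at this
  linarith

/-- Restricted eigenvalue condition for a matrix that is entrywise close to a positive definite
one. -/
lemma restricted_eigenvalue {A H : Matrix (Fin p) (Fin p) ℝ} {η lam z s : ℝ} (hη : 0 ≤ η)
    (hAH : ∀ i j, |A i j - H i j| ≤ η) (hH : ∀ v : Fin p → ℝ, lam * ∑ j, v j ^ 2 ≤ v ⬝ᵥ (H *ᵥ v))
    {T : Finset (Fin p)} (hT : (T.card : ℝ) ≤ s) {v : Fin p → ℝ}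
    (hv : ∑ j ∈ Tᶜ, |v j| ≤ z * ∑ j ∈ T, |v j|) (hs : η * ((1 + z) ^ 2 * s) ≤ lam / 2) :
    lam / 2 * ∑ j, v j ^ 2 ≤ v ⬝ᵥ (A *ᵥ v) := by
  have h1 := (abs_le.1 (abs_bilinear_sub_le hAH v v)).1
  have h2 := hH v
  have hT0 : 0 ≤ ∑ j ∈ T, |v j| := Finset.sum_nonneg fun _ _ => abs_nonneg _
  have h3 : l1 v ≤ (1 + z) * ∑ j ∈ T, |v j| := by rw [l1_eq_add_compl T]; linarith
  have h4 : l1 v * l1 v ≤ (1 + z) ^ 2 * (s * ∑ j, v j ^ 2) := by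
    calc l1 v * l1 v ≤ ((1 + z) * ∑ j ∈ T, |v j|) * ((1 + z) * ∑ j ∈ T, |v j|) :=
          mul_self_le_mul_self (l1_nonneg v) h3
      _ = (1 + z) ^ 2 * (∑ j ∈ T, |v j|) ^ 2 := by ring
      _ ≤ _ := mul_le_mul_of_nonneg_left (sq_sum_abs_le hT v) (sq_nonneg _)
  have h5 : η * l1 v * l1 v ≤ lam / 2 * ∑ j, v j ^ 2 := by
    calc η * l1 v * l1 v = η * (l1 v * l1 v) := by ring
      _ ≤ η * ((1 + z) ^ 2 * (s * ∑ j, v j ^ 2)) := mul_le_mul_of_nonneg_left h4 hη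
      _ = η * ((1 + z) ^ 2 * s) * ∑ j, v j ^ 2 := by ring
      _ ≤ _ := mul_le_mul_of_nonneg_right hs (Finset.sum_nonneg fun _ _ => sq_nonneg _)
  linarith

/-- A convex quadratic bound against the `ℓ₁`-norm on a small set bounds that norm. -/
lemma sum_abs_le_of_sq_le {T : Finset (Fin p)} {s c d : ℝ} (hT : (T.card : ℝ) ≤ s) (hc : 0 < c)
    (hd : 0 ≤ d) {v : Fin p → ℝ} (h : c * ∑ j, v j ^ 2 ≤ d * ∑ j ∈ T, |v j|) :
    ∑ j ∈ T, |v j| ≤ s * d / c := by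
  have hs : 0 ≤ s := (Nat.cast_nonneg _).trans hT
  have hT0 : 0 ≤ ∑ j ∈ T, |v j| := Finset.sum_nonneg fun _ _ => abs_nonneg _
  rcases hT0.eq_or_lt with h0 | h0
  · rw [← h0]; positivity
  · have h1 := sq_sum_abs_le hT v
    rw [le_div_iff₀ hc]
    have h2 : (∑ j ∈ T, |v j| * c) * (∑ j ∈ T, |v j|) ≤ s * d * ∑ j ∈ T, |v j| := by
      rw [← Finset.sum_mul]
      calc (∑ j ∈ T, |v j|) * c * (∑ j ∈ T, |v j|) = c * (∑ j ∈ T, |v j|) ^ 2 := by ring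
        _ ≤ c * (s * ∑ j, v j ^ 2) := mul_le_mul_of_nonneg_left h1 hc.le
        _ = s * (c * ∑ j, v j ^ 2) := by ring
        _ ≤ s * (d * ∑ j ∈ T, |v j|) := mul_le_mul_of_nonneg_left h hs
        _ = _ := by ring
    rw [Finset.sum_mul]
    exact le_of_mul_le_mul_right h2 h0

lemma exp_sub_one_le (x : ℝ) : Real.exp x - 1 ≤ x * Real.exp x := by
  have h := Real.add_one_le_exp (-x)
  have h2 : Real.exp (-x) * Real.exp x = 1 := by rw [← Real.exp_add]; simp
  nlinarith [Real.exp_pos x]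

/-- **Elastic net.** The basic inequality localizes the error in a fixed `ℓ₁`-ball by means of the
ridge term alone; on that ball the log-partition function is strongly convex in the directions of
the cone, which gives the rate `λ₁`. -/
theorem exists_elasticNet_l1_error_le {K B C lam s : ℝ} (hK : 0 ≤ K) (hB : 0 ≤ B) (hC : 0 ≤ C)
    (hlam : 0 < lam) (hs : 0 ≤ s) :
    ∃ C' η₀ : ℝ, 0 ≤ C' ∧ 0 < η₀ ∧ ∀ {p m : ℕ} [NeZero m] (a : Fin m → ℝ)
      (ψ : Fin m → Fin p → ℝ) (xbar θ v : Fin p → ℝ) (H : Matrix (Fin p) (Fin p) ℝ)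
      (T : Finset (Fin p)) (η lam₁ lam₂ : ℝ),
      (∀ k, 0 < a k) → (∀ k j, |ψ k j| ≤ K) → (∀ j, |θ j| ≤ B) →
      (∀ j, j ∉ T → θ j = 0) → (T.card : ℝ) ≤ s →
      (∀ v : Fin p → ℝ, lam * ∑ j, v j ^ 2 ≤ v ⬝ᵥ (H *ᵥ v)) →
      0 ≤ η → η ≤ η₀ →
      (∀ i j, |wcov a (fun k => ψ k i) (fun k => ψ k j) - H i j| ≤ η) →
      0 < lam₁ → 0 < lam₂ → lam₁ ≤ C * lam₂ → lam₂ ≤ C * lam₁ →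
      (∀ j, |-xbar j + wmean a fun k => ψ k j| ≤ lam₁ / 2) →
      (-(v ⬝ᵥ xbar) + (Real.log (∑ k, tilt a (fun k => v ⬝ᵥ ψ k) 1 k) - Real.log (∑ k, a k))
        + lam₁ * (l1 (θ + v) - l1 θ) + lam₂ * (∑ j, (θ + v) j ^ 2 - ∑ j, θ j ^ 2) ≤ 0) →
      l1 v ≤ C' * lam₁ := by
  set A : ℝ := 3 / 2 + 2 * B * C with hA
  set R : ℝ := (1 + 2 * A) * (s * (A * C)) with hR
  set c : ℝ := 1 / 2 * Real.exp (-(2 * (R * K))) * (lam / 2) with hc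
  have hA0 : 0 < A := by positivity
  have hc0 : 0 < c := by positivity
  refine ⟨(1 + 2 * A) * (s * A / c), lam / 2 / ((1 + 2 * A) ^ 2 * s + 1), by positivity,
    by positivity, ?_⟩
  intro p m _ a ψ xbar θ v H T η lam₁ lam₂ ha hψ hθB hθT hT hH hη0 hη hAH h1 h2 h12 h21 hg hmin
  set x := ∑ j ∈ T, |v j| with hx
  set y := ∑ j ∈ Tᶜ, |v j| with hy
  set N := ∑ j, v j ^ 2 with hN
  have hx0 : 0 ≤ x := Finset.sum_nonneg fun _ _ => abs_nonneg _
  have hy0 : 0 ≤ y := Finset.sum_nonneg fun _ _ => abs_nonneg _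
  have hN0 : 0 ≤ N := Finset.sum_nonneg fun _ _ => sq_nonneg _
  have hl1 : l1 v = x + y := l1_eq_add_compl T v
  set u : Fin m → ℝ := fun k => v ⬝ᵥ ψ k with hu
  set Br := Real.log (∑ k, tilt a u 1 k) - Real.log (∑ k, a k) - wmean a u with hBr
  have hpen := l1_add_sub_l1_ge hθT v
  have hgrad : |v ⬝ᵥ fun j => -xbar j + wmean a fun k => ψ k j| ≤ l1 v * (lam₁ / 2) :=
    abs_dotProduct_le hg
  have hgrad' : (v ⬝ᵥ fun j => -xbar j + wmean a fun k => ψ k j) = -(v ⬝ᵥ xbar) + wmean a u := by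
    rw [hu, wmean_dotProduct, ← dotProduct_neg, ← dotProduct_add]; rfl
  have hridge : N - 2 * B * x ≤ ∑ j, (θ + v) j ^ 2 - ∑ j, θ j ^ 2 := by
    have e1 : ∑ j, (θ + v) j ^ 2 - ∑ j, θ j ^ 2 = N + 2 * ∑ j, θ j * v j := by
      rw [hN, Finset.mul_sum, ← Finset.sum_sub_distrib, ← Finset.sum_add_distrib]
      exact Finset.sum_congr rfl fun j _ => by rw [Pi.add_apply]; ring
    have e2 : ∑ j, θ j * v j = ∑ j ∈ T, θ j * v j := by
      refine (Finset.sum_subset (Finset.subset_univ T) fun j _ hj => ?_).symm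
      rw [hθT j hj, zero_mul]
    have e3 : |∑ j ∈ T, θ j * v j| ≤ B * x := by
      rw [hx, Finset.mul_sum]
      refine (Finset.abs_sum_le_sum_abs _ _).trans (Finset.sum_le_sum fun j _ => ?_)
      rw [abs_mul]
      exact mul_le_mul_of_nonneg_right (hθB j) (abs_nonneg _)
    rw [e1, e2]
    linarith [(abs_le.1 e3).1]
  have hbasic : Br + lam₂ * N + lam₁ / 2 * y ≤ A * lam₁ * x := by
    have t1 := mul_le_mul_of_nonneg_left hpen h1.le
    have t2 := mul_le_mul_of_nonneg_left hridge h2.le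
    have t3 := (abs_le.1 hgrad).1
    rw [hgrad', hl1] at t3
    have t4 : 2 * B * x * lam₂ ≤ 2 * B * x * (C * lam₁) :=
      mul_le_mul_of_nonneg_left h21 (by positivity)
    rw [hA]
    linarith
  have hBr0 : 0 ≤ Br := by
    have h0 := log_sum_tilt_sub_ge (a := a) (u := u) (ε := l1 v * K) ha fun k =>
      abs_dotProduct_le (hψ k)
    exact le_trans (mul_nonneg (by positivity) (wcov_self_nonneg ha u)) h0
  -- both the Bregman divergence and the ridge term are nonnegative, so the error lies in a cone
  have hcone : y ≤ 2 * A * x := by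
    have : lam₁ / 2 * y ≤ lam₁ / 2 * (2 * A * x) := by
      have : 0 ≤ lam₂ * N := by positivity
      linarith only [hbasic, hBr0, this]
    exact le_of_mul_le_mul_left this (by positivity)
  have hl1x : l1 v ≤ (1 + 2 * A) * x := by rw [hl1]; linarith
  -- discarding the Bregman divergence: `λ₂ N` is of the order `λ₁ x`, and `λ₁ ≲ λ₂` cancels
  have hloc : l1 v ≤ R := by
    have t1 : lam₂ * N ≤ (A * C * lam₂) * x := by
      have : A * lam₁ * x ≤ A * (C * lam₂) * x := by gcongr
      have : 0 ≤ lam₁ / 2 * y := by positivity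
      linarith
    have t2 := sum_abs_le_of_sq_le hT h2 (by positivity) t1
    rw [show s * (A * C * lam₂) / lam₂ = s * (A * C) by field_simp] at t2
    exact hl1x.trans (mul_le_mul_of_nonneg_left t2 (by positivity))
  have hη' : η * ((1 + 2 * A) ^ 2 * s) ≤ lam / 2 := by
    have := (le_div_iff₀ (by positivity)).1 hη
    rw [mul_add, mul_one] at this
    linarith
  -- the exponents of the tilt are now bounded by `R K`, which makes the divergence quadratic
  have hBrN : c * N ≤ Br := by
    have t1 := log_sum_tilt_sub_ge (a := a) (u := u) (ε := R * K) ha fun k =>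
      (abs_dotProduct_le (hψ k)).trans (mul_le_mul_of_nonneg_right hloc hK)
    have t2 := restricted_eigenvalue (A := Matrix.of fun i j =>
        wcov a (fun k => ψ k i) (fun k => ψ k j)) hη0 hAH hH hT (z := 2 * A)
        hcone hη'
    rw [← wcov_dotProduct] at t2
    refine le_trans ?_ t1
    rw [hc, mul_assoc]
    exact mul_le_mul_of_nonneg_left t2 (by positivity)
  have t1 : c * N ≤ (A * lam₁) * x := by
    have : 0 ≤ lam₁ / 2 * y := by positivity
    have : 0 ≤ lam₂ * N := by positivity
    linarith
  have t2 := sum_abs_le_of_sq_le hT hc0 (by positivity) t1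
  calc l1 v ≤ (1 + 2 * A) * x := hl1x
    _ ≤ (1 + 2 * A) * (s * (A * lam₁) / c) := mul_le_mul_of_nonneg_left t2 (by positivity)
    _ = _ := by ring

set_option maxHeartbeats 400000 in
/-- **Lasso for the projection direction.** The error of the Hessian at the estimated parameter is
of the order `λ₁` and so not negligible with respect to the penalty; it enters, however, only
through its product with the standard deviation of the fitted direction, and is absorbed by the
quadratic term. -/
theorem exists_lasso_l1_error_le {K V C C₁ lam s : ℝ} (hK : 0 ≤ K) (hV : 0 ≤ V) (hC : 0 ≤ C)
    (hC₁ : 0 ≤ C₁) (hlam : 0 < lam) (hs : 0 ≤ s) :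
    ∃ C' η₀ : ℝ, 0 ≤ C' ∧ 0 < η₀ ∧ ∀ {p m : ℕ} [NeZero m] (a : Fin m → ℝ)
      (ψ : Fin m → Fin p → ℝ) (vθ vs w v : Fin p → ℝ) (H : Matrix (Fin p) (Fin p) ℝ)
      (T : Finset (Fin p)) (η lam₁ lam' : ℝ),
      (∀ k, 0 < a k) → (∀ k j, |ψ k j| ≤ K) →
      (∀ j, j ∉ T → w j = 0) → (T.card : ℝ) ≤ s →
      (∀ v : Fin p → ℝ, lam * ∑ j, v j ^ 2 ≤ v ⬝ᵥ (H *ᵥ v)) →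
      0 ≤ η → η ≤ η₀ →
      (∀ i j, |wcov a (fun k => ψ k i) (fun k => ψ k j) - H i j| ≤ η) →
      0 < lam₁ → 0 < lam' → lam₁ ≤ 1 → lam₁ ≤ C * lam' → lam' ≤ C * lam₁ →
      l1 vθ ≤ C₁ * lam₁ → l1 vs ≤ V → η * V ≤ lam' / 2 → v ⬝ᵥ (H *ᵥ vs) = 0 →
      (1 / 2 * wcov (tilt a (fun k => vθ ⬝ᵥ ψ k) 1) (fun k => v ⬝ᵥ ψ k) (fun k => v ⬝ᵥ ψ k)
        - wcov (tilt a (fun k => vθ ⬝ᵥ ψ k) 1) (fun k => v ⬝ᵥ ψ k) (fun k => vs ⬝ᵥ ψ k)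
        + lam' * (l1 (w + v) - l1 w) ≤ 0) →
      l1 v ≤ C' * lam₁ := by
  set E : ℝ := Real.exp (2 * (C₁ * K)) with hE
  set C₅ : ℝ := 2 * (V * K) * (2 * (C₁ * K) * E) with hC₅
  set c : ℝ := 1 / 4 * (Real.exp (-(2 * (C₁ * K))) * (lam / 2)) with hc
  have hC₅0 : 0 ≤ C₅ := by positivity
  have hc0 : 0 < c := by positivity
  refine ⟨6 * (C₅ ^ 2 * C) + 6 * (s * (5 / 2 * C) / c), lam / 2 / ((1 + 5) ^ 2 * s + 1),
    by positivity, by positivity, ?_⟩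
  intro p m _ a ψ vθ vs w v H T η lam₁ lam' ha hψ hwT hT hH hη0 hη hAH h1 h' h1le h1' h'1 hvθ hvs
    hηV hHv hmin
  set x := ∑ j ∈ T, |v j| with hx
  set y := ∑ j ∈ Tᶜ, |v j| with hy
  set N := ∑ j, v j ^ 2 with hN
  have hx0 : 0 ≤ x := Finset.sum_nonneg fun _ _ => abs_nonneg _
  have hy0 : 0 ≤ y := Finset.sum_nonneg fun _ _ => abs_nonneg _
  have hN0 : 0 ≤ N := Finset.sum_nonneg fun _ _ => sq_nonneg _
  have hl1 : l1 v = x + y := l1_eq_add_compl T v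
  set u : Fin m → ℝ := fun k => vθ ⬝ᵥ ψ k with hu
  set f : Fin m → ℝ := fun k => v ⬝ᵥ ψ k with hf
  set g : Fin m → ℝ := fun k => vs ⬝ᵥ ψ k with hg
  set Q := wcov (tilt a u 1) f f with hQ
  have hQ0 : 0 ≤ Q := wcov_self_nonneg (tilt_pos ha u 1) f
  have hpen := l1_add_sub_l1_ge hwT v
  have hub : ∀ k, |u k| ≤ C₁ * lam₁ * K := fun k =>
    (abs_dotProduct_le (hψ k)).trans (mul_le_mul_of_nonneg_right hvθ hK)
  have hε1 : C₁ * lam₁ * K ≤ C₁ * K := by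
    rw [mul_right_comm]; exact mul_le_of_le_one_right (by positivity) h1le
  have hgb : ∀ k, |g k| ≤ V * K := fun k =>
    (abs_dotProduct_le (hψ k)).trans (mul_le_mul_of_nonneg_right hvs hK)
  have htilt : tilt (tilt a u 1) (fun k => -u k) 1 = a := by
    funext k
    simp only [tilt, one_mul, mul_assoc, ← Real.exp_add]
    simp
  -- `Q` is the variance under the tilted weights, so the tilt is undone rather than applied
  have hcov1 : |wcov a f g - wcov (tilt a u 1) f g| ≤ C₅ * lam₁ * Real.sqrt Q := by
    have t1 := abs_wcov_tilt_sub_le (a := tilt a u 1) (u := fun k => -u k)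
      (ε := C₁ * lam₁ * K) (tilt_pos ha u 1) (fun k => by rw [abs_neg]; exact hub k) f hgb
    rw [htilt] at t1
    refine t1.trans (mul_le_mul_of_nonneg_right ?_ (Real.sqrt_nonneg _))
    have t2 := exp_sub_one_le (2 * (C₁ * lam₁ * K))
    have t3 : Real.exp (2 * (C₁ * lam₁ * K)) ≤ E := Real.exp_le_exp.2 (by linarith)
    have t4 : 2 * (C₁ * lam₁ * K) * Real.exp (2 * (C₁ * lam₁ * K))
        ≤ 2 * (C₁ * lam₁ * K) * E := mul_le_mul_of_nonneg_left t3 (by positivity)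
    calc 2 * (V * K) * (Real.exp (2 * (C₁ * lam₁ * K)) - 1)
        ≤ 2 * (V * K) * (2 * (C₁ * lam₁ * K) * E) :=
          mul_le_mul_of_nonneg_left (t2.trans t4) (by positivity)
      _ = _ := by rw [hC₅]; ring
  have hcov2 : |wcov a f g| ≤ lam' / 2 * l1 v := by
    have t1 := abs_bilinear_sub_le (A := Matrix.of fun i j =>
        wcov a (fun k => ψ k i) (fun k => ψ k j)) hAH v vs
    rw [← wcov_dotProduct, hHv, sub_zero] at t1
    refine t1.trans ?_
    calc η * l1 v * l1 vs ≤ η * l1 v * V :=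
          mul_le_mul_of_nonneg_left hvs (mul_nonneg hη0 (l1_nonneg v))
      _ = η * V * l1 v := by ring
      _ ≤ _ := mul_le_mul_of_nonneg_right hηV (l1_nonneg v)
  set e := C₅ ^ 2 * C * lam₁ with he
  have he0 : 0 ≤ e := by positivity
  -- half of the quadratic term absorbs the error of the Hessian, at the price `(C₅ λ₁)² ≤ λ' e`
  have hbasic : 1 / 4 * Q + lam' / 2 * y ≤ 3 / 2 * lam' * x + lam' * e := by
    have t1 : C₅ * lam₁ * Real.sqrt Q ≤ 1 / 4 * Q + (C₅ * lam₁) ^ 2 := by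
      linarith only [sq_nonneg (1 / 2 * Real.sqrt Q - C₅ * lam₁), Real.sq_sqrt hQ0]
    have t2 : (C₅ * lam₁) ^ 2 ≤ lam' * e := by
      calc (C₅ * lam₁) ^ 2 = C₅ ^ 2 * lam₁ * lam₁ := by ring
        _ ≤ C₅ ^ 2 * lam₁ * (C * lam') := mul_le_mul_of_nonneg_left h1' (by positivity)
        _ = _ := by rw [he]; ring
    have t3 := mul_le_mul_of_nonneg_left hpen h'.le
    have t4 := (abs_le.1 hcov1).1
    have t5 := (abs_le.1 hcov2).2
    rw [hl1] at t5
    linarith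
  have hy3 : y ≤ 3 * x + 2 * e := by
    have : lam' / 2 * y ≤ lam' / 2 * (3 * x + 2 * e) := by linarith only [hbasic, hQ0]
    exact le_of_mul_le_mul_left this (by positivity)
  rw [hl1]
  have hrest : 0 ≤ 6 * (s * (5 / 2 * C) / c) * lam₁ := by positivity
  -- either the error on the support is already of the order `λ₁`, or `e` is absorbed by the cone
  rcases le_total x e with hxe | hex
  · calc x + y ≤ 6 * e := by linarith
      _ ≤ _ := by rw [he, add_mul]; linarith
  · have hcone : y ≤ 5 * x := by linarith
    have hη' : η * ((1 + 5) ^ 2 * s) ≤ lam / 2 := by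
      have := (le_div_iff₀ (by positivity)).1 hη
      rw [mul_add, mul_one] at this
      linarith
    have t1 := restricted_eigenvalue (A := Matrix.of fun i j =>
        wcov a (fun k => ψ k i) (fun k => ψ k j)) hη0 hAH hH hT (z := 5)
        hcone hη'
    rw [← wcov_dotProduct] at t1
    have t2 := exp_mul_wcov_self_le_wcov_tilt (a := a) (u := u) (ε := C₁ * K) ha
      (fun k => (hub k).trans hε1) f
    have t3 : c * N ≤ 1 / 4 * Q := by
      refine le_trans ?_ (mul_le_mul_of_nonneg_left t2 (by norm_num))
      rw [hc, mul_assoc, mul_assoc]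
      exact mul_le_mul_of_nonneg_left (mul_le_mul_of_nonneg_left t1 (Real.exp_pos _).le)
        (by norm_num)
    have t4 : c * N ≤ (5 / 2 * lam') * x := by
      have : lam' * e ≤ lam' * x := mul_le_mul_of_nonneg_left hex h'.le
      have : 0 ≤ lam' / 2 * y := by positivity
      linarith
    have t5 := sum_abs_le_of_sq_le hT hc0 (by positivity) t4
    have t6 : s * (5 / 2 * lam') / c ≤ s * (5 / 2 * C) / c * lam₁ := by
      calc s * (5 / 2 * lam') / c ≤ s * (5 / 2 * (C * lam₁)) / c :=
            div_le_div_of_nonneg_right (mul_le_mul_of_nonneg_left (by linarith) hs) hc0.le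
        _ = _ := by ring
    have : 0 ≤ 6 * (C₅ ^ 2 * C) * lam₁ := by positivity
    linarith

/-- **Expansion of the decorrelated score.** Replacing `w` by its population value, the nuisance
parameter by its true value and the MCMC mean by the exact mean costs only products of two
estimation errors and the error `δ` of a single Monte Carlo average. -/
theorem exists_score_expansion_le {K V C₁ C₂ : ℝ} (hK : 0 ≤ K) (hV : 0 ≤ V)
    (hC₁ : 0 ≤ C₁) (hC₂ : 0 ≤ C₂) :
    ∃ C' : ℝ, 0 ≤ C' ∧ ∀ {p m : ℕ} [NeZero m] (a : Fin m → ℝ)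
      (ψ : Fin m → Fin p → ℝ) (xbar v₀ vs v : Fin p → ℝ) (H : Matrix (Fin p) (Fin p) ℝ)
      (μs η δ lam₁ : ℝ),
      (∀ k, 0 < a k) → (∀ k j, |ψ k j| ≤ K) → 0 ≤ η →
      (∀ i j, |wcov a (fun k => ψ k i) (fun k => ψ k j) - H i j| ≤ η) →
      0 < lam₁ → lam₁ ≤ 1 →
      (∀ j, |-xbar j + wmean a fun k => ψ k j| ≤ lam₁ / 2) →
      |wmean a (fun k => vs ⬝ᵥ ψ k) - μs| ≤ δ →
      l1 v₀ ≤ C₁ * lam₁ → l1 vs ≤ V → l1 v ≤ C₂ * lam₁ → v₀ ⬝ᵥ (H *ᵥ vs) = 0 →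
      |(-((vs - v) ⬝ᵥ xbar) + wmean (tilt a (fun k => v₀ ⬝ᵥ ψ k) 1) fun k => (vs - v) ⬝ᵥ ψ k)
        - (-(vs ⬝ᵥ xbar) + μs)| ≤ C' * (lam₁ * (lam₁ + η)) + δ := by
  set E : ℝ := Real.exp (2 * (C₁ * K)) with hE
  refine ⟨C₁ * V + 2 * (V * K) * (2 * (C₁ * K) * E) * (C₁ * K) + C₂ / 2
    + 2 * (C₁ * K) * E * (C₂ * K), by positivity, ?_⟩
  intro p m _ a ψ xbar v₀ vs v H μs η δ lam₁ ha hψ hη0 hAH h1 h1le hg hδ hv₀ hvs hv hHv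
  set u : Fin m → ℝ := fun k => v₀ ⬝ᵥ ψ k with hu
  have hub : ∀ k, |u k| ≤ C₁ * lam₁ * K := fun k =>
    (abs_dotProduct_le (hψ k)).trans (mul_le_mul_of_nonneg_right hv₀ hK)
  have hε1 : C₁ * lam₁ * K ≤ C₁ * K := by
    rw [mul_right_comm]; exact mul_le_of_le_one_right (by positivity) h1le
  have hfb : ∀ k, |vs ⬝ᵥ ψ k| ≤ V * K := fun k =>
    (abs_dotProduct_le (hψ k)).trans (mul_le_mul_of_nonneg_right hvs hK)
  have hvb : ∀ k, |v ⬝ᵥ ψ k| ≤ C₂ * lam₁ * K := fun k =>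
    (abs_dotProduct_le (hψ k)).trans (mul_le_mul_of_nonneg_right hv hK)
  have hexp : Real.exp (2 * (C₁ * lam₁ * K)) - 1 ≤ 2 * (C₁ * K) * E * lam₁ := by
    refine (exp_sub_one_le _).trans ?_
    have t3 : Real.exp (2 * (C₁ * lam₁ * K)) ≤ E := Real.exp_le_exp.2 (by linarith)
    calc 2 * (C₁ * lam₁ * K) * Real.exp (2 * (C₁ * lam₁ * K))
        ≤ 2 * (C₁ * lam₁ * K) * E := mul_le_mul_of_nonneg_left t3 (by positivity)
      _ = _ := by ring
  -- the quadratic remainder of the expansion in the nuisance parameter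
  have b1 : |wmean (tilt a u 1) (fun k => vs ⬝ᵥ ψ k) - wmean a (fun k => vs ⬝ᵥ ψ k)
      - wcov a (fun k => vs ⬝ᵥ ψ k) u|
      ≤ 2 * (V * K) * (2 * (C₁ * K) * E) * (C₁ * K) * (lam₁ * lam₁) := by
    refine (abs_wmean_tilt_sub_sub_wcov_le ha hub hfb).trans ?_
    calc 2 * (V * K) * (Real.exp (2 * (C₁ * lam₁ * K)) - 1) * (C₁ * lam₁ * K)
        ≤ 2 * (V * K) * (2 * (C₁ * K) * E * lam₁) * (C₁ * lam₁ * K) := by gcongr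
      _ = _ := by ring
  -- the linear term, which vanishes in the population by orthogonality
  have b2 : |wcov a (fun k => vs ⬝ᵥ ψ k) u| ≤ C₁ * V * (lam₁ * η) := by
    have t1 := abs_bilinear_sub_le (A := Matrix.of fun i j =>
        wcov a (fun k => ψ k i) (fun k => ψ k j)) hAH v₀ vs
    rw [← wcov_dotProduct, hHv, sub_zero, wcov_comm] at t1
    refine t1.trans ?_
    calc η * l1 v₀ * l1 vs ≤ η * (C₁ * lam₁) * V := by
          have := l1_nonneg v₀
          have := l1_nonneg vs
          gcongr
      _ = _ := by ring
  -- the score at the true parameter along the error of the projection direction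
  have b3 : |-(v ⬝ᵥ xbar) + wmean a fun k => v ⬝ᵥ ψ k| ≤ C₂ / 2 * (lam₁ * lam₁) := by
    have t1 := abs_dotProduct_le (u := v) hg
    have t2 : (v ⬝ᵥ fun j => -xbar j + wmean a fun k => ψ k j)
        = -(v ⬝ᵥ xbar) + wmean a fun k => v ⬝ᵥ ψ k := by
      rw [wmean_dotProduct, ← dotProduct_neg, ← dotProduct_add]; rfl
    rw [t2] at t1
    refine t1.trans ?_
    calc l1 v * (lam₁ / 2) ≤ C₂ * lam₁ * (lam₁ / 2) := by gcongr
      _ = _ := by ring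
  -- the interaction of the two estimation errors
  have b4 : |wmean (tilt a u 1) (fun k => v ⬝ᵥ ψ k) - wmean a (fun k => v ⬝ᵥ ψ k)|
      ≤ 2 * (C₁ * K) * E * (C₂ * K) * (lam₁ * lam₁) := by
    refine (abs_wmean_tilt_sub_le ha hub _).trans ?_
    have t1 : (wmean a fun k => |v ⬝ᵥ ψ k|) ≤ C₂ * lam₁ * K :=
      (wmean_mono ha hvb).trans (wmean_const ha _).le
    have t2 : 0 ≤ wmean a fun k => |v ⬝ᵥ ψ k| := wmean_nonneg ha fun k => abs_nonneg _
    calc (Real.exp (2 * (C₁ * lam₁ * K)) - 1) * (wmean a fun k => |v ⬝ᵥ ψ k|)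
        ≤ (2 * (C₁ * K) * E * lam₁) * (C₂ * lam₁ * K) := by gcongr
      _ = _ := by ring
  have e1 : wmean (tilt a u 1) (fun k => (vs - v) ⬝ᵥ ψ k)
      = wmean (tilt a u 1) (fun k => vs ⬝ᵥ ψ k) - wmean (tilt a u 1) (fun k => v ⬝ᵥ ψ k) := by
    simp only [sub_dotProduct, wmean_sub]
  have hη1 : 0 ≤ lam₁ * η := by positivity
  rw [e1, sub_dotProduct]
  rw [abs_le] at *
  have h11 : 0 ≤ lam₁ * lam₁ := by positivity
  have p1 : 0 ≤ 2 * (V * K) * (2 * (C₁ * K) * E) * (C₁ * K) * (lam₁ * η) := by positivity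
  have p2 : 0 ≤ C₁ * V * (lam₁ * lam₁) := by positivity
  have p3 : 0 ≤ C₂ / 2 * (lam₁ * η) := by positivity
  have p4 : 0 ≤ 2 * (C₁ * K) * E * (C₂ * K) * (lam₁ * η) := by positivity
  constructor <;> linarith [b1.1, b1.2, b2.1, b2.2, b3.1, b3.2, b4.1, b4.2, hδ.1, hδ.2]

end Deterministic

/-! ### Concentration for Markov chains with a spectral gap -/

section MarkovChain

variable {S : Type*} [Fintype S]

/-- The norm of `L²(h)`. -/
noncomputable def l2norm (h f : S → ℝ) : ℝ := Real.sqrt (∑ y, f y ^ 2 * h y)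

variable {h : S → ℝ}

lemma l2norm_nonneg (h f : S → ℝ) : 0 ≤ l2norm h f := Real.sqrt_nonneg _

lemma sq_l2norm (hh : ∀ y, 0 < h y) (f : S → ℝ) : l2norm h f ^ 2 = ∑ y, f y ^ 2 * h y :=
  Real.sq_sqrt (Finset.sum_nonneg fun y _ => mul_nonneg (sq_nonneg _) (hh y).le)

lemma l2norm_eq_norm (hh : ∀ y, 0 < h y) (f : S → ℝ) :
    l2norm h f = ‖(WithLp.toLp 2 fun y => f y * Real.sqrt (h y) : EuclideanSpace ℝ S)‖ := by
  rw [EuclideanSpace.norm_eq, l2norm]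
  congr 1
  refine Finset.sum_congr rfl fun y _ => ?_
  simp only [Real.norm_eq_abs, sq_abs, mul_pow, Real.sq_sqrt (hh y).le]

lemma l2norm_add_le (hh : ∀ y, 0 < h y) (f g : S → ℝ) :
    l2norm h (fun y => f y + g y) ≤ l2norm h f + l2norm h g := by
  simp only [l2norm_eq_norm hh]
  refine le_trans (le_of_eq ?_) (norm_add_le _ _)
  congr 1
  ext y
  simp [add_mul]

lemma l2norm_mono (hh : ∀ y, 0 < h y) {f g : S → ℝ} {c : ℝ} (hc : 0 ≤ c)
    (hfg : ∀ y, |f y| ≤ c * |g y|) : l2norm h f ≤ c * l2norm h g := by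
  have : c * l2norm h g = Real.sqrt (c ^ 2 * ∑ y, g y ^ 2 * h y) := by
    rw [Real.sqrt_mul (sq_nonneg c), Real.sqrt_sq hc, l2norm]
  rw [this, Finset.mul_sum]
  refine Real.sqrt_le_sqrt (Finset.sum_le_sum fun y _ => ?_)
  rw [← mul_assoc]
  refine mul_le_mul_of_nonneg_right ?_ (hh y).le
  rw [← sq_abs (f y), ← sq_abs (g y), ← mul_pow]
  exact pow_le_pow_left₀ (abs_nonneg _) (hfg y) 2

lemma wmean_massFn (hm : IsMassFn h) (f : S → ℝ) : wmean h f = ∑ y, f y * h y := by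
  rw [wmean, hm.2, div_one]
  exact Finset.sum_congr rfl fun y _ => mul_comm _ _

lemma l2norm_const (hm : IsMassFn h) (c : ℝ) : l2norm h (fun _ => c) = |c| := by
  rw [l2norm, ← Finset.mul_sum, hm.2, mul_one, Real.sqrt_sq_eq_abs]

lemma IsMassFn.nonempty (hm : IsMassFn h) : Nonempty S := by
  by_contra hS
  rw [not_nonempty_iff] at hS
  simpa using hm.2

lemma sum_abs_mul_le_l2norm (hh : ∀ y, 0 < h y) (hm : IsMassFn h) (f : S → ℝ) :
    ∑ y, |f y| * h y ≤ l2norm h f := by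
  have := hm.nonempty
  refine Real.le_sqrt_of_sq_le ?_
  have := sq_wmean_le hh fun y => |f y|
  simpa only [wmean_massFn hm, sq_abs] using this

lemma l2norm_sub_mean_le (hh : ∀ y, 0 < h y) (hm : IsMassFn h) (f : S → ℝ) :
    l2norm h (fun y => f y - ∑ z, f z * h z) ≤ l2norm h f := by
  have := hm.nonempty
  refine Real.sqrt_le_sqrt ?_
  have h1 := wcov_self_eq hh f
  have h2 := wcov_self_le hh f 0
  rw [h1] at h2
  simpa only [wmean_massFn hm, sub_zero] using h2

variable {P : S → S → ℝ}

lemma sum_transOp (hst : IsStationary P h) (f : S → ℝ) :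
    ∑ y, transOp P f y * h y = ∑ y, f y * h y := by
  simp only [transOp, Finset.sum_mul]
  rw [Finset.sum_comm]
  refine Finset.sum_congr rfl fun x _ => ?_
  rw [← hst x, Finset.mul_sum]
  exact Finset.sum_congr rfl fun y _ => by ring

lemma transOp_sub_const (hP : IsTransition P) (f : S → ℝ) (c : ℝ) (y : S) :
    transOp P (fun x => f x - c) y = transOp P f y - c := by
  simp only [transOp, sub_mul, Finset.sum_sub_distrib, ← Finset.mul_sum, (hP y).2, mul_one]

/-- A transition operator is a contraction of `L²` of its stationary law. -/
lemma l2norm_transOp_le (hP : IsTransition P) (hh : ∀ y, 0 < h y) (hst : IsStationary P h)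
    (f : S → ℝ) : l2norm h (transOp P f) ≤ l2norm h f := by
  refine Real.sqrt_le_sqrt ?_
  rw [← sum_transOp hst fun y => f y ^ 2]
  refine Finset.sum_le_sum fun y _ => mul_le_mul_of_nonneg_right ?_ (hh y).le
  have := Finset.sum_mul_sq_le_sq_mul_sq Finset.univ (fun x => f x * Real.sqrt (P y x))
    (fun x => Real.sqrt (P y x))
  simp only [mul_assoc, Real.mul_self_sqrt ((hP y).1 _), mul_pow, Real.sq_sqrt ((hP y).1 _),
    (hP y).2, mul_one] at this
  exact this

/-- `kappa` bounds the transition operator on the mean-zero functions. -/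
lemma l2norm_transOp_le_kappa (hP : IsTransition P) (hh : ∀ y, 0 < h y)
    (hst : IsStationary P h) {f : S → ℝ} (hf : ∑ y, f y * h y = 0) :
    l2norm h (transOp P f) ≤ kappa P h * l2norm h f := by
  rcases (l2norm_nonneg h f).eq_or_lt with h0 | h0
  · rw [← h0, mul_zero, h0]
    exact l2norm_transOp_le hP hh hst f
  · set c := l2norm h f with hc
    have hbdd : BddAbove {c : ℝ | ∃ f : S → ℝ, ∑ y, f y * h y = 0 ∧ ∑ y, f y ^ 2 * h y = 1 ∧
        c = Real.sqrt (∑ y, transOp P f y ^ 2 * h y)} := by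
      refine ⟨1, ?_⟩
      rintro _ ⟨g, -, hg, rfl⟩
      refine (l2norm_transOp_le hP hh hst g).trans ?_
      rw [l2norm, hg, Real.sqrt_one]
    have hscale : ∀ y, transOp P (fun x => c⁻¹ * f x) y = c⁻¹ * transOp P f y := fun y => by
      simp only [transOp, Finset.mul_sum, mul_assoc]
    have hmem := le_csSup hbdd ⟨fun x => c⁻¹ * f x, by
      simp only [mul_assoc, ← Finset.mul_sum, hf, mul_zero], by
      simp only [mul_pow, mul_assoc, ← Finset.mul_sum, ← sq_l2norm hh f, ← hc]
      field_simp, rfl⟩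
    have h1 : Real.sqrt (∑ y, transOp P (fun x => c⁻¹ * f x) y ^ 2 * h y)
        = c⁻¹ * l2norm h (transOp P f) := by
      simp only [hscale, mul_pow, mul_assoc, ← Finset.mul_sum]
      rw [Real.sqrt_mul (sq_nonneg _), Real.sqrt_sq (by positivity), l2norm]
    rw [h1] at hmem
    calc l2norm h (transOp P f) = c⁻¹ * l2norm h (transOp P f) * c := by field_simp
      _ ≤ _ := mul_le_mul_of_nonneg_right hmem h0.le

/-- One step of the perturbed chain `u ↦ P (exp (f) u)`. The Lyapunov function is the mean plus a
multiple, of the order of the perturbation, of the norm of the fluctuation: the spectral gap lets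
the fluctuation absorb the first-order coupling, so that one step costs only a factor
`1 + O(τ²)`. -/
lemma lyapunov_step (hP : IsTransition P) (hh : ∀ y, 0 < h y) (hm : IsMassFn h)
    (hst : IsStationary P h) {κ τ : ℝ} (hκ0 : 0 ≤ κ) (hκ1 : κ < 1) (hκ : kappa P h ≤ κ)
    (hτ : 4 * τ ≤ 1 - κ) {f : S → ℝ} (hf0 : ∑ y, f y * h y = 0) (hf : ∀ y, |f y| ≤ τ)
    {u u' : S → ℝ} (hu : ∀ y, 0 ≤ u y) (hu' : u' = transOp P fun x => Real.exp (f x) * u x) :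
    (∑ y, u' y * h y) + 4 * τ / (1 - κ) * l2norm h (fun y => u' y - ∑ z, u' z * h z)
      ≤ (1 + 9 * τ ^ 2 / (1 - κ)) * ((∑ y, u y * h y)
        + 4 * τ / (1 - κ) * l2norm h (fun y => u y - ∑ z, u z * h z)) := by
  obtain ⟨y₀⟩ := hm.nonempty
  have hτ0 : 0 ≤ τ := (abs_nonneg _).trans (hf y₀)
  have hτ1 : τ ≤ 1 := by linarith
  have hgap : 0 < 1 - κ := by linarith
  set A := ∑ y, u y * h y with hA
  set v : S → ℝ := fun y => u y - A with hv
  set N := l2norm h v with hN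
  have hA0 : 0 ≤ A := Finset.sum_nonneg fun y _ => mul_nonneg (hu y) (hh y).le
  have hN0 : 0 ≤ N := l2norm_nonneg _ _
  set D : S → ℝ := fun y => Real.exp (f y) - 1 with hD
  have hDabs : ∀ y, |D y| ≤ 2 * τ := fun y =>
    (Real.abs_exp_sub_one_le ((hf y).trans hτ1)).trans (by linarith [hf y])
  -- the perturbation is centred to first order
  have hDmean : ∑ y, D y * h y ≤ τ ^ 2 := by
    have h1 : ∀ y, D y ≤ f y + τ ^ 2 := fun y => by
      have h2 := (abs_le.1 (Real.abs_exp_sub_one_sub_id_le ((hf y).trans hτ1))).2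
      have h3 : f y ^ 2 ≤ τ ^ 2 := sq_le_sq' (neg_le_of_abs_le (hf y)) ((le_abs_self _).trans (hf y))
      simp only [hD]; linarith
    calc ∑ y, D y * h y ≤ ∑ y, (f y + τ ^ 2) * h y :=
          Finset.sum_le_sum fun y _ => mul_le_mul_of_nonneg_right (h1 y) (hh y).le
      _ = τ ^ 2 := by
          simp only [add_mul, Finset.sum_add_distrib, hf0, ← Finset.mul_sum, hm.2]; ring
  have hmean' : ∑ y, u' y * h y = ∑ y, (Real.exp (f y) * u y) * h y := by
    rw [hu', sum_transOp hst]
  have hA' : ∑ y, u' y * h y ≤ A * (1 + τ ^ 2) + 2 * τ * N := by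
    have h1 : ∑ y, (Real.exp (f y) * u y) * h y
        = A + A * ∑ y, D y * h y + ∑ y, D y * v y * h y := by
      rw [hA, Finset.mul_sum, ← Finset.sum_add_distrib, ← Finset.sum_add_distrib]
      exact Finset.sum_congr rfl fun y _ => by simp only [hD, hv]; ring
    have h2 : ∑ y, D y * v y * h y ≤ 2 * τ * N := by
      calc ∑ y, D y * v y * h y ≤ ∑ y, 2 * τ * (|v y| * h y) := by
            refine Finset.sum_le_sum fun y _ => ?_
            rw [← mul_assoc]
            refine mul_le_mul_of_nonneg_right ?_ (hh y).le
            refine (le_abs_self _).trans ?_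
            rw [abs_mul]
            exact mul_le_mul_of_nonneg_right (hDabs y) (abs_nonneg _)
        _ = 2 * τ * ∑ y, |v y| * h y := by rw [Finset.mul_sum]
        _ ≤ 2 * τ * N := mul_le_mul_of_nonneg_left (sum_abs_mul_le_l2norm hh hm v) (by positivity)
    have h3 := mul_le_mul_of_nonneg_left hDmean hA0
    rw [hmean', h1]
    linarith
  have hN' : l2norm h (fun y => u' y - ∑ z, u' z * h z) ≤ κ * (N + 2 * τ * (A + N)) := by
    set e := ∑ y, (Real.exp (f y) * u y) * h y with he
    have h1 : (fun y => u' y - ∑ z, u' z * h z)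
        = transOp P fun x => Real.exp (f x) * u x - e := by
      funext y
      rw [transOp_sub_const hP, hmean', hu']
    have h2 : ∑ y, (Real.exp (f y) * u y - e) * h y = 0 := by
      simp only [sub_mul, Finset.sum_sub_distrib, ← Finset.mul_sum, hm.2, mul_one]
      rw [he, sub_self]
    rw [h1]
    refine (l2norm_transOp_le_kappa hP hh hst h2).trans ?_
    refine mul_le_mul hκ ?_ (l2norm_nonneg _ _) hκ0
    have h3 : (fun y => Real.exp (f y) * u y - e)
        = fun y => v y + (D y * u y - ∑ z, (D z * u z) * h z) := by
      funext y
      have : ∑ z, (D z * u z) * h z = e - A := by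
        rw [he, hA, ← Finset.sum_sub_distrib]
        exact Finset.sum_congr rfl fun z _ => by simp only [hD]; ring
      rw [this]
      simp only [hD, hv]; ring
    rw [h3]
    refine (l2norm_add_le hh _ _).trans ?_
    refine add_le_add_right ?_ _
    refine (l2norm_sub_mean_le hh hm _).trans ?_
    have h4 : l2norm h u ≤ A + N := by
      have h5 := l2norm_add_le hh (fun _ => A) v
      rw [l2norm_const hm, abs_of_nonneg hA0] at h5
      have h6 : (fun y => A + v y) = u := by funext y; simp only [hv]; ring
      rwa [h6] at h5
    refine (l2norm_mono hh (c := 2 * τ) (g := u) (by positivity) fun y => ?_).trans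
      (mul_le_mul_of_nonneg_left h4 (by positivity))
    rw [abs_mul]
    exact mul_le_mul_of_nonneg_right (hDabs y) (abs_nonneg _)
  set γ := 4 * τ / (1 - κ) with hγ
  have hγ0 : 0 ≤ γ := by positivity
  have hγ1 : γ * (1 - κ) = 4 * τ := by rw [hγ]; field_simp
  have hN'' := mul_le_mul_of_nonneg_left hN' hγ0
  -- the coefficient of the fluctuation does not increase
  have c1 : 2 * τ + γ * (κ * (1 + 2 * τ)) ≤ γ := by
    have h1 : κ * (2 * τ) ≤ (1 - κ) / 2 := by nlinarith
    have h2 : γ * (κ * (2 * τ)) ≤ γ * ((1 - κ) / 2) := mul_le_mul_of_nonneg_left h1 hγ0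
    linarith
  have c2 : 1 + τ ^ 2 + γ * (κ * (2 * τ)) ≤ 1 + 9 * τ ^ 2 / (1 - κ) := by
    have h1 : τ ^ 2 ≤ τ ^ 2 / (1 - κ) := le_div_self (sq_nonneg _) hgap (by linarith)
    have h2 : γ * (κ * (2 * τ)) ≤ γ * (2 * τ) :=
      mul_le_mul_of_nonneg_left (by nlinarith) hγ0
    have h3 : γ * (2 * τ) = 8 * (τ ^ 2 / (1 - κ)) := by rw [hγ]; ring
    have h4 : 9 * τ ^ 2 / (1 - κ) = 9 * (τ ^ 2 / (1 - κ)) := by ring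
    linarith
  have c3 : 1 ≤ 1 + 9 * τ ^ 2 / (1 - κ) := by
    have : 0 ≤ 9 * τ ^ 2 / (1 - κ) := by positivity
    linarith
  have d1 := mul_le_mul_of_nonneg_right c1 hN0
  have d2 := mul_le_mul_of_nonneg_right c2 hA0
  have d3 := mul_le_mul_of_nonneg_right c3 (mul_nonneg hγ0 hN0)
  linarith

/-- The Feynman–Kac iterates `(P e^f)^k 1`. -/
noncomputable def feynmanKac (P : S → S → ℝ) (f : S → ℝ) : ℕ → S → ℝ
  | 0 => fun _ => 1
  | k + 1 => transOp P fun x => Real.exp (f x) * feynmanKac P f k x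

lemma feynmanKac_nonneg (hP : IsTransition P) (f : S → ℝ) (k : ℕ) (y : S) :
    0 ≤ feynmanKac P f k y := by
  induction k generalizing y with
  | zero => exact zero_le_one
  | succ k ih =>
    exact Finset.sum_nonneg fun x _ =>
      mul_nonneg (mul_nonneg (Real.exp_pos _).le (ih x)) ((hP y).1 x)

lemma sum_feynmanKac_le (hP : IsTransition P) (hh : ∀ y, 0 < h y) (hm : IsMassFn h)
    (hst : IsStationary P h) {κ τ : ℝ} (hκ0 : 0 ≤ κ) (hκ1 : κ < 1) (hκ : kappa P h ≤ κ)
    (hτ : 4 * τ ≤ 1 - κ) {f : S → ℝ} (hf0 : ∑ y, f y * h y = 0) (hf : ∀ y, |f y| ≤ τ) (k : ℕ) :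
    ∑ y, feynmanKac P f k y * h y ≤ Real.exp (9 * k * τ ^ 2 / (1 - κ)) := by
  obtain ⟨y₀⟩ := hm.nonempty
  have hτ0 : 0 ≤ τ := (abs_nonneg _).trans (hf y₀)
  have hgap : 0 < 1 - κ := by linarith
  have key : (∑ y, feynmanKac P f k y * h y) + 4 * τ / (1 - κ)
      * l2norm h (fun y => feynmanKac P f k y - ∑ z, feynmanKac P f k z * h z)
      ≤ (1 + 9 * τ ^ 2 / (1 - κ)) ^ k := by
    induction k with
    | zero => simp [feynmanKac, hm.2, l2norm]
    | succ k ih =>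
      refine (lyapunov_step hP hh hm hst hκ0 hκ1 hκ hτ hf0 hf (feynmanKac_nonneg hP f k) rfl).trans ?_
      rw [pow_succ' (1 + 9 * τ ^ 2 / (1 - κ))]
      exact mul_le_mul_of_nonneg_left ih (by positivity)
  have h1 : 0 ≤ 4 * τ / (1 - κ)
      * l2norm h (fun y => feynmanKac P f k y - ∑ z, feynmanKac P f k z * h z) :=
    mul_nonneg (by positivity) (l2norm_nonneg _ _)
  have h2 : (1 + 9 * τ ^ 2 / (1 - κ)) ^ k ≤ Real.exp (9 * τ ^ 2 / (1 - κ)) ^ k :=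
    pow_le_pow_left₀ (by positivity) (by linarith [Real.add_one_le_exp (9 * τ ^ 2 / (1 - κ))]) k
  rw [← Real.exp_nat_mul] at h2
  have h3 : (k : ℝ) * (9 * τ ^ 2 / (1 - κ)) = 9 * k * τ ^ 2 / (1 - κ) := by ring
  rw [h3] at h2
  linarith

omit [Fintype S] in
lemma pathProb_cons (q : S → ℝ) (P : S → S → ℝ) {m : ℕ} (s : S) (y : Fin m → S) :
    pathProb q P (Fin.cons s y : Fin (m + 1) → S) = q s * pathProb (P s) P y := by
  cases m with
  | zero => simp [pathProb]
  | succ m =>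
    simp only [pathProb, Fin.cons_zero]
    rw [Fin.prod_univ_succ]
    simp

/-- The exponential moment of an additive functional along a path. -/
lemma sum_pathProb_mul_exp (P : S → S → ℝ) (f : S → ℝ) (m : ℕ) (q : S → ℝ) :
    ∑ y : Fin (m + 1) → S, pathProb q P y * Real.exp (∑ i, f (y i))
      = ∑ s, q s * (Real.exp (f s) * feynmanKac P f m s) := by
  have hcons : ∀ (m : ℕ) (q : S → ℝ),
      ∑ y : Fin (m + 1) → S, pathProb q P y * Real.exp (∑ i, f (y i))
        = ∑ s, q s * (Real.exp (f s)
          * ∑ y : Fin m → S, pathProb (P s) P y * Real.exp (∑ i, f (y i))) := by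
    intro m q
    rw [← (Fin.consEquiv fun _ : Fin (m + 1) => S).sum_comp, Fintype.sum_prod_type]
    refine Finset.sum_congr rfl fun s _ => ?_
    rw [Finset.mul_sum, Finset.mul_sum]
    refine Finset.sum_congr rfl fun y _ => ?_
    change pathProb q P (Fin.cons s y : Fin (m + 1) → S)
      * Real.exp (∑ i, f ((Fin.cons s y : Fin (m + 1) → S) i)) = _
    rw [pathProb_cons, Fin.sum_univ_succ, Real.exp_add]
    simp only [Fin.cons_zero, Fin.cons_succ]
    ring
  induction m generalizing q with
  | zero =>
    rw [hcons]
    simp [pathProb, feynmanKac]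
  | succ m ih =>
    rw [hcons]
    refine Finset.sum_congr rfl fun s _ => ?_
    rw [ih, feynmanKac, transOp]
    congr 2
    exact Finset.sum_congr rfl fun x _ => by ring

variable [MeasurableSpace S] [MeasurableSingletonClass S]

lemma IsMarkovChain.integral_eq {Ω : Type*} [MeasurableSpace Ω] {μ : Measure Ω}
    [IsProbabilityMeasure μ] {q : S → ℝ} {m : ℕ} {Y : Fin m → Ω → S}
    (hY : IsMarkovChain μ q P Y) (hYm : ∀ i, Measurable (Y i)) (G : (Fin m → S) → ℝ) :
    ∫ ω, G (fun i => Y i ω) ∂μ = ∑ y, pathProb q P y * G y := by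
  have hYm' : Measurable fun ω i => Y i ω := measurable_pi_lambda _ hYm
  have hG : StronglyMeasurable G := (measurable_of_finite G).stronglyMeasurable
  rw [← integral_map hYm'.aemeasurable hG.aestronglyMeasurable, integral_fintype]
  · refine Finset.sum_congr rfl fun y _ => ?_
    rw [map_measureReal_apply hYm' (measurableSet_singleton y), ← hY y, smul_eq_mul]
    congr 3
    ext ω
    simp [funext_iff]
  · exact Integrable.of_finite

/-- Exponential moments of additive functionals of a Markov chain with a spectral gap. -/
lemma IsMarkovChain.integral_exp_le {Ω : Type*} [MeasurableSpace Ω] {μ : Measure Ω}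
    [IsProbabilityMeasure μ] {q : S → ℝ} {m : ℕ} {Y : Fin m → Ω → S}
    (hY : IsMarkovChain μ q P Y) (hYm : ∀ i, Measurable (Y i))
    (hP : IsTransition P) (hh : ∀ y, 0 < h y) (hm : IsMassFn h)
    (hst : IsStationary P h) {κ τ Q : ℝ} (hκ0 : 0 ≤ κ) (hκ1 : κ < 1) (hκ : kappa P h ≤ κ)
    (hτ : 4 * τ ≤ 1 - κ) (hQ : ∀ y, q y ≤ Q * h y) (hq : IsMassFn q)
    {f : S → ℝ} (hf0 : ∑ y, f y * h y = 0) (hf : ∀ y, |f y| ≤ τ) :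
    ∫ ω, Real.exp (∑ i, f (Y i ω)) ∂μ ≤ Q * Real.exp (9 * m * τ ^ 2 / (1 - κ)) := by
  have hQ1 : 1 ≤ Q := by
    have := Finset.sum_le_sum fun y (_ : y ∈ Finset.univ) => hQ y
    rwa [hq.2, ← Finset.mul_sum, hm.2, mul_one] at this
  rw [hY.integral_eq hYm fun y => Real.exp (∑ i, f (y i))]
  cases m with
  | zero => simpa [pathProb] using hQ1
  | succ m =>
    rw [sum_pathProb_mul_exp]
    calc ∑ s, q s * (Real.exp (f s) * feynmanKac P f m s)
        ≤ ∑ s, Q * ((Real.exp (f s) * feynmanKac P f m s) * h s) := by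
          refine Finset.sum_le_sum fun s _ => ?_
          have := mul_le_mul_of_nonneg_right (hQ s)
            (mul_nonneg (Real.exp_pos (f s)).le (feynmanKac_nonneg hP f m s))
          linarith
      _ = Q * ∑ s, feynmanKac P f (m + 1) s * h s := by
          rw [← Finset.mul_sum, feynmanKac, sum_transOp hst]
      _ ≤ _ := mul_le_mul_of_nonneg_left
          (sum_feynmanKac_le hP hh hm hst hκ0 hκ1 hκ hτ hf0 hf (m + 1)) (by linarith)

/-- Chernoff bound for a Markov chain with a spectral gap. -/
theorem IsMarkovChain.measure_abs_sum_ge_le {Ω : Type*} [MeasurableSpace Ω] {μ : Measure Ω}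
    [IsProbabilityMeasure μ] {q : S → ℝ} {m : ℕ} {Y : Fin m → Ω → S}
    (hY : IsMarkovChain μ q P Y) (hYm : ∀ i, Measurable (Y i))
    (hP : IsTransition P) (hh : ∀ y, 0 < h y) (hm : IsMassFn h)
    (hst : IsStationary P h) {κ Q : ℝ} (hκ0 : 0 ≤ κ) (hκ1 : κ < 1) (hκ : kappa P h ≤ κ)
    (hQ : ∀ y, q y ≤ Q * h y) (hq : IsMassFn q)
    {f : S → ℝ} {F : ℝ} (hF : 0 < F) (hf0 : ∑ y, f y * h y = 0) (hf : ∀ y, |f y| ≤ F)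
    {ε : ℝ} (hε : 0 ≤ ε) (hεF : ε ≤ F) :
    μ.real {ω | m * ε ≤ |∑ i, f (Y i ω)|}
      ≤ 2 * Q * Real.exp (-(m * ε ^ 2 * (1 - κ) / (36 * F ^ 2))) := by
  have hgap : 0 < 1 - κ := by linarith
  have one : ∀ g : S → ℝ, ∑ y, g y * h y = 0 → (∀ y, |g y| ≤ F) →
      μ.real {ω | m * ε ≤ ∑ i, g (Y i ω)}
        ≤ Q * Real.exp (-(m * ε ^ 2 * (1 - κ) / (36 * F ^ 2))) := by
    intro g hg0 hg
    -- the minimizer of `9 t² F² / (1 - κ) - t ε`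
    set t := ε * (1 - κ) / (18 * F ^ 2) with ht
    have ht0 : 0 ≤ t := by positivity
    have hmeas : Measurable fun ω => Real.exp (t * ∑ i, g (Y i ω)) := by
      have : ∀ i, Measurable fun ω => g (Y i ω) := fun i =>
        (measurable_of_finite g).comp (hYm i)
      fun_prop
    have hint : Integrable (fun ω => Real.exp (t * ∑ i, g (Y i ω))) μ := by
      refine Integrable.of_bound hmeas.aestronglyMeasurable (Real.exp (t * ∑ _i : Fin m, F))
        (ae_of_all _ fun ω => ?_)
      rw [Real.norm_eq_abs, Real.abs_exp]
      refine Real.exp_le_exp.2 (mul_le_mul_of_nonneg_left ?_ ht0)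
      exact Finset.sum_le_sum fun i _ => (le_abs_self _).trans (hg _)
    have h1 := measure_ge_le_exp_mul_mgf (X := fun ω => ∑ i, g (Y i ω)) (m * ε) ht0 hint
    have h2 : mgf (fun ω => ∑ i, g (Y i ω)) μ t
        ≤ Q * Real.exp (9 * m * (t * F) ^ 2 / (1 - κ)) := by
      have := hY.integral_exp_le hYm hP hh hm hst hκ0 hκ1 hκ (τ := t * F) (f := fun y => t * g y)
        (by
          have : t * F = ε / F * (1 - κ) / 18 := by rw [ht]; field_simp
          have h3 : ε / F ≤ 1 := (div_le_one hF).2 hεF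
          rw [this]
          nlinarith) hQ hq
        (by simp only [mul_assoc, ← Finset.mul_sum, hg0, mul_zero])
        (fun y => by
          rw [abs_mul, abs_of_nonneg ht0]
          exact mul_le_mul_of_nonneg_left (hg y) ht0)
      simpa only [mgf, Finset.mul_sum] using this
    refine h1.trans ((mul_le_mul_of_nonneg_left h2 (Real.exp_pos _).le).trans (le_of_eq ?_))
    rw [mul_left_comm, ← Real.exp_add]
    congr 2
    rw [ht]
    field_simp
    ring
  have hsub : {ω | m * ε ≤ |∑ i, f (Y i ω)|}
      ⊆ {ω | m * ε ≤ ∑ i, f (Y i ω)} ∪ {ω | m * ε ≤ ∑ i, -f (Y i ω)} := by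
    intro ω hω
    rcases le_abs.1 (show (m : ℝ) * ε ≤ |∑ i, f (Y i ω)| from hω) with h1 | h1
    · exact Or.inl h1
    · right
      simpa only [Set.mem_ofPred_eq, Finset.sum_neg_distrib] using h1
  have h1 := one f hf0 hf
  have h2 := one (fun y => -f y) (by simp only [neg_mul, Finset.sum_neg_distrib, hf0, neg_zero])
    (fun y => by rw [abs_neg]; exact hf y)
  refine (measureReal_mono hsub).trans ((measureReal_union_le _ _).trans ?_)
  linarith

end MarkovChain

/-! ### Convergence in distribution for triangular arrays -/

section Limit

lemma norm_prod_sub_prod_le {ι : Type*} (s : Finset ι) {a b : ι → ℂ} (ha : ∀ i, ‖a i‖ ≤ 1)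
    (hb : ∀ i, ‖b i‖ ≤ 1) : ‖∏ i ∈ s, a i - ∏ i ∈ s, b i‖ ≤ ∑ i ∈ s, ‖a i - b i‖ := by
  classical
  induction s using Finset.induction_on with
  | empty => simp
  | insert i s hi ih =>
    rw [Finset.prod_insert hi, Finset.prod_insert hi, Finset.sum_insert hi]
    have h1 : ‖∏ j ∈ s, b j‖ ≤ 1 := by
      rw [norm_prod]
      exact Finset.prod_le_one (fun _ _ => norm_nonneg _) fun j _ => hb j
    calc ‖a i * ∏ j ∈ s, a j - b i * ∏ j ∈ s, b j‖
        = ‖a i * (∏ j ∈ s, a j - ∏ j ∈ s, b j) + (a i - b i) * ∏ j ∈ s, b j‖ := by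
          congr 1; ring
      _ ≤ ‖a i‖ * ‖∏ j ∈ s, a j - ∏ j ∈ s, b j‖ + ‖a i - b i‖ * ‖∏ j ∈ s, b j‖ := by
          rw [← norm_mul, ← norm_mul]; exact norm_add_le _ _
      _ ≤ 1 * ∑ j ∈ s, ‖a j - b j‖ + ‖a i - b i‖ * 1 := by
          gcongr
          exact ha i
      _ = _ := by ring

/-- Third-order comparison of the characteristic function of a bounded centred variable with that
of the Gaussian variable of the same variance. -/
lemma norm_charFun_sub_exp_le {Ω : Type*} [MeasurableSpace Ω] {μ : Measure Ω}
    [IsProbabilityMeasure μ] {Z : Ω → ℝ} (hZ : Measurable Z) {K v s : ℝ}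
    (hK : ∀ ω, |Z ω| ≤ K) (h0 : ∫ ω, Z ω ∂μ = 0) (hv : ∫ ω, Z ω ^ 2 ∂μ = v) (hs : |s| * K ≤ 1) :
    ‖charFun (μ.map Z) s - Complex.exp ((-(s ^ 2 * v / 2) : ℝ))‖
      ≤ (|s| * K) ^ 3 + (|s| * K) ^ 4 := by
  obtain ⟨ω₀⟩ : Nonempty Ω := nonempty_of_isProbabilityMeasure μ
  have hK0 : 0 ≤ K := (abs_nonneg _).trans (hK ω₀)
  have hZint : Integrable Z μ := Integrable.of_bound hZ.aestronglyMeasurable K (ae_of_all _ hK)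
  have hZ2int : Integrable (fun ω => Z ω ^ 2) μ := by
    refine Integrable.of_bound (hZ.pow_const 2).aestronglyMeasurable (K ^ 2)
      (ae_of_all _ fun ω => ?_)
    rw [Real.norm_eq_abs, abs_pow]
    exact pow_le_pow_left₀ (abs_nonneg _) (hK ω) 2
  have hEint : Integrable (fun ω => Complex.exp (s * Z ω * Complex.I)) μ := by
    refine Integrable.of_bound (by fun_prop) 1 (ae_of_all _ fun ω => ?_)
    rw [← Complex.ofReal_mul, Complex.norm_exp_ofReal_mul_I]
  have hchar : charFun (μ.map Z) s = ∫ ω, Complex.exp (s * Z ω * Complex.I) ∂μ := by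
    rw [charFun_apply_real, integral_map hZ.aemeasurable (by fun_prop)]
  have hpint : Integrable
      (fun ω => (1 : ℂ) + (Z ω : ℂ) * (s * Complex.I) - ((Z ω ^ 2 : ℝ) : ℂ) * (s ^ 2 / 2)) μ :=
    ((integrable_const _).add (hZint.ofReal.mul_const _)).sub (hZ2int.ofReal.mul_const _)
  have hpoly : ∫ ω, ((1 : ℂ) + (Z ω : ℂ) * (s * Complex.I)
      - ((Z ω ^ 2 : ℝ) : ℂ) * (s ^ 2 / 2)) ∂μ = ((1 - s ^ 2 * v / 2 : ℝ) : ℂ) := by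
    rw [integral_sub ((integrable_const _).add (hZint.ofReal.mul_const _))
      (hZ2int.ofReal.mul_const _), integral_add (integrable_const _) (hZint.ofReal.mul_const _),
      integral_mul_const, integral_mul_const, integral_complex_ofReal, integral_complex_ofReal,
      h0, hv]
    simp
    ring
  -- Taylor expansion of the exponential to second order
  have hpt : ∀ ω, ‖Complex.exp (s * Z ω * Complex.I)
      - ((1 : ℂ) + (Z ω : ℂ) * (s * Complex.I) - ((Z ω ^ 2 : ℝ) : ℂ) * (s ^ 2 / 2))‖
      ≤ (|s| * K) ^ 3 := fun ω => by
    have hn : ‖(s * Z ω * Complex.I : ℂ)‖ = |s| * |Z ω| := by simp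
    have hle : |s| * |Z ω| ≤ |s| * K := mul_le_mul_of_nonneg_left (hK ω) (abs_nonneg _)
    have h1 := Complex.exp_bound (x := s * Z ω * Complex.I) (by rw [hn]; linarith)
      (n := 3) (by norm_num)
    have h2 : ∑ k ∈ Finset.range 3, (s * Z ω * Complex.I : ℂ) ^ k / (k.factorial : ℂ)
        = (1 : ℂ) + (Z ω : ℂ) * (s * Complex.I) - ((Z ω ^ 2 : ℝ) : ℂ) * (s ^ 2 / 2) := by
      simp only [Finset.sum_range_succ, Finset.sum_range_zero, Nat.factorial, mul_pow,
        Complex.I_sq]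
      push_cast
      ring
    rw [h2, hn] at h1
    refine h1.trans ?_
    have h3 : (|s| * |Z ω|) ^ 3 ≤ (|s| * K) ^ 3 := pow_le_pow_left₀ (by positivity) hle 3
    refine (mul_le_of_le_one_right (by positivity) ?_).trans h3
    norm_num [Nat.factorial]
  have hA : ‖charFun (μ.map Z) s - ((1 - s ^ 2 * v / 2 : ℝ) : ℂ)‖ ≤ (|s| * K) ^ 3 := by
    rw [hchar, ← hpoly, ← integral_sub hEint hpint]
    have := norm_integral_le_of_norm_le_const (μ := μ) (ae_of_all _ hpt)
    simpa using this
  have hv0 : 0 ≤ v := hv ▸ integral_nonneg fun ω => sq_nonneg _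
  have hvK : v ≤ K ^ 2 := by
    rw [← hv]
    have := integral_mono hZ2int (integrable_const (K ^ 2)) fun ω => by
      rw [← sq_abs]; exact pow_le_pow_left₀ (abs_nonneg _) (hK ω) 2
    simpa using this
  have hx : s ^ 2 * v ≤ (|s| * K) ^ 2 := by
    rw [mul_pow, sq_abs]; exact mul_le_mul_of_nonneg_left hvK (sq_nonneg _)
  have hx1 : (|s| * K) ^ 2 ≤ 1 := pow_le_one₀ (by positivity) hs
  have hx0 : 0 ≤ s ^ 2 * v := by positivity
  have hB : ‖((1 - s ^ 2 * v / 2 : ℝ) : ℂ) - Complex.exp ((-(s ^ 2 * v / 2) : ℝ))‖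
      ≤ (|s| * K) ^ 4 := by
    rw [← Complex.ofReal_exp, ← Complex.ofReal_sub, Complex.norm_real, Real.norm_eq_abs,
      abs_sub_comm]
    have h1 := Real.abs_exp_sub_one_sub_id_le (x := -(s ^ 2 * v / 2)) (by
      rw [abs_neg, abs_of_nonneg (by positivity)]; linarith)
    have h2 : Real.exp (-(s ^ 2 * v / 2)) - 1 - -(s ^ 2 * v / 2)
        = Real.exp (-(s ^ 2 * v / 2)) - (1 - s ^ 2 * v / 2) := by ring
    rw [h2] at h1
    refine h1.trans ?_
    calc (-(s ^ 2 * v / 2)) ^ 2 ≤ (s ^ 2 * v) ^ 2 := by nlinarith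
      _ ≤ ((|s| * K) ^ 2) ^ 2 := pow_le_pow_left₀ hx0 hx 2
      _ = _ := by ring
  calc _ = ‖(charFun (μ.map Z) s - ((1 - s ^ 2 * v / 2 : ℝ) : ℂ))
        + (((1 - s ^ 2 * v / 2 : ℝ) : ℂ) - Complex.exp ((-(s ^ 2 * v / 2) : ℝ)))‖ := by
        congr 1; ring
    _ ≤ _ := (norm_add_le _ _).trans (add_le_add hA hB)

variable {Ω : ℕ → Type*} [∀ n, MeasurableSpace (Ω n)] {μ : (n : ℕ) → Measure (Ω n)}
  [∀ n, IsProbabilityMeasure (μ n)]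

/-- Central limit theorem for a triangular array with bounded, independent, centred rows of
constant variance, in terms of characteristic functions. -/
lemma tendsto_charFun_sqrt_mul_mean {Z : (n : ℕ) → Fin n → Ω n → ℝ}
    (hZ : ∀ n i, Measurable (Z n i)) (hind : ∀ n, iIndepFun (Z n) (μ n)) {K : ℝ}
    (hK : ∀ n i ω, |Z n i ω| ≤ K) (h0 : ∀ n i, ∫ ω, Z n i ω ∂μ n = 0) {v : ℕ → ℝ} {v₀ : ℝ}
    (hv : ∀ n i, ∫ ω, Z n i ω ^ 2 ∂μ n = v n) (hlim : Tendsto v atTop (𝓝 v₀)) (t : ℝ) :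
    Tendsto (fun n : ℕ => charFun ((μ n).map fun ω => (Real.sqrt n)⁻¹ * ∑ i, Z n i ω) t) atTop
      (𝓝 (Complex.exp ((-(t ^ 2 * v₀ / 2) : ℝ)))) := by
  have hsq : Tendsto (fun n : ℕ => (Real.sqrt n)⁻¹) atTop (𝓝 0) :=
    tendsto_inv_atTop_zero.comp (Real.tendsto_sqrt_atTop.comp tendsto_natCast_atTop_atTop)
  have hgauss : Tendsto (fun n : ℕ => Complex.exp ((-(t ^ 2 * v n / 2) : ℝ))) atTop
      (𝓝 (Complex.exp ((-(t ^ 2 * v₀ / 2) : ℝ)))) := by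
    refine (Complex.continuous_exp.tendsto _).comp
      ((Complex.continuous_ofReal.tendsto _).comp ?_)
    exact ((hlim.const_mul (t ^ 2)).div_const 2).neg
  set c := |t| * |K| with hc
  have hbound : ∀ᶠ n : ℕ in atTop,
      ‖charFun ((μ n).map fun ω => (Real.sqrt n)⁻¹ * ∑ i, Z n i ω) t
        - Complex.exp ((-(t ^ 2 * v n / 2) : ℝ))‖
        ≤ c ^ 3 * (Real.sqrt n)⁻¹ + c ^ 4 * ((Real.sqrt n)⁻¹ * (Real.sqrt n)⁻¹) := by
    have hsmall : ∀ᶠ n : ℕ in atTop, (Real.sqrt n)⁻¹ * c ≤ 1 := by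
      have h1 := hsq.mul_const c
      rw [zero_mul] at h1
      exact (h1.eventually_lt_const zero_lt_one).mono fun n hn => hn.le
    filter_upwards [hsmall, eventually_gt_atTop 0] with n hn hnpos
    have hn0 : (0 : ℝ) < n := Nat.cast_pos.2 hnpos
    set r := (Real.sqrt n)⁻¹ with hr
    have hr0 : 0 < r := by positivity
    have hnr : (n : ℝ) * (r * r) = 1 := by
      rw [hr, ← mul_inv, Real.mul_self_sqrt hn0.le]
      field_simp
    have habs : |r * t| * |K| = r * c := by rw [abs_mul, abs_of_pos hr0, hc]; ring
    have hv0 : 0 ≤ v n := by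
      rw [← hv n ⟨0, hnpos⟩]
      exact integral_nonneg fun ω => sq_nonneg _
    -- the Gaussian factor is split over the summands, to compare the two products factor by factor
    have hprod : Complex.exp ((-(t ^ 2 * v n / 2) : ℝ))
        = ∏ _i : Fin n, Complex.exp ((-((r * t) ^ 2 * v n / 2) : ℝ)) := by
      rw [Finset.prod_const, Finset.card_univ, Fintype.card_fin, ← Complex.exp_nat_mul]
      congr 1
      rw [← Complex.ofReal_natCast, ← Complex.ofReal_mul]
      congr 1
      linear_combination (t ^ 2 * v n / 2) * hnr
    rw [charFun_map_mul_comp (Finset.aemeasurable_fun_sum _ fun i _ => (hZ n i).aemeasurable),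
      (hind n).charFun_map_fun_sum_eq_prod (fun i => (hZ n i).aemeasurable), Finset.prod_apply,
      hprod]
    refine (norm_prod_sub_prod_le _ (fun i => ?_) fun i => ?_).trans ?_
    · have : IsProbabilityMeasure ((μ n).map (Z n i)) :=
        Measure.isProbabilityMeasure_map (hZ n i).aemeasurable
      exact norm_charFun_le_one _
    · rw [← Complex.ofReal_exp, Complex.norm_real, Real.norm_eq_abs, Real.abs_exp,
        Real.exp_le_one_iff, neg_nonpos]
      positivity
    · calc ∑ i, ‖charFun ((μ n).map (Z n i)) (r * t)
            - Complex.exp ((-((r * t) ^ 2 * v n / 2) : ℝ))‖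
          ≤ ∑ _i : Fin n, ((r * c) ^ 3 + (r * c) ^ 4) := by
            refine Finset.sum_le_sum fun i _ => ?_
            have := norm_charFun_sub_exp_le (hZ n i) (s := r * t) (K := |K|)
              (fun ω => (hK n i ω).trans (le_abs_self K)) (h0 n i) (hv n i)
              (by rw [habs]; exact hn)
            rwa [habs] at this
        _ = n * (r * r) * (c ^ 3 * r + c ^ 4 * (r * r)) := by
            rw [Finset.sum_const, Finset.card_univ, Fintype.card_fin, nsmul_eq_mul]
            ring
        _ = _ := by rw [hnr, one_mul]
  have hzero : Tendsto (fun n : ℕ => c ^ 3 * (Real.sqrt n)⁻¹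
      + c ^ 4 * ((Real.sqrt n)⁻¹ * (Real.sqrt n)⁻¹)) atTop (𝓝 0) := by
    simpa using (hsq.const_mul (c ^ 3)).add ((hsq.mul hsq).const_mul (c ^ 4))
  have hdiff := squeeze_zero_norm' hbound hzero
  simpa using hdiff.add hgauss

/-- Slutsky's lemma over varying probability spaces, with a Gaussian limit. -/
lemma tendstoInDistribution_gaussian_of_charFun {A B : (n : ℕ) → Ω n → ℝ}
    (hA : ∀ n, Measurable (A n)) (hB : ∀ n, Measurable (B n)) {v : ℝ≥0}
    (hlim : ∀ t : ℝ, Tendsto (fun n => charFun ((μ n).map (A n)) t) atTop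
      (𝓝 (Complex.exp ((-(t ^ 2 * (v : ℝ) / 2) : ℝ)))))
    (hAB : ∀ ε > 0, Tendsto (fun n => (μ n).real {ω | ε < |B n ω - A n ω|}) atTop (𝓝 0)) :
    TendstoInDistribution B atTop (id : ℝ → ℝ) μ (gaussianReal 0 v) := by
  refine ⟨fun n => (hB n).aemeasurable, aemeasurable_id, ?_⟩
  refine ProbabilityMeasure.tendsto_of_tendsto_charFun fun t => ?_
  have hgauss : charFun ((gaussianReal 0 v).map id) t
      = Complex.exp ((-(t ^ 2 * (v : ℝ) / 2) : ℝ)) := by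
    rw [Measure.map_id, charFun_gaussianReal]
    congr 1
    push_cast
    ring
  change Tendsto (fun n => charFun ((μ n).map (B n)) t) atTop
    (𝓝 (charFun ((gaussianReal 0 v).map id) t))
  rw [hgauss]
  suffices hdiff : Tendsto (fun n => charFun ((μ n).map (B n)) t - charFun ((μ n).map (A n)) t)
      atTop (𝓝 0) by
    simpa using hdiff.add (hlim t)
  have hint : ∀ {n} {F : Ω n → ℝ}, Measurable F →
      Integrable (fun ω => Complex.exp (t * F ω * Complex.I)) (μ n) := fun {n F} hF => by
    refine Integrable.of_bound (by fun_prop) 1 (ae_of_all _ fun ω => ?_)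
    rw [← Complex.ofReal_mul, Complex.norm_exp_ofReal_mul_I]
  have hbound : ∀ ε > 0, ∀ n, ‖charFun ((μ n).map (B n)) t - charFun ((μ n).map (A n)) t‖
      ≤ |t| * ε + 2 * (μ n).real {ω | ε < |B n ω - A n ω|} := by
    intro ε hε n
    have hms : MeasurableSet {ω | ε < |B n ω - A n ω|} :=
      measurableSet_lt measurable_const ((hB n).sub (hA n)).abs
    rw [charFun_apply_real, charFun_apply_real, integral_map (hB n).aemeasurable (by fun_prop),
      integral_map (hA n).aemeasurable (by fun_prop), ← integral_sub (hint (hB n)) (hint (hA n))]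
    have hpt : ∀ ω, ‖Complex.exp (t * B n ω * Complex.I) - Complex.exp (t * A n ω * Complex.I)‖
        ≤ |t| * ε + {ω | ε < |B n ω - A n ω|}.indicator (fun _ => (2 : ℝ)) ω := by
      intro ω
      by_cases hω : ω ∈ {ω | ε < |B n ω - A n ω|}
      · rw [Set.indicator_of_mem hω]
        have h1 : ∀ x : ℝ, ‖Complex.exp (t * x * Complex.I)‖ = 1 := fun x => by
          rw [← Complex.ofReal_mul, Complex.norm_exp_ofReal_mul_I]
        refine (norm_sub_le _ _).trans ?_
        rw [h1, h1]
        have : 0 ≤ |t| * ε := by positivity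
        linarith
      · rw [Set.indicator_of_notMem hω, add_zero]
        have h1 : |B n ω - A n ω| ≤ ε := not_lt.1 hω
        have h2 : Complex.exp (t * B n ω * Complex.I) - Complex.exp (t * A n ω * Complex.I)
            = Complex.exp ((t * A n ω : ℝ) * Complex.I)
              * (Complex.exp (Complex.I * (t * (B n ω - A n ω) : ℝ)) - 1) := by
          rw [mul_sub, mul_one, ← Complex.exp_add]
          push_cast
          ring_nf
        rw [h2, norm_mul, Complex.norm_exp_ofReal_mul_I, one_mul]
        refine (Real.norm_exp_I_mul_ofReal_sub_one_le).trans ?_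
        rw [Real.norm_eq_abs, abs_mul]
        exact mul_le_mul_of_nonneg_left h1 (abs_nonneg _)
    have hind : Integrable ({ω | ε < |B n ω - A n ω|}.indicator fun _ => (2 : ℝ)) (μ n) :=
      (integrable_const _).indicator hms
    refine (norm_integral_le_integral_norm _).trans ?_
    refine (integral_mono ((hint (hB n)).sub (hint (hA n))).norm
      ((integrable_const (|t| * ε)).add hind) hpt).trans (le_of_eq ?_)
    rw [integral_add' (integrable_const _) hind, integral_indicator hms]
    simp [mul_comm]
  rw [Metric.tendsto_atTop']
  intro δ hδ
  have hε : 0 < δ / (2 * (|t| + 1)) := by positivity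
  have h1 := ((hAB _ hε).const_mul 2).eventually_lt_const (u := δ / 2) (by simpa using half_pos hδ)
  obtain ⟨N, hN⟩ := eventually_atTop.1 h1
  refine ⟨N, fun n hn => ?_⟩
  rw [dist_zero_right]
  refine (hbound _ hε n).trans_lt ?_
  have h2 : |t| * (δ / (2 * (|t| + 1))) ≤ δ / 2 := by
    have : |t| * (δ / (2 * (|t| + 1))) = δ / 2 * (|t| / (|t| + 1)) := by field_simp
    rw [this]
    refine mul_le_of_le_one_right (by positivity) ?_
    rw [div_le_one (by positivity)]
    linarith
  linarith [hN n hn.le]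

end Limit

/-! ### The i.i.d. sample -/

section Sample

variable {S : Type*} [Fintype S] [MeasurableSpace S] [MeasurableSingletonClass S]
  {Ω : Type*} [MeasurableSpace Ω] {μ : Measure Ω} [IsProbabilityMeasure μ]

lemma integral_comp_of_law {X : Ω → S} (hX : Measurable X) {π : S → ℝ}
    (hlaw : ∀ s, μ.real {ω | X ω = s} = π s) (f : S → ℝ) :
    ∫ ω, f (X ω) ∂μ = ∑ s, π s * f s := by
  have hf : StronglyMeasurable f := (measurable_of_finite f).stronglyMeasurable
  rw [← integral_map hX.aemeasurable hf.aestronglyMeasurable, integral_fintype Integrable.of_finite]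
  refine Finset.sum_congr rfl fun s _ => ?_
  rw [map_measureReal_apply hX (measurableSet_singleton s), ← hlaw s, smul_eq_mul]
  rfl

/-- Hoeffding's inequality for bounded functions of an i.i.d. sample from a finite set. -/
lemma measure_abs_sum_sub_ge_le {n : ℕ} {X : Fin n → Ω → S} (hX : ∀ i, Measurable (X i))
    (hind : iIndepFun X μ) {π : S → ℝ} (hlaw : ∀ i s, μ.real {ω | X i ω = s} = π s)
    {f : S → ℝ} {K : ℝ} (hK : 0 < K) (hf : ∀ s, |f s| ≤ K) {ε : ℝ} (hε : 0 ≤ ε) :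
    μ.real {ω | n * ε ≤ |∑ i, (f (X i ω) - ∑ s, π s * f s)|}
      ≤ 2 * Real.exp (-(n * ε ^ 2 / (2 * K ^ 2))) := by
  have one : ∀ g : S → ℝ, (∀ s, |g s| ≤ K) →
      μ.real {ω | n * ε ≤ ∑ i, (g (X i ω) - ∑ s, π s * g s)}
        ≤ Real.exp (-(n * ε ^ 2 / (2 * K ^ 2))) := by
    intro g hg
    have hgm : Measurable g := measurable_of_finite g
    have hsub : ∀ i, HasSubgaussianMGF (fun ω => g (X i ω) - ∑ s, π s * g s)
        ((‖K - -K‖₊ / 2) ^ 2) μ := fun i => by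
      have := hasSubgaussianMGF_of_mem_Icc (μ := μ) (X := fun ω => g (X i ω)) (a := -K) (b := K)
        (hgm.comp (hX i)).aemeasurable (ae_of_all _ fun ω => abs_le.1 (hg _))
      rwa [integral_comp_of_law (hX i) (hlaw i) g] at this
    have h1 := HasSubgaussianMGF.measure_sum_ge_le_of_iIndepFun (μ := μ) (s := Finset.univ)
      (hind.comp (fun _ s => g s - ∑ s, π s * g s) fun _ => hgm.sub_const _)
      (fun i _ => hsub i) (ε := n * ε) (by positivity)
    refine h1.trans (Real.exp_le_exp.2 (le_of_eq ?_))
    simp only [Finset.sum_const, Finset.card_univ, Fintype.card_fin, nsmul_eq_mul]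
    have h2 : ((‖K - -K‖₊ / 2 : ℝ≥0) : ℝ) = K := by
      push_cast
      rw [Real.norm_eq_abs, abs_of_pos (by linarith)]
      ring
    push_cast at h2 ⊢
    rw [h2]
    rcases Nat.eq_zero_or_pos n with rfl | hn
    · simp
    · have : (0 : ℝ) < n := Nat.cast_pos.2 hn
      field_simp
  have hsub : {ω | n * ε ≤ |∑ i, (f (X i ω) - ∑ s, π s * f s)|}
      ⊆ {ω | n * ε ≤ ∑ i, (f (X i ω) - ∑ s, π s * f s)}
        ∪ {ω | n * ε ≤ ∑ i, (-f (X i ω) - ∑ s, π s * -f s)} := by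
    intro ω hω
    rcases le_abs.1 (show (n : ℝ) * ε ≤ |∑ i, (f (X i ω) - ∑ s, π s * f s)| from hω) with h1 | h1
    · exact Or.inl h1
    · right
      have : ∑ i, (-f (X i ω) - ∑ s, π s * -f s) = -∑ i, (f (X i ω) - ∑ s, π s * f s) := by
        simp only [mul_neg, Finset.sum_neg_distrib, Finset.sum_sub_distrib]
        ring
      rw [Set.mem_ofPred_eq, this]
      exact h1
  have h1 := one f hf
  have h2 := one (fun s => -f s) fun s => by rw [abs_neg]; exact hf s
  refine (measureReal_mono hsub).trans ((measureReal_union_le _ _).trans ?_)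
  linarith

end Sample

/-! ### The population projection -/

section Population

lemma le_dotProduct_mulVec_of_spectrum {p : ℕ} {A : Matrix (Fin p) (Fin p) ℝ}
    (hA : A.IsHermitian) {c : ℝ} (hc : ∀ ev ∈ spectrum ℝ A, c ≤ ev) (v : Fin p → ℝ) :
    c * ∑ j, v j ^ 2 ≤ v ⬝ᵥ (A *ᵥ v) := by
  have h1 : (A - algebraMap ℝ _ c).PosSemidef := by
    rw [Matrix.posSemidef_iff_isHermitian_and_spectrum_nonneg]
    refine ⟨hA.sub ?_, ?_⟩
    · rw [Matrix.algebraMap_eq_diagonal]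
      exact Matrix.isHermitian_diagonal _
    · rw [← spectrum.sub_singleton_eq]
      rintro _ ⟨x, hx, _, rfl, rfl⟩
      exact sub_nonneg.2 (hc x hx)
  have h2 := h1.dotProduct_mulVec_nonneg v
  rw [star_trivial, Matrix.sub_mulVec, dotProduct_sub, Matrix.algebraMap_eq_diagonal] at h2
  have h3 : v ⬝ᵥ (Matrix.diagonal (algebraMap ℝ (Fin p → ℝ) c) *ᵥ v) = c * ∑ j, v j ^ 2 := by
    simp only [dotProduct, Matrix.mulVec_diagonal, Finset.mul_sum]
    exact Finset.sum_congr rfl fun j _ => by simp; ring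
  linarith

variable {b : ℕ} {A : Matrix (Fin (b + 1)) (Fin (b + 1)) ℝ}

lemma mulVec_contrast_succ (w : Fin b → ℝ) (j : Fin b) :
    (A *ᵥ contrast w) j.succ = blockAB A j - (blockBB A *ᵥ w) j := by
  simp [Matrix.mulVec, dotProduct, Fin.sum_univ_succ, contrast, blockAB, blockBB, sub_eq_add_neg]

lemma mulVec_contrast_zero (hA : ∀ i j, A i j = A j i) (w : Fin b → ℝ) :
    (A *ᵥ contrast w) 0 = blockAA A - w ⬝ᵥ blockAB A := by
  simp only [Matrix.mulVec, dotProduct, Fin.sum_univ_succ, contrast, blockAB, blockAA,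
    Fin.cons_zero, Fin.cons_succ, Pi.neg_apply, mul_one, mul_neg, Finset.sum_neg_distrib,
    ← sub_eq_add_neg]
  congr 1
  exact Finset.sum_congr rfl fun j _ => by rw [hA 0 j.succ, mul_comm]

/-- The quadratic form at a contrast, as the function of which the Lasso minimizes a penalized
version. -/
lemma contrast_dotProduct_mulVec (hA : ∀ i j, A i j = A j i) (w : Fin b → ℝ) :
    contrast w ⬝ᵥ (A *ᵥ contrast w)
      = blockAA A - 2 * (w ⬝ᵥ blockAB A) + w ⬝ᵥ (blockBB A *ᵥ w) := by
  have h1 : contrast w ⬝ᵥ (A *ᵥ contrast w)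
      = (A *ᵥ contrast w) 0 - ∑ j, w j * (A *ᵥ contrast w) (Fin.succ j) := by
    rw [dotProduct, Fin.sum_univ_succ]
    simp [contrast, sub_eq_add_neg]
  rw [h1, mulVec_contrast_zero hA]
  simp only [mulVec_contrast_succ, mul_sub, Finset.sum_sub_distrib]
  simp only [dotProduct]
  ring

lemma dotProduct_mulVec_contrast (hA : ∀ i j, A i j = A j i) {w : Fin b → ℝ}
    (hw : blockBB A *ᵥ w = blockAB A) (u : Fin (b + 1) → ℝ) :
    u ⬝ᵥ (A *ᵥ contrast w) = u 0 * (blockAA A - w ⬝ᵥ blockAB A) := by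
  rw [dotProduct, Fin.sum_univ_succ, mulVec_contrast_zero hA]
  simp [mulVec_contrast_succ, hw]

lemma det_blockBB_ne_zero {c : ℝ} (hc : 0 < c)
    (hpd : ∀ v : Fin (b + 1) → ℝ, c * ∑ j, v j ^ 2 ≤ v ⬝ᵥ (A *ᵥ v)) :
    (blockBB A).det ≠ 0 := by
  intro hdet
  obtain ⟨u, hu, hu0⟩ := Matrix.exists_mulVec_eq_zero_iff.2 hdet
  have h1 := hpd (Fin.cons 0 u)
  have h2 : (Fin.cons 0 u : Fin (b + 1) → ℝ) ⬝ᵥ (A *ᵥ Fin.cons 0 u) = u ⬝ᵥ (blockBB A *ᵥ u) := by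
    simp [dotProduct, Matrix.mulVec, Fin.sum_univ_succ, blockBB]
  rw [h2, hu0, dotProduct_zero, Fin.sum_univ_succ] at h1
  simp only [Fin.cons_zero, Fin.cons_succ] at h1
  obtain ⟨j, hj⟩ := Function.ne_iff.1 hu
  have h3 : 0 < ∑ j, u j ^ 2 := Finset.sum_pos' (fun _ _ => sq_nonneg _)
    ⟨j, Finset.mem_univ _, by have : u j ≠ 0 := hj; positivity⟩
  nlinarith

lemma schur_eq_of_blockBB_mulVec (hdet : (blockBB A).det ≠ 0) {w : Fin b → ℝ}
    (hw : blockBB A *ᵥ w = blockAB A) : schur A = blockAA A - w ⬝ᵥ blockAB A := by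
  have : (blockBB A)⁻¹ *ᵥ blockAB A = w := by
    rw [← hw, Matrix.mulVec_mulVec, Matrix.nonsing_inv_mul _ (isUnit_iff_ne_zero.2 hdet),
      Matrix.one_mulVec]
  rw [schur, this, dotProduct_comm w]

/-- The Schur complement is a value of the quadratic form at a vector with first entry `1`. -/
lemma le_schur {c : ℝ} (hc : 0 < c) (hA : ∀ i j, A i j = A j i)
    (hpd : ∀ v : Fin (b + 1) → ℝ, c * ∑ j, v j ^ 2 ≤ v ⬝ᵥ (A *ᵥ v)) : c ≤ schur A := by
  have hdet := det_blockBB_ne_zero hc hpd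
  set w := (blockBB A)⁻¹ *ᵥ blockAB A with hw
  have hw' : blockBB A *ᵥ w = blockAB A := by
    rw [hw, Matrix.mulVec_mulVec, Matrix.mul_nonsing_inv _ (isUnit_iff_ne_zero.2 hdet),
      Matrix.one_mulVec]
  rw [schur_eq_of_blockBB_mulVec hdet hw']
  have h1 := hpd (contrast w)
  rw [dotProduct_mulVec_contrast hA hw', Fin.sum_univ_succ] at h1
  simp only [contrast, Fin.cons_zero, one_mul] at h1
  refine le_trans ?_ h1
  have : 0 ≤ ∑ i : Fin b, (Fin.cons 1 (-w) : Fin (b + 1) → ℝ) i.succ ^ 2 :=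
    Finset.sum_nonneg fun _ _ => sq_nonneg _
  nlinarith

/-- A minimizer of the quadratic form over contrasts solves the normal equations. -/
lemma blockBB_mulVec_of_isMinOn (hA : ∀ i j, A i j = A j i) {w : Fin b → ℝ}
    (hmin : ∀ w', contrast w ⬝ᵥ (A *ᵥ contrast w) ≤ contrast w' ⬝ᵥ (A *ᵥ contrast w')) :
    blockBB A *ᵥ w = blockAB A := by
  funext j
  set e : Fin b → ℝ := Pi.single j 1 with he
  set B := (blockBB A *ᵥ w) j - blockAB A j with hB
  set G := blockBB A j j with hG
  have hval : ∀ t : ℝ, contrast (w + t • e) ⬝ᵥ (A *ᵥ contrast (w + t • e))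
      = contrast w ⬝ᵥ (A *ᵥ contrast w) + 2 * t * B + t ^ 2 * G := fun t => by
    have hsymm : w ⬝ᵥ (blockBB A *ᵥ e) = e ⬝ᵥ (blockBB A *ᵥ w) := by
      rw [Matrix.dotProduct_mulVec, ← Matrix.mulVec_transpose, dotProduct_comm]
      congr 2
      ext i k
      exact hA _ _
    have h1 : e ⬝ᵥ (blockBB A *ᵥ w) = (blockBB A *ᵥ w) j := by simp [he]
    have h2 : e ⬝ᵥ (blockBB A *ᵥ e) = G := by simp [he, hG]
    have h3 : e ⬝ᵥ blockAB A = blockAB A j := by simp [he]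
    simp only [contrast_dotProduct_mulVec hA, Matrix.mulVec_add, Matrix.mulVec_smul,
      add_dotProduct, dotProduct_add, smul_dotProduct, dotProduct_smul, smul_eq_mul, hsymm, h1, h2,
      h3]
    rw [hB]
    ring
  have hq : ∀ t : ℝ, 0 ≤ 2 * t * B + t ^ 2 * G := fun t => by
    have := hmin (w + t • e)
    rw [hval] at this
    linarith
  have hB0 : B = 0 := by
    by_contra hne
    have hpos : 0 < |G| + 1 := by positivity
    have h1 := hq (-(B / (|G| + 1)))
    have h2 : 2 * -(B / (|G| + 1)) * B + (-(B / (|G| + 1))) ^ 2 * G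
        = -(B ^ 2 / (|G| + 1) ^ 2 * (2 * (|G| + 1) - G)) := by
      field_simp
      ring
    rw [h2] at h1
    have h3 : 0 < 2 * (|G| + 1) - G := by linarith [le_abs_self G, abs_nonneg G]
    have h4 : 0 < B ^ 2 / (|G| + 1) ^ 2 * (2 * (|G| + 1) - G) := by positivity
    linarith
  linarith

lemma covMat_symm [hS : Fintype S] {p : ℕ} (φ : S → Fin p → ℝ) (θ : Fin p → ℝ) (i j : Fin p) :
    covMat φ θ i j = covMat φ θ j i := by
  simp only [covMat, Matrix.of_apply]
  exact Finset.sum_congr rfl fun s _ => by ring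

variable {S : Type*} [Fintype S] [MeasurableSpace S] [MeasurableSingletonClass S]
  {Ω : Type*} [MeasurableSpace Ω] {μ : Measure Ω} [IsProbabilityMeasure μ]

/-- The second moment of the projected score of the exact likelihood. -/
lemma integral_sq_projectedScore [Nonempty S] {n : ℕ} (hn : 0 < n) {X : Fin n → Ω → S}
    (hX : ∀ i, Measurable (X i)) (hind : iIndepFun X μ) {φ : S → Fin (b + 1) → ℝ}
    {θ : Fin (b + 1) → ℝ} (hlaw : ∀ i s, μ.real {ω | X i ω = s} = pmf φ θ s) (w : Fin b → ℝ) :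
    ∫ ω, (projectedScore (negLogLik φ fun i => X i ω) w θ) ^ 2 ∂μ
      = (1 / (n : ℝ)) * (contrast w ⬝ᵥ (covMat φ θ *ᵥ contrast w)) := by
  set g : S → ℝ := fun s => contrast w ⬝ᵥ φ s with hg
  have hgm : Measurable g := measurable_of_finite g
  have hgX : ∀ i, Measurable fun ω => g (X i ω) := fun i => hgm.comp (hX i)
  obtain ⟨C, hC⟩ := (Set.finite_range fun s => ‖g s‖).bddAbove
  have hLp : ∀ i, MemLp (fun ω => g (X i ω)) 2 μ := fun i =>
    MemLp.of_bound (hgX i).aestronglyMeasurable C (ae_of_all _ fun ω => hC ⟨_, rfl⟩)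
  have hmean : ∀ i, ∫ ω, g (X i ω) ∂μ = contrast w ⬝ᵥ meanVec φ θ := fun i => by
    rw [integral_comp_of_law (hX i) (hlaw i), sum_pmf_mul, dotProduct_meanVec]
  have hn' : (n : ℝ) ≠ 0 := by positivity
  have hvar : ∀ i, Var[fun ω => g (X i ω); μ] = contrast w ⬝ᵥ (covMat φ θ *ᵥ contrast w) :=
    fun i => by
    rw [variance_eq_integral (hgX i).aemeasurable, hmean,
      integral_comp_of_law (hX i) (hlaw i) fun s => (g s - contrast w ⬝ᵥ meanVec φ θ) ^ 2,
      sum_pmf_mul, dotProduct_covMat_mulVec, wcov_self_eq (gibbsWeight_pos φ θ),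
      dotProduct_meanVec]
  have hps : ∀ ω, projectedScore (negLogLik φ fun i => X i ω) w θ
      = -((1 / (n : ℝ)) * (∑ i, fun ω => g (X i ω)) ω - contrast w ⬝ᵥ meanVec φ θ) := fun ω => by
    rw [projectedScore_negLogLik φ hn, Finset.sum_apply, ← mean_dotProduct]
    ring
  have hEmean : ∫ ω, (1 / (n : ℝ)) * (∑ i, fun ω => g (X i ω)) ω ∂μ
      = contrast w ⬝ᵥ meanVec φ θ := by
    simp only [Finset.sum_apply]
    rw [integral_const_mul, integral_finsetSum _ fun i _ => (hLp i).integrable (by norm_num)]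
    simp only [hmean, Finset.sum_const, Finset.card_univ, Fintype.card_fin, nsmul_eq_mul]
    field_simp
  have hsumvar : Var[∑ i, fun ω => g (X i ω); μ]
      = n * (contrast w ⬝ᵥ (covMat φ θ *ᵥ contrast w)) := by
    rw [IndepFun.variance_sum (fun i _ => hLp i) fun i _ j _ hij =>
      (hind.indepFun hij).comp hgm hgm]
    simp only [hvar, Finset.sum_const, Finset.card_univ, Fintype.card_fin, nsmul_eq_mul]
  have h1 := variance_const_mul (1 / (n : ℝ)) (∑ i, fun ω => g (X i ω)) μ
  rw [hsumvar, variance_eq_integral (by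
    refine AEMeasurable.const_mul ?_ _
    exact Finset.aemeasurable_sum _ fun i _ => (hgX i).aemeasurable), hEmean] at h1
  simp only [hps, neg_sq]
  rw [h1]
  field_simp

end Population

/-! ### The decorrelated score on a good event -/

section Combination

lemma l1_cons {b : ℕ} (c : ℝ) (w : Fin b → ℝ) : l1 (Fin.cons c w : Fin (b + 1) → ℝ) = |c| + l1 w := by
  simp [l1, Fin.sum_univ_succ]

lemma card_support_cons_zero {b : ℕ} (w : Fin b → ℝ) :
    (Finset.univ.filter fun j => (Fin.cons 0 w : Fin (b + 1) → ℝ) j ≠ 0).card = l0 w := by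
  rw [l0, ← Finset.card_map (Fin.succEmb b)]
  congr 1
  ext j
  simp only [Finset.mem_filter, Finset.mem_univ, true_and, Finset.mem_map, Fin.coe_succEmb]
  constructor
  · intro hj
    rcases Fin.eq_zero_or_eq_succ j with rfl | ⟨k, rfl⟩
    · exact absurd rfl hj
    · exact ⟨k, hj, rfl⟩
  · rintro ⟨k, hk, rfl⟩
    exact hk

lemma l1_contrast_le {b : ℕ} {w : Fin b → ℝ} {D s : ℝ} (hD : 0 ≤ D) (hw : ∀ j, |w j| ≤ D)
    (hs : (l0 w : ℝ) ≤ s) : l1 (contrast w) ≤ 1 + s * D := by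
  rw [contrast, l1_cons, abs_one]
  have h1 : l1 (-w) = ∑ j ∈ Finset.univ.filter (fun j => w j ≠ 0), |w j| := by
    simp only [l1, Pi.neg_apply, abs_neg]
    refine (Finset.sum_subset (Finset.subset_univ _) fun j _ hj => ?_).symm
    simpa using hj
  have h2 := Finset.sum_le_card_nsmul (Finset.univ.filter fun j => w j ≠ 0) (fun j => |w j|) D
    fun j _ => hw j
  rw [nsmul_eq_mul] at h2
  rw [h1]
  have h3 : ((Finset.univ.filter fun j => w j ≠ 0).card : ℝ) * D ≤ s * D :=
    mul_le_mul_of_nonneg_right hs hD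
  linarith

lemma contrast_sub_cons {b : ℕ} (w w' : Fin b → ℝ) :
    contrast w - Fin.cons 0 (w' - w) = contrast w' := by
  funext j
  refine Fin.cases ?_ (fun k => ?_) j
  · simp [contrast]
  · simp only [contrast, Pi.sub_apply, Fin.cons_succ, Pi.neg_apply]
    ring

variable {S : Type*}

/-- The Lasso criterion in terms of the covariance at the contrast `(1, -w)`. -/
lemma lassoCriterion_eq {b n m : ℕ} (φ : S → Fin (b + 1) → ℝ) {h : S → ℝ} (hh : ∀ s, 0 < h s)
    (x : Fin n → S) (y : Fin m → S) (lam' : ℝ) (θ : Fin (b + 1) → ℝ) (w : Fin b → ℝ) :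
    lassoCriterion φ h x y lam' θ w
      = 1 / 2 * wcov (importanceWeight φ h y θ) (fun k => contrast w ⬝ᵥ φ (y k))
          (fun k => contrast w ⬝ᵥ φ (y k))
        - 1 / 2 * blockAA (hessian (mcNegLogLik φ h x y) θ) + lam' * l1 w := by
  have hsymm : ∀ i j, hessian (mcNegLogLik φ h x y) θ i j
      = hessian (mcNegLogLik φ h x y) θ j i := fun i j => by
    rw [hessian_mcNegLogLik φ hh, Matrix.of_apply, Matrix.of_apply, wcov_comm]
  rw [wcov_dotProduct _ _ _ fun k => φ (y k), ← hessian_mcNegLogLik φ hh x y θ,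
    contrast_dotProduct_mulVec hsymm, lassoCriterion]
  ring

lemma wcov_one_div_mul_weight {m : ℕ} (a f g : Fin m → ℝ) :
    wcov (fun k => 1 / (m : ℝ) * a k) f g = wcov a f g := by
  simp only [wcov, wmean_one_div_mul_weight]

lemma wcov_sub_self {m : ℕ} [NeZero m] {a : Fin m → ℝ} (f g : Fin m → ℝ) :
    wcov a (fun k => f k - g k) (fun k => f k - g k)
      = wcov a f f - 2 * wcov a g f + wcov a g g := by
  have h1 : (fun k => (f k - g k) * (f k - g k))
      = fun k => (f k * f k - 2 * (g k * f k)) + g k * g k := by funext k; ring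
  simp only [wcov, h1, wmean_add, wmean_sub, wmean_const_mul]
  ring

/-- On the event on which the score, the Hessian and one Monte Carlo average are close to their
population values, the decorrelated score at the estimates is close to the score of the exact
likelihood along the population contrast. -/
theorem exists_decorrelatedScore_error_le {K B D C lam s : ℝ} (hK : 0 ≤ K) (hB : 0 ≤ B)
    (hD : 0 ≤ D) (hC : 0 ≤ C) (hlam : 0 < lam) (hs : 0 ≤ s) :
    ∃ C' η₀ : ℝ, 0 ≤ C' ∧ 0 < η₀ ∧ ∀ {S : Type} {b n m : ℕ} [NeZero m]
      (φ : S → Fin (b + 1) → ℝ) (h : S → ℝ) (x : Fin n → S) (y : Fin m → S)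
      (θ θ' : Fin (b + 1) → ℝ) (w w' : Fin b → ℝ) (H : Matrix (Fin (b + 1)) (Fin (b + 1)) ℝ)
      (μs η δ lam₁ lam₂ lam' : ℝ),
      (∀ s, 0 < h s) → (∀ s j, |φ s j| ≤ K) → (∀ j, |θ j| ≤ B) → (l0 θ : ℝ) ≤ s →
      (∀ j, |w j| ≤ D) → (l0 w : ℝ) ≤ s →
      (∀ v : Fin (b + 1) → ℝ, lam * ∑ j, v j ^ 2 ≤ v ⬝ᵥ (H *ᵥ v)) →
      (∀ v : Fin (b + 1) → ℝ, v 0 = 0 → v ⬝ᵥ (H *ᵥ contrast w) = 0) →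
      0 ≤ η → η ≤ η₀ → η * (1 + s * D) ≤ lam' / 2 →
      (∀ i j, |wcov (importanceWeight φ h y θ) (fun k => φ (y k) i) (fun k => φ (y k) j) - H i j|
        ≤ η) →
      0 < lam₁ → 0 < lam₂ → 0 < lam' → lam₁ ≤ 1 → lam₁ ≤ C * lam₂ → lam₂ ≤ C * lam₁ →
      lam₁ ≤ C * lam' → lam' ≤ C * lam₁ →
      (∀ j, |-sampleMean φ x j + wmean (importanceWeight φ h y θ) fun k => φ (y k) j|
        ≤ lam₁ / 2) →
      |wmean (importanceWeight φ h y θ) (fun k => contrast w ⬝ᵥ φ (y k)) - μs| ≤ δ →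
      IsMinOn (elasticNetCriterion φ h x y lam₁ lam₂) Set.univ θ' →
      IsMinOn (lassoCriterion φ h x y lam' θ') Set.univ w' →
      |decorrelatedScore φ h x y w' (θ 0) (fun j => θ' j.succ)
        - (-(contrast w ⬝ᵥ sampleMean φ x) + μs)| ≤ C' * (lam₁ * (lam₁ + η)) + δ := by
  have hV : 0 ≤ 1 + s * D := by positivity
  obtain ⟨C₁, η₁, hC₁, hη₁, hEN⟩ := exists_elasticNet_l1_error_le hK hB hC hlam hs
  obtain ⟨C₂, η₂, hC₂, hη₂, hLasso⟩ := exists_lasso_l1_error_le hK hV hC hC₁ hlam hs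
  obtain ⟨C₃, hC₃, hScore⟩ := exists_score_expansion_le hK hV hC₁ hC₂
  refine ⟨C₃, min η₁ η₂, hC₃, lt_min hη₁ hη₂, ?_⟩
  intro S b n m _ φ h x y θ θ' w w' H μs η δ lam₁ lam₂ lam' hh hφ hθ hθs hw hws hH hHw hη0 hη hηV
    hcov h1 h2 h' h1le h12 h21 h1' h'1 hgrad hδ hmin hmin'
  set a := importanceWeight φ h y θ with ha
  have hapos : ∀ k, 0 < a k := importanceWeight_pos φ hh y θ
  set ψ : Fin m → Fin (b + 1) → ℝ := fun k => φ (y k) with hψ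
  have hψK : ∀ k j, |ψ k j| ≤ K := fun k j => hφ _ _
  have hm0 : (0 : ℝ) < m := Nat.cast_pos.2 (NeZero.pos m)
  -- the basic inequality compares the criterion at `θ'` with its value at `θ`; the factor `1 / m`
  -- in the weights changes neither means nor covariances
  have hθ'err : l1 (θ' - θ) ≤ C₁ * lam₁ := by
    refine hEN (fun k => 1 / (m : ℝ) * a k) ψ (sampleMean φ x) θ (θ' - θ) H
      (Finset.univ.filter fun j => θ j ≠ 0) η lam₁ lam₂ (fun k => mul_pos (by positivity) (hapos k))
      hψK hθ (fun j hj => by simpa using hj) hθs hH hη0 (hη.trans (min_le_left _ _))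
      (fun i j => by rw [wcov_one_div_mul_weight]; exact hcov i j) h1 h2 h12 h21
      (fun j => by rw [wmean_one_div_mul_weight]; exact hgrad j) ?_
    have h3 := hmin (Set.mem_univ θ)
    simp only [Set.mem_ofPred_eq, elasticNetCriterion] at h3
    have h4 := mcNegLogLik_add_smul φ h x y θ (θ' - θ) 1
    have h5 := mcNegLogLik_add_smul φ h x y θ (θ' - θ) 0
    rw [one_smul, add_sub_cancel, one_mul] at h4
    rw [zero_smul, add_zero, zero_mul, add_zero, tilt_zero] at h5
    rw [h4, h5] at h3
    rw [add_sub_cancel]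
    linarith
  -- the Hessian at `θ'` is the covariance under the weights at `θ` tilted by `θ' - θ`
  have hsub := contrast_sub_cons w w'
  set v : Fin (b + 1) → ℝ := Fin.cons 0 (w' - w) with hv
  have htilt : importanceWeight φ h y θ' = tilt a (fun k => (θ' - θ) ⬝ᵥ ψ k) 1 := by
    rw [ha, hψ, ← importanceWeight_add, add_sub_cancel]
  have hcs := l1_contrast_le hD hw hws
  have hw'err : l1 v ≤ C₂ * lam₁ := by
    refine hLasso a ψ (θ' - θ) (contrast w) (Fin.cons 0 w) v H
      (Finset.univ.filter fun j => (Fin.cons 0 w : Fin (b + 1) → ℝ) j ≠ 0) η lam₁ lam' hapos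
      hψK (fun j hj => by simpa using hj) (by rw [card_support_cons_zero]; exact hws) hH hη0
      (hη.trans (min_le_right _ _)) hcov h1 h' h1le h1' h'1 hθ'err hcs hηV (hHw v rfl) ?_
    have h3 := hmin' (Set.mem_univ w)
    simp only [Set.mem_ofPred_eq, lassoCriterion_eq φ hh, htilt] at h3
    have h4 : (Fin.cons 0 w + v : Fin (b + 1) → ℝ) = Fin.cons 0 w' := by
      funext j
      refine Fin.cases ?_ (fun k => ?_) j <;> simp [hv]
    rw [h4, l1_cons, l1_cons, abs_zero, zero_add, zero_add]
    have h5 := wcov_sub_self (a := tilt a (fun k => (θ' - θ) ⬝ᵥ ψ k) 1)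
      (fun k => contrast w ⬝ᵥ ψ k) (fun k => v ⬝ᵥ ψ k)
    simp only [← sub_dotProduct, hsub] at h5
    simp only [hψ] at h5 ⊢
    simp only [hψ] at h3
    linarith
  -- the score is evaluated at the true `α`, so the displacement `v₀` has no `α`-component
  set v₀ : Fin (b + 1) → ℝ := Fin.cons 0 fun j => θ' j.succ - θ j.succ with hv₀
  have hv₀l1 : l1 v₀ ≤ C₁ * lam₁ := by
    refine le_trans ?_ hθ'err
    rw [hv₀, l1_cons, abs_zero, zero_add, l1, l1, Fin.sum_univ_succ]
    simp
  have hcons : (Fin.cons (θ 0) fun j => θ' j.succ : Fin (b + 1) → ℝ) = θ + v₀ := by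
    funext j
    refine Fin.cases ?_ (fun k => ?_) j <;> simp [hv₀]
  have h6 := hScore a ψ (sampleMean φ x) v₀ (contrast w) v H μs η δ lam₁ hapos hψK hη0 hcov h1
    h1le hgrad hδ hv₀l1 hcs hw'err (hHw v₀ rfl)
  rw [hsub] at h6
  rw [decorrelatedScore, hcons, projectedScore_mcNegLogLik φ hh, importanceWeight_add]
  exact h6

end Combination

/-! ### The good event -/

section GoodEvent

variable {S : Type*} [Fintype S] {p m : ℕ}

lemma partitionFn_pos [Nonempty S] (φ : S → Fin p → ℝ) (θ : Fin p → ℝ) : 0 < partitionFn φ θ :=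
  sum_weight_pos (gibbsWeight_pos φ θ)

lemma pmf_pos [Nonempty S] (φ : S → Fin p → ℝ) (θ : Fin p → ℝ) (s : S) : 0 < pmf φ θ s :=
  div_pos (Real.exp_pos _) (partitionFn_pos φ θ)

lemma sum_pmf [Nonempty S] (φ : S → Fin p → ℝ) (θ : Fin p → ℝ) : ∑ s, pmf φ θ s = 1 := by
  have := sum_pmf_mul φ θ fun _ => 1
  simpa only [mul_one, wmean_const (gibbsWeight_pos φ θ)] using this

lemma wmean_importanceWeight [Nonempty S] (φ : S → Fin p → ℝ) (h : S → ℝ)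
    (y : Fin m → S) (θ : Fin p → ℝ) (f : Fin m → ℝ) :
    wmean (importanceWeight φ h y θ) f = wmean (fun k => pmf φ θ (y k) / h (y k)) f := by
  have hC := (partitionFn_pos φ θ).ne'
  rw [← wmean_smul_weight (fun k => pmf φ θ (y k) / h (y k)) f hC]
  congr 1
  funext k
  rw [importanceWeight, pmf]
  field_simp

/-- Self-normalized importance sampling: closeness of the two Monte Carlo averages in the numerator
and the denominator gives closeness of the ratio. -/
lemma abs_wmean_importanceWeight_sub_le [Nonempty S] (φ : S → Fin p → ℝ) (h : S → ℝ)
    {y : Fin m → S} (hm : 0 < m) {θ : Fin p → ℝ} {f : S → ℝ} {c ε : ℝ}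
    (hnum : |∑ k, pmf φ θ (y k) / h (y k) * (f (y k) - c)| ≤ m * ε)
    (hden : |∑ k, (pmf φ θ (y k) / h (y k) - 1)| ≤ m * (1 / 2)) :
    |wmean (importanceWeight φ h y θ) (fun k => f (y k)) - c| ≤ 2 * ε := by
  have hm0 : (0 : ℝ) < m := Nat.cast_pos.2 hm
  rw [wmean_importanceWeight]
  set g : Fin m → ℝ := fun k => pmf φ θ (y k) / h (y k) with hg
  rw [Finset.sum_sub_distrib] at hden
  simp only [Finset.sum_const, Finset.card_univ, Fintype.card_fin, nsmul_eq_mul, mul_one] at hden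
  have hsum : m * (1 / 2 : ℝ) ≤ ∑ k, g k := by linarith [(abs_le.1 hden).1]
  have hpos : 0 < ∑ k, g k := by linarith [mul_pos hm0 (show (0 : ℝ) < 1 / 2 by norm_num)]
  have hε : 0 ≤ ε := nonneg_of_mul_nonneg_right ((abs_nonneg _).trans hnum) hm0
  have h1 : wmean g (fun k => f (y k)) - c = (∑ k, g k * (f (y k) - c)) / ∑ k, g k := by
    simp only [wmean, mul_sub, Finset.sum_sub_distrib, ← Finset.sum_mul]
    field_simp
  rw [h1, abs_div, abs_of_pos hpos, div_le_iff₀ hpos]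
  refine hnum.trans ?_
  nlinarith

lemma abs_wcov_sub_wcov_le {ι κ : Type*} [Fintype ι] [Nonempty ι] [Fintype κ] [Nonempty κ]
    {a : ι → ℝ} {a' : κ → ℝ} (ha : ∀ k, 0 < a k) (ha' : ∀ k, 0 < a' k) {f g : ι → ℝ}
    {f' g' : κ → ℝ} {K ε : ℝ} (hf : ∀ k, |f k| ≤ K) (hg' : ∀ k, |g' k| ≤ K)
    (h1 : |wmean a f - wmean a' f'| ≤ ε) (h2 : |wmean a g - wmean a' g'| ≤ ε)
    (h3 : |wmean a (fun k => f k * g k) - wmean a' fun k => f' k * g' k| ≤ ε) :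
    |wcov a f g - wcov a' f' g'| ≤ (1 + 2 * K) * ε := by
  have e1 := abs_wmean_le ha hf
  have e2 := abs_wmean_le ha' hg'
  have hK : 0 ≤ K := (abs_nonneg _).trans e1
  have h4 : |wmean a f * (wmean a g - wmean a' g')| ≤ K * ε := by
    rw [abs_mul]; exact mul_le_mul e1 h2 (abs_nonneg _) hK
  have h5 : |(wmean a f - wmean a' f') * wmean a' g'| ≤ ε * K := by
    rw [abs_mul]; exact mul_le_mul h1 e2 (abs_nonneg _) ((abs_nonneg _).trans h1)
  have h6 : wcov a f g - wcov a' f' g'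
      = (wmean a (fun k => f k * g k) - wmean a' fun k => f' k * g' k)
        - wmean a f * (wmean a g - wmean a' g') - (wmean a f - wmean a' f') * wmean a' g' := by
    simp only [wcov]; ring
  rw [h6]
  rw [abs_le] at *
  constructor <;> linarith [h3.1, h3.2, h4.1, h4.2, h5.1, h5.2]

lemma pmf_div_le_chainM2 {h : S → ℝ} (φ : S → Fin p → ℝ) (θ : Fin p → ℝ) (s : S) :
    pmf φ θ s / h s ≤ chainM2 φ θ h :=
  le_ciSup (f := fun s => pmf φ θ s / h s) (Set.finite_range _).bddAbove s

variable [MeasurableSpace S] [MeasurableSingletonClass S]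
  {Ω : Type*} [MeasurableSpace Ω] {μ : Measure Ω} [IsProbabilityMeasure μ]

/-- Concentration of the Monte Carlo average of an importance-weighted centred function. -/
lemma measure_abs_sum_importance_gt_le [Nonempty S] {h q : S → ℝ} {P : S → S → ℝ}
    {φ : S → Fin p → ℝ} {θ : Fin p → ℝ} {Y : Fin m → Ω → S}
    (hY : IsMarkovChain μ q P Y) (hYm : ∀ i, Measurable (Y i))
    (hP : IsTransition P) (hh : ∀ y, 0 < h y) (hm : IsMassFn h)
    (hst : IsStationary P h) {κ Q M L F : ℝ} (hκ0 : 0 ≤ κ) (hκ1 : κ < 1) (hκ : kappa P h ≤ κ)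
    (hQ : ∀ y, q y ≤ Q * h y) (hq : IsMassFn q) (hM0 : 0 ≤ M) (hM : chainM2 φ θ h ≤ M)
    (hL : 0 < L) (hFL : M * (2 * F) ≤ L) {f : S → ℝ} (hf : ∀ s, |f s| ≤ F)
    {ε : ℝ} (hε : 0 ≤ ε) (hεL : ε ≤ L) :
    μ.real {ω | m * ε ≤ |∑ k, pmf φ θ (Y k ω) / h (Y k ω)
        * (f (Y k ω) - wmean (gibbsWeight φ θ) f)|}
      ≤ 2 * Q * Real.exp (-(m * ε ^ 2 * (1 - κ) / (36 * L ^ 2))) := by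
  refine hY.measure_abs_sum_ge_le (f := fun s => pmf φ θ s / h s
    * (f s - wmean (gibbsWeight φ θ) f)) hYm hP hh hm hst hκ0 hκ1 hκ hQ hq hL ?_ (fun s => ?_)
    hε hεL
  · have h1 : ∀ s, pmf φ θ s / h s * (f s - wmean (gibbsWeight φ θ) f) * h s
        = pmf φ θ s * f s - pmf φ θ s * wmean (gibbsWeight φ θ) f := fun s => by
      have := (hh s).ne'
      field_simp
    simp only [h1, Finset.sum_sub_distrib, ← Finset.sum_mul, sum_pmf, one_mul, sum_pmf_mul,
      sub_self]
  · rw [abs_mul, abs_of_pos (div_pos (pmf_pos φ θ s) (hh s))]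
    have h1 : |f s - wmean (gibbsWeight φ θ) f| ≤ 2 * F := by
      have h2 := abs_wmean_le (gibbsWeight_pos φ θ) hf
      have h3 := abs_sub (f s) (wmean (gibbsWeight φ θ) f)
      linarith [hf s]
    exact (mul_le_mul ((pmf_div_le_chainM2 φ θ s).trans hM) h1 (abs_nonneg _) hM0).trans hFL

/-- Outside an event of small probability, the score, the Hessian and the Monte Carlo average along
the population contrast are close to their population values. -/
theorem exists_good_event [Nonempty S] {b n : ℕ} {h q : S → ℝ} {P : S → S → ℝ}
    {φ : S → Fin (b + 1) → ℝ} {θ : Fin (b + 1) → ℝ} {w : Fin b → ℝ}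
    {X : Fin n → Ω → S} {Y : Fin m → Ω → S} (hn : 0 < n) (hm0 : 0 < m)
    (hX : ∀ i, Measurable (X i)) (hind : iIndepFun X μ)
    (hlaw : ∀ i s, μ.real {ω | X i ω = s} = pmf φ θ s)
    (hY : IsMarkovChain μ q P Y) (hYm : ∀ i, Measurable (Y i))
    (hP : IsTransition P) (hh : ∀ y, 0 < h y) (hm : IsMassFn h)
    (hst : IsStationary P h) {κ Q M L K V : ℝ} (hκ0 : 0 ≤ κ) (hκ1 : κ < 1)
    (hκ : kappa P h ≤ κ) (hQ : ∀ y, q y ≤ Q * h y) (hq : IsMassFn q) (hM1 : 1 ≤ M)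
    (hM : chainM2 φ θ h ≤ M) (hK : 0 < K) (hV : 0 ≤ V)
    (hL : L = M * (2 * (K + K ^ 2 + V * K)) + M + 1)
    (hφ : ∀ s j, |φ s j| ≤ K) (hw : l1 (contrast w) ≤ V)
    {εX ε₀ ε₁ : ℝ} (hεX : 0 ≤ εX) (hε₀ : 0 ≤ ε₀) (hε₀' : ε₀ ≤ 1 / 2) (hε₁ : 0 ≤ ε₁)
    (hε₁' : ε₁ ≤ 1 / 2) :
    ∃ G : Set Ω,
      (∀ ω ∈ G,
        (∀ j, |sampleMean φ (fun i => X i ω) j - meanVec φ θ j| ≤ εX) ∧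
        (∀ j, |wmean (importanceWeight φ h (fun k => Y k ω) θ) (fun k => φ (Y k ω) j)
          - meanVec φ θ j| ≤ 2 * ε₀) ∧
        (∀ i j, |wcov (importanceWeight φ h (fun k => Y k ω) θ) (fun k => φ (Y k ω) i)
          (fun k => φ (Y k ω) j) - covMat φ θ i j| ≤ (1 + 2 * K) * (2 * ε₀)) ∧
        |wmean (importanceWeight φ h (fun k => Y k ω) θ) (fun k => contrast w ⬝ᵥ φ (Y k ω))
          - contrast w ⬝ᵥ meanVec φ θ| ≤ 2 * ε₁) ∧
      μ.real Gᶜ ≤ (b + 1) * (2 * Real.exp (-(n * εX ^ 2 / (2 * K ^ 2))))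
        + (1 + (b + 1) + (b + 1) * (b + 1))
          * (2 * Q * Real.exp (-(m * ε₀ ^ 2 * (1 - κ) / (36 * L ^ 2))))
        + 2 * Q * Real.exp (-(m * ε₁ ^ 2 * (1 - κ) / (36 * L ^ 2))) := by
  have hM0 : 0 ≤ M := by linarith
  have hL1 : 1 ≤ L := by
    have : 0 ≤ M * (2 * (K + K ^ 2 + V * K)) := by positivity
    rw [hL]; linarith
  have hL0 : 0 < L := by linarith
  have hFL : ∀ F, F ≤ K + K ^ 2 + V * K → M * (2 * F) ≤ L := fun F hF => by
    have : M * (2 * F) ≤ M * (2 * (K + K ^ 2 + V * K)) :=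
      mul_le_mul_of_nonneg_left (by linarith) hM0
    rw [hL]; linarith
  have hVK : 0 ≤ V * K := by positivity
  have hmR : (0 : ℝ) < m := Nat.cast_pos.2 hm0
  have hnR : (0 : ℝ) < n := Nat.cast_pos.2 hn
  set rX := 2 * Real.exp (-(n * εX ^ 2 / (2 * K ^ 2))) with hrX
  set r₀ := 2 * Q * Real.exp (-(m * ε₀ ^ 2 * (1 - κ) / (36 * L ^ 2))) with hr₀
  set r₁ := 2 * Q * Real.exp (-(m * ε₁ ^ 2 * (1 - κ) / (36 * L ^ 2))) with hr₁
  -- `N ε f`: the numerator of the importance-sampling ratio for `f` is off by `ε`; `A j`: the `j`-th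
  -- sample mean is off by `εX`; `B₀`: the denominator of the ratio is off by `ε₀`
  obtain ⟨N, hN⟩ : ∃ N : ℝ → (S → ℝ) → Set Ω, ∀ ε f, N ε f
      = {ω | m * ε ≤ |∑ k, pmf φ θ (Y k ω) / h (Y k ω)
        * (f (Y k ω) - wmean (gibbsWeight φ θ) f)|} := ⟨_, fun _ _ => rfl⟩
  obtain ⟨A, hAdef⟩ : ∃ A : Fin (b + 1) → Set Ω, ∀ j, A j
      = {ω | n * εX ≤ |∑ i, (φ (X i ω) j - ∑ s, pmf φ θ s * φ s j)|} := ⟨_, fun _ => rfl⟩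
  obtain ⟨B₀, hB₀def⟩ : ∃ B₀ : Set Ω,
      B₀ = {ω | m * ε₀ ≤ |∑ k, (pmf φ θ (Y k ω) / h (Y k ω) - 1)|} := ⟨_, rfl⟩
  have hA : ∀ j, μ.real (A j) ≤ rX := fun j => by
    rw [hAdef]
    exact measure_abs_sum_sub_ge_le (f := fun s => φ s j) hX hind hlaw hK (fun s => hφ s j) hεX
  have hB₀ : μ.real B₀ ≤ r₀ := by
    rw [hB₀def]
    refine hY.measure_abs_sum_ge_le (f := fun s => pmf φ θ s / h s - 1) hYm hP hh hm hst hκ0 hκ1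
      hκ hQ hq hL0 ?_ (fun s => ?_) hε₀ (by linarith)
    · have h1 : ∀ s, (pmf φ θ s / h s - 1) * h s = pmf φ θ s - h s := fun s => by
        have := (hh s).ne'
        field_simp
      simp only [h1, Finset.sum_sub_distrib, sum_pmf, hm.2, sub_self]
    · have h1 := (pmf_div_le_chainM2 φ θ s).trans hM
      have h2 := div_pos (pmf_pos φ θ s) (hh s)
      have h3 : 0 ≤ M * (2 * (K + K ^ 2 + V * K)) := by positivity
      rw [abs_le, hL]
      constructor <;> linarith
  have hNle : ∀ {ε F : ℝ} {f : S → ℝ}, 0 ≤ ε → ε ≤ 1 / 2 → F ≤ K + K ^ 2 + V * K →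
      (∀ s, |f s| ≤ F) →
      μ.real (N ε f) ≤ 2 * Q * Real.exp (-(m * ε ^ 2 * (1 - κ) / (36 * L ^ 2))) :=
    fun {ε F f} hε hε' hF hf => by
    rw [hN]
    exact measure_abs_sum_importance_gt_le hY hYm hP hh hm hst hκ0 hκ1 hκ
      hQ hq hM0 hM hL0 (hFL F hF) hf hε (by linarith)
  have hN1 : ∀ j, μ.real (N ε₀ fun s => φ s j) ≤ r₀ := fun j =>
    hNle (F := K) hε₀ hε₀' (by linarith [sq_nonneg K]) fun s => hφ s j
  have hN2 : ∀ i j, μ.real (N ε₀ fun s => φ s i * φ s j) ≤ r₀ := fun i j =>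
    hNle (F := K ^ 2) hε₀ hε₀' (by linarith) fun s => by
      rw [abs_mul, sq]; exact mul_le_mul (hφ s i) (hφ s j) (abs_nonneg _) hK.le
  have hN3 : μ.real (N ε₁ fun s => contrast w ⬝ᵥ φ s) ≤ r₁ :=
    hNle (F := V * K) hε₁ hε₁' (by linarith [sq_nonneg K]) fun s =>
      (abs_dotProduct_le (hφ s)).trans (mul_le_mul_of_nonneg_right hw hK.le)
  refine ⟨((⋃ j, A j) ∪ (B₀ ∪ (⋃ j, N ε₀ fun s => φ s j)
    ∪ ⋃ ij : Fin (b + 1) × Fin (b + 1), N ε₀ fun s => φ s ij.1 * φ s ij.2)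
    ∪ N ε₁ fun s => contrast w ⬝ᵥ φ s)ᶜ, ?_, ?_⟩
  · intro ω hω
    simp only [Set.compl_union, Set.compl_iUnion, Set.mem_inter_iff, Set.mem_iInter,
      Set.mem_compl_iff] at hω
    obtain ⟨⟨hωA, ⟨hωB, hω1⟩, hω2⟩, hω3⟩ := hω
    rw [hB₀def] at hωB
    have hden : |∑ k, (pmf φ θ (Y k ω) / h (Y k ω) - 1)| ≤ m * (1 / 2) :=
      (not_le.1 hωB).le.trans (mul_le_mul_of_nonneg_left hε₀' hmR.le)
    have hmean : ∀ (ε : ℝ) (f : S → ℝ), ω ∉ N ε f →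
        |wmean (importanceWeight φ h (fun k => Y k ω) θ) (fun k => f (Y k ω))
          - wmean (gibbsWeight φ θ) f| ≤ 2 * ε := fun ε f hf => by
      rw [hN] at hf
      exact abs_wmean_importanceWeight_sub_le φ h (y := fun k => Y k ω) (f := f)
        (c := wmean (gibbsWeight φ θ) f) (ε := ε) hm0 (not_le.1 hf).le hden
    refine ⟨fun j => ?_, fun j => ?_, fun i j => ?_, ?_⟩
    · have h1 : |∑ i, (φ (X i ω) j - ∑ s, pmf φ θ s * φ s j)| ≤ n * εX := by
        have h2 := hωA j
        rw [hAdef] at h2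
        exact (not_le.1 h2).le
      simp only [Finset.sum_sub_distrib, Finset.sum_const, Finset.card_univ, Fintype.card_fin,
        nsmul_eq_mul] at h1
      have h2 : ∑ i, φ (X i ω) j - n * ∑ s, pmf φ θ s * φ s j
          = n * (sampleMean φ (fun i => X i ω) j - meanVec φ θ j) := by
        rw [sampleMean, meanVec]; field_simp
      rw [h2, abs_mul, abs_of_pos hnR] at h1
      exact le_of_mul_le_mul_left h1 hnR
    · rw [meanVec_eq]
      exact hmean ε₀ (fun s => φ s j) (hω1 j)
    · rw [covMat_eq, Matrix.of_apply]
      have : Nonempty (Fin m) := ⟨⟨0, hm0⟩⟩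
      exact abs_wcov_sub_wcov_le (importanceWeight_pos φ hh _ θ) (gibbsWeight_pos φ θ)
        (fun k => hφ _ i) (fun s => hφ s j) (hmean ε₀ (fun s => φ s i) (hω1 i))
        (hmean ε₀ (fun s => φ s j) (hω1 j)) (hmean ε₀ (fun s => φ s i * φ s j) (hω2 (i, j)))
    · rw [dotProduct_meanVec]
      exact hmean ε₁ (fun s => contrast w ⬝ᵥ φ s) hω3
  · rw [compl_compl]
    have hA' : μ.real (⋃ j, A j) ≤ (b + 1) * rX := by
      refine (measureReal_iUnion_fintype_le _).trans ((Finset.sum_le_sum fun j _ => hA j).trans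
        (le_of_eq ?_))
      simp
    have hN1' : μ.real (⋃ j, N ε₀ fun s => φ s j) ≤ (b + 1) * r₀ := by
      refine (measureReal_iUnion_fintype_le _).trans ((Finset.sum_le_sum fun j _ => hN1 j).trans
        (le_of_eq ?_))
      simp
    have hN2' : μ.real (⋃ ij : Fin (b + 1) × Fin (b + 1), N ε₀ fun s => φ s ij.1 * φ s ij.2)
        ≤ (b + 1) * (b + 1) * r₀ := by
      refine (measureReal_iUnion_fintype_le _).trans
        ((Finset.sum_le_sum fun ij _ => hN2 ij.1 ij.2).trans (le_of_eq ?_))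
      simp
    have u1 := measureReal_union_le (μ := μ) ((⋃ j, A j) ∪ (B₀ ∪ (⋃ j, N ε₀ fun s => φ s j)
      ∪ ⋃ ij : Fin (b + 1) × Fin (b + 1), N ε₀ fun s => φ s ij.1 * φ s ij.2))
      (N ε₁ fun s => contrast w ⬝ᵥ φ s)
    have u2 := measureReal_union_le (μ := μ) (⋃ j, A j) (B₀ ∪ (⋃ j, N ε₀ fun s => φ s j)
      ∪ ⋃ ij : Fin (b + 1) × Fin (b + 1), N ε₀ fun s => φ s ij.1 * φ s ij.2)
    have u3 := measureReal_union_le (μ := μ) (B₀ ∪ (⋃ j, N ε₀ fun s => φ s j))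
      (⋃ ij : Fin (b + 1) × Fin (b + 1), N ε₀ fun s => φ s ij.1 * φ s ij.2)
    have u4 := measureReal_union_le (μ := μ) B₀ (⋃ j, N ε₀ fun s => φ s j)
    linarith

end GoodEvent

/-! ### The remainder at a fixed sample size -/

section Remainder

/-- Bound, at a fixed sample size, for the probability that the decorrelated score at the estimates
deviates from the score of the exact likelihood along the population contrast. -/
theorem exists_measure_remainder_le.{u} {K B D C lam s κ Q M : ℝ} (hK : 0 < K) (hB : 0 ≤ B)
    (hD : 0 ≤ D) (hC : 0 ≤ C) (hlam : 0 < lam) (hs : 0 ≤ s) (hκ0 : 0 ≤ κ) (hκ1 : κ < 1)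
    (hM1 : 1 ≤ M) :
    ∃ C' η₀ L : ℝ, 0 ≤ C' ∧ 0 < η₀ ∧ 0 < L ∧ ∀ {S : Type} [Fintype S] [Nonempty S]
      [MeasurableSpace S] [MeasurableSingletonClass S] {Ω : Type u} [MeasurableSpace Ω]
      (μ : Measure Ω) [IsProbabilityMeasure μ] {b n m : ℕ}
      (φ : S → Fin (b + 1) → ℝ) (h q : S → ℝ) (P : S → S → ℝ)
      (X : Fin n → Ω → S) (Y : Fin m → Ω → S)
      (θ : Fin (b + 1) → ℝ) (θ' : Ω → Fin (b + 1) → ℝ) (w : Fin b → ℝ) (w' : Ω → Fin b → ℝ)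
      (lam₁ lam₂ lam' εX ε₀ ε₁ : ℝ),
      0 < n → 0 < m → (∀ i, Measurable (X i)) → iIndepFun X μ →
      (∀ i s, μ.real {ω | X i ω = s} = pmf φ θ s) →
      IsMarkovChain μ q P Y → (∀ i, Measurable (Y i)) → IsTransition P → (∀ y, 0 < h y) →
      IsMassFn h → IsStationary P h → kappa P h ≤ κ → (∀ y, q y ≤ Q * h y) → IsMassFn q →
      chainM2 φ θ h ≤ M →
      (∀ s j, |φ s j| ≤ K) → (∀ j, |θ j| ≤ B) → (l0 θ : ℝ) ≤ s →
      (∀ j, |w j| ≤ D) → (l0 w : ℝ) ≤ s →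
      (∀ v : Fin (b + 1) → ℝ, lam * ∑ j, v j ^ 2 ≤ v ⬝ᵥ (covMat φ θ *ᵥ v)) →
      blockBB (covMat φ θ) *ᵥ w = blockAB (covMat φ θ) →
      0 ≤ εX → 0 ≤ ε₀ → ε₀ ≤ 1 / 2 → 0 ≤ ε₁ → ε₁ ≤ 1 / 2 →
      εX ≤ lam₁ / 4 → 2 * ε₀ ≤ lam₁ / 4 → (1 + 2 * K) * (2 * ε₀) ≤ η₀ →
      (1 + 2 * K) * (2 * ε₀) * (1 + s * D) ≤ lam' / 2 →
      0 < lam₁ → 0 < lam₂ → 0 < lam' → lam₁ ≤ 1 → lam₁ ≤ C * lam₂ → lam₂ ≤ C * lam₁ →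
      lam₁ ≤ C * lam' → lam' ≤ C * lam₁ →
      (∀ ω, IsMinOn (elasticNetCriterion φ h (fun i => X i ω) (fun i => Y i ω) lam₁ lam₂)
        Set.univ (θ' ω)) →
      (∀ ω, IsMinOn (lassoCriterion φ h (fun i => X i ω) (fun i => Y i ω) lam' (θ' ω))
        Set.univ (w' ω)) →
      μ.real {ω | C' * (lam₁ * (lam₁ + (1 + 2 * K) * (2 * ε₀))) + 2 * ε₁ <
          |decorrelatedScore φ h (fun i => X i ω) (fun i => Y i ω) (w' ω) (θ 0)
              (fun j => θ' ω j.succ)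
            - (-(contrast w ⬝ᵥ sampleMean φ fun i => X i ω) + contrast w ⬝ᵥ meanVec φ θ)|}
        ≤ (b + 1) * (2 * Real.exp (-(n * εX ^ 2 / (2 * K ^ 2))))
          + (1 + (b + 1) + (b + 1) * (b + 1))
            * (2 * Q * Real.exp (-(m * ε₀ ^ 2 * (1 - κ) / (36 * L ^ 2))))
          + 2 * Q * Real.exp (-(m * ε₁ ^ 2 * (1 - κ) / (36 * L ^ 2))) := by
  obtain ⟨C', η₀, hC', hη₀, hmain⟩ := exists_decorrelatedScore_error_le hK.le hB hD hC hlam hs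
  have hV : 0 ≤ 1 + s * D := by positivity
  refine ⟨C', η₀, M * (2 * (K + K ^ 2 + (1 + s * D) * K)) + M + 1, hC', hη₀, by positivity, ?_⟩
  intro S _ _ _ _ Ω _ μ _ b n m φ h q P X Y θ θ' w w' lam₁ lam₂ lam' εX ε₀ ε₁ hn hm hX hind hlaw
    hY hYm hP hh hmass hst hκ hQ hq hM hφ hθ hθs hw hws hpd hwn hεX hε₀ hε₀' hε₁ hε₁' hεXl hε₀l
    hη hηV h1 h2 h' h1le h12 h21 h1' h'1 hmin hmin'
  obtain ⟨G, hG, hGc⟩ := exists_good_event (w := w) hn hm hX hind hlaw hY hYm hP hh hmass hst hκ0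
    hκ1 hκ hQ hq hM1 hM hK hV rfl hφ (l1_contrast_le hD hw hws) hεX hε₀ hε₀' hε₁ hε₁'
  refine (measureReal_mono fun ω hω => ?_).trans hGc
  intro hωG
  obtain ⟨g1, g2, g3, g4⟩ := hG ω hωG
  have : NeZero m := ⟨hm.ne'⟩
  rw [Set.mem_ofPred_eq] at hω
  refine (not_le.2 hω) ?_
  refine hmain φ h (fun i => X i ω) (fun i => Y i ω) θ (θ' ω) w (w' ω) (covMat φ θ)
    (contrast w ⬝ᵥ meanVec φ θ) ((1 + 2 * K) * (2 * ε₀)) (2 * ε₁) lam₁ lam₂ lam' hh hφ hθ hθs hw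
    hws hpd (fun v hv => ?_) (by positivity) hη hηV g3 h1 h2 h' h1le h12 h21 h1' h'1
    (fun j => ?_) g4 (hmin ω) (hmin' ω)
  · rw [dotProduct_mulVec_contrast (covMat_symm φ θ) hwn, hv, zero_mul]
  · have e1 := abs_le.1 (g1 j)
    have e2 := abs_le.1 (g2 j)
    rw [abs_le]
    constructor <;> linarith [e1.1, e1.2, e2.1, e2.2]

end Remainder

/-! ### Growth rates -/

section Rates

variable {b m : ℕ → ℕ}

lemma tendsto_log_dim (hp : Tendsto b atTop atTop) :
    Tendsto (fun n => Real.log ((b n + 1 : ℕ) : ℝ)) atTop atTop :=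
  Real.tendsto_log_atTop.comp (tendsto_natCast_atTop_atTop.comp
    (tendsto_atTop_mono (fun n => Nat.le_succ (b n)) hp))

lemma exists_mul_le_chain_length
    (hmn : (fun n : ℕ => Real.log ((b n + 1 : ℕ) : ℝ)) =O[atTop] fun n : ℕ => (m n : ℝ) / n) :
    ∃ c : ℝ, 0 < c ∧ ∀ᶠ n : ℕ in atTop, c * (n * Real.log ((b n + 1 : ℕ) : ℝ)) ≤ m n := by
  obtain ⟨C, hC, hbound⟩ := hmn.exists_pos
  refine ⟨C⁻¹, inv_pos.2 hC, ?_⟩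
  filter_upwards [hbound.bound, eventually_gt_atTop 0] with n hn hn0
  have hn0' : (0 : ℝ) < n := Nat.cast_pos.2 hn0
  rw [Real.norm_eq_abs, Real.norm_eq_abs, abs_of_nonneg (by positivity : (0 : ℝ) ≤ m n / n)] at hn
  have h1 := (le_abs_self _).trans hn
  rw [← mul_div_assoc, le_div_iff₀ hn0'] at h1
  rw [inv_mul_le_iff₀ hC]
  linarith

/-- With a simulated path of length at least of the order `n log p`, the rate is that of the
sampling error. -/
lemma exists_rate_le (hp : Tendsto b atTop atTop)
    (hmn : (fun n : ℕ => Real.log ((b n + 1 : ℕ) : ℝ)) =O[atTop] fun n : ℕ => (m n : ℝ) / n) :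
    ∃ C : ℝ, 0 ≤ C ∧ ∀ᶠ n : ℕ in atTop, |rate (b n + 1) n (m n)|
      ≤ C * Real.sqrt (Real.log ((b n + 1 : ℕ) : ℝ) / n) := by
  obtain ⟨c, hc, hcm⟩ := exists_mul_le_chain_length hmn
  refine ⟨1 + Real.sqrt c⁻¹ + c⁻¹, by positivity, ?_⟩
  filter_upwards [hcm, (tendsto_log_dim hp).eventually_ge_atTop 1, eventually_gt_atTop 0]
    with n hn hℓ hn0
  set ℓ := Real.log ((b n + 1 : ℕ) : ℝ) with hℓdef
  have hn0' : (1 : ℝ) ≤ n := by exact_mod_cast hn0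
  have hℓ0 : 0 < ℓ := by linarith
  have hnℓ : (0 : ℝ) < c * (n * ℓ) := by positivity
  have hm0 : (0 : ℝ) < m n := lt_of_lt_of_le hnℓ hn
  have h1 : ℓ / m n ≤ c⁻¹ * (1 / n) := by
    rw [div_le_iff₀ hm0]
    calc ℓ = c⁻¹ * (1 / n) * (c * (n * ℓ)) := by field_simp
      _ ≤ _ := mul_le_mul_of_nonneg_left hn (by positivity)
  have h2 : (1 : ℝ) / n ≤ ℓ / n := by gcongr
  have h3 : Real.sqrt (ℓ / m n) ≤ Real.sqrt c⁻¹ * Real.sqrt (ℓ / n) := by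
    rw [← Real.sqrt_mul (by positivity)]
    exact Real.sqrt_le_sqrt (h1.trans (mul_le_mul_of_nonneg_left h2 (by positivity)))
  have h4 : (1 : ℝ) / n ≤ Real.sqrt (ℓ / n) := by
    refine Real.le_sqrt_of_sq_le (le_trans ?_ h2)
    rw [sq]
    refine mul_le_of_le_one_right (by positivity) ?_
    rw [div_le_one (by positivity)]
    exact hn0'
  have h5 : ℓ / m n ≤ c⁻¹ * Real.sqrt (ℓ / n) :=
    h1.trans (mul_le_mul_of_nonneg_left h4 (by positivity))
  have hrate : rate (b n + 1) n (m n)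
      = Real.sqrt (ℓ / n) + Real.sqrt (ℓ / m n) + ℓ / m n := rfl
  rw [hrate, abs_of_nonneg (by positivity)]
  linarith

lemma tendsto_const_mul_exp_neg_mul {ℓ : ℕ → ℝ} (hℓ : Tendsto ℓ atTop atTop) (A : ℝ) {c : ℝ}
    (hc : 0 < c) : Tendsto (fun n => A * Real.exp (-(c * ℓ n))) atTop (𝓝 0) := by
  have := (Real.tendsto_exp_neg_atTop_nhds_zero.comp (hℓ.const_mul_atTop hc)).const_mul A
  simpa using this

/-- The exceptional probabilities vanish: the penalty level is chosen so that the union bound over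
the coordinates of the score converges, and the length of the path makes the Monte Carlo bound at
level `c₀ / √n` beat the union bound over the entries of the Hessian. -/
lemma tendsto_exceptional_probability (hp : Tendsto b atTop atTop)
    (hmn : (fun n : ℕ => Real.log ((b n + 1 : ℕ) : ℝ)) =O[atTop] fun n : ℕ => (m n : ℝ) / n)
    {K r κ L Q : ℝ} (hK : 0 < K) (hr : 1 < r) (hκ : κ < 1) (hL : 0 < L) (hQ : 0 ≤ Q) :
    ∃ c₀ : ℝ, 0 < c₀ ∧ ∀ ε > 0, Tendsto (fun n : ℕ => ((b n : ℝ) + 1)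
        * (2 * Real.exp (-(n * (K * Real.sqrt (2 * r * Real.log ((b n + 1 : ℕ) : ℝ) / n)) ^ 2
          / (2 * K ^ 2))))
      + (1 + ((b n : ℝ) + 1) + ((b n : ℝ) + 1) * ((b n : ℝ) + 1))
        * (2 * Q * Real.exp (-(m n * (c₀ / Real.sqrt n) ^ 2 * (1 - κ) / (36 * L ^ 2))))
      + 2 * Q * Real.exp (-(m n * (ε / Real.sqrt n) ^ 2 * (1 - κ) / (36 * L ^ 2))))
      atTop (𝓝 0) := by
  obtain ⟨c, hc, hcm⟩ := exists_mul_le_chain_length hmn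
  have hgap : 0 < 1 - κ := by linarith
  have hℓ := tendsto_log_dim hp
  set d := c * (1 - κ) / (36 * L ^ 2) with hd
  have hd0 : 0 < d := by positivity
  refine ⟨Real.sqrt (3 / d), by positivity, fun ε hε => ?_⟩
  have hlim := ((tendsto_const_mul_exp_neg_mul hℓ 2 (sub_pos.2 hr)).add
    (tendsto_const_mul_exp_neg_mul hℓ (6 * Q) zero_lt_one)).add
    (tendsto_const_mul_exp_neg_mul hℓ (2 * Q) (mul_pos hd0 (pow_pos hε 2)))
  simp only [add_zero] at hlim
  refine squeeze_zero' (Eventually.of_forall fun n => by positivity) ?_ hlim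
  filter_upwards [hcm, hℓ.eventually_ge_atTop 0, eventually_gt_atTop 0] with n hn hℓ0 hn0
  have hn0' : (0 : ℝ) < n := Nat.cast_pos.2 hn0
  have hexp : ((b n : ℝ) + 1) = Real.exp (Real.log ((b n + 1 : ℕ) : ℝ)) := by
    rw [Real.exp_log (by positivity)]; push_cast; ring
  set ℓ := Real.log ((b n + 1 : ℕ) : ℝ) with hℓdef
  have hMC : ∀ x : ℝ, d * x ^ 2 * ℓ ≤ m n * (x / Real.sqrt n) ^ 2 * (1 - κ) / (36 * L ^ 2) := by
    intro x
    rw [div_pow, Real.sq_sqrt hn0'.le]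
    have e1 : d * x ^ 2 * ℓ = c * (n * ℓ) * (x ^ 2 / n) * (1 - κ) / (36 * L ^ 2) := by
      rw [hd]; field_simp
    rw [e1]
    gcongr
  refine add_le_add (add_le_add ?_ ?_) ?_
  · rw [mul_pow, Real.sq_sqrt (by positivity), hexp]
    have e1 : n * (K ^ 2 * (2 * r * ℓ / n)) / (2 * K ^ 2) = r * ℓ := by field_simp
    rw [e1, mul_left_comm, ← Real.exp_add]
    refine le_of_eq ?_
    congr 2
    ring
  · have e1 := hMC (Real.sqrt (3 / d))
    rw [Real.sq_sqrt (by positivity), mul_div_cancel₀ _ hd0.ne'] at e1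
    have e2 : Real.exp (-(m n * (Real.sqrt (3 / d) / Real.sqrt n) ^ 2 * (1 - κ) / (36 * L ^ 2)))
        ≤ Real.exp (-(3 * ℓ)) := Real.exp_le_exp.2 (by linarith)
    have e3 : (1 : ℝ) ≤ b n + 1 := by
      have : (0 : ℝ) ≤ b n := Nat.cast_nonneg _
      linarith
    calc _ ≤ (3 * (((b n : ℝ) + 1) * ((b n : ℝ) + 1))) * (2 * Q * Real.exp (-(3 * ℓ))) := by
          refine mul_le_mul ?_ (mul_le_mul_of_nonneg_left e2 (by positivity)) (by positivity)
            (by positivity)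
          nlinarith
      _ = 6 * Q * Real.exp (-(1 * ℓ)) := by
          rw [hexp, show -(1 * ℓ) = ℓ + ℓ + -(3 * ℓ) by ring, Real.exp_add, Real.exp_add]
          ring
  · exact mul_le_mul_of_nonneg_left (Real.exp_le_exp.2 (by linarith [hMC ε])) (by positivity)

end Rates

/-! ### The tuning parameters -/

section Tuning

variable {b m : ℕ → ℕ} {lam₁ : ℕ → ℝ} {K ζ r : ℝ}

/-- The penalty level dominates the sampling error of the score. -/
lemma eventually_sampling_error_le (hK : 0 < K) (hζ : 1 < ζ)
    (hconst : ∀ᶠ n : ℕ in atTop,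
      4 * K * (ζ + 1) / (ζ - 1) * Real.sqrt (2 * r * Real.log ((b n + 1 : ℕ) : ℝ) / n) < lam₁ n) :
    ∀ᶠ n : ℕ in atTop,
      4 * (K * Real.sqrt (2 * r * Real.log ((b n + 1 : ℕ) : ℝ) / n)) ≤ lam₁ n := by
  filter_upwards [hconst] with n hn
  refine le_trans ?_ hn.le
  rw [← mul_assoc]
  refine mul_le_mul_of_nonneg_right ?_ (Real.sqrt_nonneg _)
  rw [le_div_iff₀ (by linarith)]
  exact mul_le_mul_of_nonneg_left (by linarith) (by positivity)

/-- The penalty level is of larger order than `1 / √n`, because the dimension diverges. -/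
lemma eventually_div_sqrt_le (hp : Tendsto b atTop atTop) (hK : 0 < K) (hr : 1 < r)
    (hle : ∀ᶠ n : ℕ in atTop,
      4 * (K * Real.sqrt (2 * r * Real.log ((b n + 1 : ℕ) : ℝ) / n)) ≤ lam₁ n) (A : ℝ) :
    ∀ᶠ n : ℕ in atTop, A / Real.sqrt n ≤ lam₁ n := by
  have h1 : Tendsto (fun n => 4 * K * Real.sqrt (2 * r * Real.log ((b n + 1 : ℕ) : ℝ)))
      atTop atTop :=
    (Real.tendsto_sqrt_atTop.comp ((tendsto_log_dim hp).const_mul_atTop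
      (by linarith : (0 : ℝ) < 2 * r))).const_mul_atTop (by linarith)
  filter_upwards [hle, h1.eventually_ge_atTop A] with n hn hA
  refine le_trans ?_ hn
  rw [Real.sqrt_div' _ (Nat.cast_nonneg n), ← mul_assoc, ← mul_div_assoc]
  exact div_le_div_of_nonneg_right hA (Real.sqrt_nonneg _)

lemma tendsto_log_div_sqrt (hgrowth : Tendsto (fun n : ℕ =>
      Real.log ((b n + 1 : ℕ) : ℝ) / Real.sqrt n + Real.log ((b n + 1 : ℕ) : ℝ) / Real.sqrt (m n)
        + Real.log ((b n + 1 : ℕ) : ℝ) ^ (3 / 2 : ℝ) / m n) atTop (𝓝 0)) :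
    Tendsto (fun n : ℕ => Real.log ((b n + 1 : ℕ) : ℝ) / Real.sqrt n) atTop (𝓝 0) := by
  have hℓ : ∀ n, 0 ≤ Real.log ((b n + 1 : ℕ) : ℝ) := fun n => Real.log_natCast_nonneg _
  refine squeeze_zero (fun n => div_nonneg (hℓ n) (Real.sqrt_nonneg _)) (fun n => ?_) hgrowth
  have h1 := div_nonneg (hℓ n) (Real.sqrt_nonneg (m n))
  have h2 := div_nonneg (Real.rpow_nonneg (hℓ n) (3 / 2)) (Nat.cast_nonneg (α := ℝ) (m n))
  linarith

/-- The square of the penalty level, which is the order of the bias of the decorrelated score, is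
negligible after scaling by `√n`. -/
lemma tendsto_sqrt_mul_sq (hp : Tendsto b atTop atTop)
    (hmn : (fun n : ℕ => Real.log ((b n + 1 : ℕ) : ℝ)) =O[atTop] fun n : ℕ => (m n : ℝ) / n)
    (hrate : lam₁ =O[atTop] fun n => rate (b n + 1) n (m n))
    (hlog : Tendsto (fun n : ℕ => Real.log ((b n + 1 : ℕ) : ℝ) / Real.sqrt n) atTop (𝓝 0)) :
    Tendsto (fun n : ℕ => Real.sqrt n * lam₁ n ^ 2) atTop (𝓝 0) := by
  obtain ⟨A, hA, hAb⟩ := hrate.exists_pos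
  obtain ⟨C, hC, hCb⟩ := exists_rate_le hp hmn
  have hlim := hlog.const_mul ((A * C) ^ 2)
  rw [mul_zero] at hlim
  refine squeeze_zero' (Eventually.of_forall fun n => by positivity) ?_ hlim
  filter_upwards [hAb.bound, hCb, eventually_gt_atTop 0] with n h1 h2 hn0
  have hn0' : (0 : ℝ) < n := Nat.cast_pos.2 hn0
  have hℓ : 0 ≤ Real.log ((b n + 1 : ℕ) : ℝ) := Real.log_natCast_nonneg _
  have h3 : |lam₁ n| ≤ A * C * Real.sqrt (Real.log ((b n + 1 : ℕ) : ℝ) / n) := by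
    rw [mul_assoc]
    exact h1.trans (mul_le_mul_of_nonneg_left h2 hA.le)
  have h4 : lam₁ n ^ 2 ≤ (A * C) ^ 2 * (Real.log ((b n + 1 : ℕ) : ℝ) / n) := by
    rw [← sq_abs, ← Real.sq_sqrt (div_nonneg hℓ hn0'.le), ← mul_pow]
    exact pow_le_pow_left₀ (abs_nonneg _) h3 2
  refine (mul_le_mul_of_nonneg_left h4 (Real.sqrt_nonneg _)).trans_eq ?_
  have hs : Real.sqrt n * Real.sqrt n = n := Real.mul_self_sqrt hn0'.le
  have hs0 : 0 < Real.sqrt n := Real.sqrt_pos.2 hn0'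
  rw [← hs]
  field_simp
  rw [Real.sqrt_sq hs0.le]

/-- The deterministic bound for the remainder vanishes after scaling by `√n`. -/
lemma tendsto_sqrt_mul_remainder (hsq : Tendsto (fun n : ℕ => Real.sqrt n * lam₁ n ^ 2) atTop (𝓝 0))
    (hzero : Tendsto lam₁ atTop (𝓝 0)) (C a : ℝ) :
    Tendsto (fun n : ℕ => Real.sqrt n * (C * (lam₁ n * (lam₁ n + a / Real.sqrt n))))
      atTop (𝓝 0) := by
  have hlim := (hsq.const_mul C).add (hzero.const_mul (C * a))
  rw [mul_zero, mul_zero, add_zero] at hlim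
  refine hlim.congr' ?_
  filter_upwards [eventually_gt_atTop 0] with n hn0
  have hs0 : 0 < Real.sqrt n := Real.sqrt_pos.2 (Nat.cast_pos.2 hn0)
  field_simp

lemma exists_eventually_le_mul_of_isBigO {f g : ℕ → ℝ} (h : f =O[atTop] g) (hg : ∀ n, 0 < g n) :
    ∃ C : ℝ, 0 ≤ C ∧ ∀ C', C ≤ C' → ∀ᶠ n in atTop, f n ≤ C' * g n := by
  obtain ⟨C, hC, hCb⟩ := h.exists_pos
  refine ⟨C, hC.le, fun C' hC' => ?_⟩
  filter_upwards [hCb.bound] with n hn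
  rw [Real.norm_eq_abs, Real.norm_eq_abs, abs_of_pos (hg n)] at hn
  exact (le_abs_self _).trans (hn.trans (mul_le_mul_of_nonneg_right hC' (hg n).le))

end Tuning

/-! ### The scaled remainder -/

section ScaledRemainder

/-- The scaled decorrelated score differs from the scaled exact score along the population contrast
by a remainder that tends to zero in probability. -/
theorem tendsto_measure_scaled_remainder.{u} {S : ℕ → Type} [∀ n, Fintype (S n)]
    [∀ n, Nonempty (S n)] [∀ n, MeasurableSpace (S n)] [∀ n, MeasurableSingletonClass (S n)]
    {b m : ℕ → ℕ} {φ : (n : ℕ) → S n → Fin (b n + 1) → ℝ} {θ : (n : ℕ) → Fin (b n + 1) → ℝ}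
    {P : (n : ℕ) → S n → S n → ℝ} {h q : (n : ℕ) → S n → ℝ}
    (hP : ∀ n, IsTransition (P n)) (hh : ∀ n, IsMassFn (h n)) (hh_pos : ∀ n y, 0 < h n y)
    (hstat : ∀ n, IsStationary (P n) (h n)) (hq : ∀ n, IsMassFn (q n))
    {Ω : ℕ → Type u} [∀ n, MeasurableSpace (Ω n)]
    {μ : (n : ℕ) → Measure (Ω n)} [∀ n, IsProbabilityMeasure (μ n)]
    {X : (n : ℕ) → Fin n → Ω n → S n} {Y : (n : ℕ) → Fin (m n) → Ω n → S n}
    (hX : ∀ n i, Measurable (X n i)) (hYm : ∀ n i, Measurable (Y n i))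
    (hind : ∀ n, iIndepFun (X n) (μ n))
    (hlaw : ∀ n i x, (μ n).real {ω | X n i ω = x} = pmf (φ n) (θ n) x)
    (hY : ∀ n, IsMarkovChain (μ n) (q n) (P n) (Y n))
    {K B lam D κ M Q ζ r s : ℝ} (hK : 0 < K) (hB : 0 ≤ B) (hD : 0 ≤ D) (hlam : 0 < lam)
    (hs : 0 ≤ s) (hκ0 : 0 ≤ κ) (hκ1 : κ < 1) (hM1 : 1 ≤ M) (hQ0 : 0 ≤ Q) (hζ : 1 < ζ) (hr : 1 < r)
    (hgap : ∀ n, kappa (P n) (h n) ≤ κ) (hM : ∀ n, chainM2 (φ n) (θ n) (h n) ≤ M)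
    (hQ : ∀ n y, q n y ≤ Q * h n y) (hφ : ∀ n x j, |φ n x j| ≤ K) (hθ : ∀ n j, |θ n j| ≤ B)
    (hpd : ∀ n (v : Fin (b n + 1) → ℝ),
      lam * ∑ j, v j ^ 2 ≤ v ⬝ᵥ (covMat (φ n) (θ n) *ᵥ v))
    {w : (n : ℕ) → Fin (b n) → ℝ} (hw : ∀ n j, |w n j| ≤ D)
    (hwn : ∀ n, 1 ≤ n → blockBB (covMat (φ n) (θ n)) *ᵥ w n = blockAB (covMat (φ n) (θ n)))
    (hθs : ∀ n, (l0 (θ n) : ℝ) ≤ s) (hws : ∀ n, (l0 (w n) : ℝ) ≤ s)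
    {lam₁ lam₂ lam' : ℕ → ℝ} (hlam₁ : ∀ n, 0 < lam₁ n) (hlam₂ : ∀ n, 0 < lam₂ n)
    (hlam' : ∀ n, 0 < lam' n)
    (hrate : lam₁ =Θ[atTop] fun n => rate (b n + 1) n (m n))
    (hconst : ∀ᶠ n : ℕ in atTop,
      4 * K * (ζ + 1) / (ζ - 1) * Real.sqrt (2 * r * Real.log ((b n + 1 : ℕ) : ℝ) / n) < lam₁ n)
    (hlam₁₂ : lam₁ =Θ[atTop] lam₂) (hlam₂' : lam₂ =Θ[atTop] lam')
    (hzero : Tendsto lam' atTop (𝓝 0)) (hp : Tendsto b atTop atTop)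
    (hgrowth : Tendsto (fun n : ℕ =>
      Real.log ((b n + 1 : ℕ) : ℝ) / Real.sqrt n + Real.log ((b n + 1 : ℕ) : ℝ) / Real.sqrt (m n)
        + Real.log ((b n + 1 : ℕ) : ℝ) ^ (3 / 2 : ℝ) / m n) atTop (𝓝 0))
    (hmn : (fun n : ℕ => Real.log ((b n + 1 : ℕ) : ℝ)) =O[atTop] fun n : ℕ => (m n : ℝ) / n)
    {θ' : (n : ℕ) → Ω n → Fin (b n + 1) → ℝ}
    (hmin : ∀ n ω, IsMinOn (elasticNetCriterion (φ n) (h n) (fun i => X n i ω)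
      (fun i => Y n i ω) (lam₁ n) (lam₂ n)) Set.univ (θ' n ω))
    {w' : (n : ℕ) → Ω n → Fin (b n) → ℝ}
    (hmin' : ∀ n ω, IsMinOn (lassoCriterion (φ n) (h n) (fun i => X n i ω)
      (fun i => Y n i ω) (lam' n) (θ' n ω)) Set.univ (w' n ω))
    {ε : ℝ} (hε : 0 < ε) :
    Tendsto (fun n : ℕ => (μ n).real {ω | ε < |Real.sqrt n * decorrelatedScore (φ n) (h n)
        (fun i => X n i ω) (fun i => Y n i ω) (w' n ω) (θ n 0) (fun j => θ' n ω j.succ)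
      - Real.sqrt n * (-(contrast (w n) ⬝ᵥ sampleMean (φ n) fun i => X n i ω)
        + contrast (w n) ⬝ᵥ meanVec (φ n) (θ n))|}) atTop (𝓝 0) := by
  have hlam₁' := hlam₁₂.trans hlam₂'
  obtain ⟨C₁, hC₁, h12⟩ := exists_eventually_le_mul_of_isBigO hlam₁₂.1 hlam₂
  obtain ⟨C₂, hC₂, h21⟩ := exists_eventually_le_mul_of_isBigO hlam₁₂.2 hlam₁
  obtain ⟨C₃, hC₃, h13⟩ := exists_eventually_le_mul_of_isBigO hlam₁'.1 hlam'
  obtain ⟨C₄, hC₄, h31⟩ := exists_eventually_le_mul_of_isBigO hlam₁'.2 hlam₁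
  set C := C₁ + C₂ + C₃ + C₄ with hCdef
  have hC : 0 ≤ C := by positivity
  have h12 := h12 C (by linarith)
  have h21 := h21 C (by linarith)
  have h13 := h13 C (by linarith)
  have h31 := h31 C (by linarith)
  obtain ⟨C', η₀, L, hC', hη₀, hL, hbound⟩ :=
    exists_measure_remainder_le.{u} (Q := Q) hK hB hD hC hlam hs hκ0 hκ1 hM1
  obtain ⟨c₀, hc₀, hexc⟩ := tendsto_exceptional_probability (r := r) hp hmn hK hr hκ1 hL hQ0
  obtain ⟨c, hc, hcm⟩ := exists_mul_le_chain_length hmn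
  have hle := eventually_sampling_error_le hK hζ hconst
  have hzero₁ : Tendsto lam₁ atTop (𝓝 0) := hlam₁'.1.trans_tendsto hzero
  have hsq := tendsto_sqrt_mul_sq hp hmn hrate.1 (tendsto_log_div_sqrt hgrowth)
  have hrem := tendsto_sqrt_mul_remainder hsq hzero₁ C' ((1 + 2 * K) * (2 * c₀))
  have hV : 0 ≤ 1 + s * D := by positivity
  have hsmall : ∀ A x : ℝ, 0 < x → ∀ᶠ n : ℕ in atTop, A / Real.sqrt n ≤ x := fun A x hx =>
    (Tendsto.const_div_atTop (Real.tendsto_sqrt_atTop.comp tendsto_natCast_atTop_atTop)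
      A).eventually_le_const hx
  refine squeeze_zero' (Eventually.of_forall fun n => measureReal_nonneg) ?_
    (hexc (ε / 4) (by positivity))
  filter_upwards [h12, h21, h13, h31, hcm, hle, hzero₁.eventually_le_const zero_lt_one,
    hrem.eventually_le_const (half_pos hε), eventually_div_sqrt_le hp hK hr hle (8 * c₀),
    eventually_div_sqrt_le hp hK hr hle (C * (2 * ((1 + 2 * K) * (2 * c₀) * (1 + s * D)))),
    hsmall c₀ (1 / 2) (by norm_num), hsmall (ε / 4) (1 / 2) (by norm_num),
    hsmall ((1 + 2 * K) * (2 * c₀)) η₀ hη₀, (tendsto_log_dim hp).eventually_gt_atTop 0,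
    eventually_gt_atTop 0]
    with n h12 h21 h13 h31 hcm hle h1le hrem h8 hηV hc₀2 hε2 hη hℓ hn
  have hn0 : (0 : ℝ) < n := Nat.cast_pos.2 hn
  have hs0 : 0 < Real.sqrt n := Real.sqrt_pos.2 hn0
  have hm0 : 0 < m n := by
    have : (0 : ℝ) < m n := lt_of_lt_of_le (by positivity) hcm
    exact_mod_cast this
  have key := hbound (μ n) (φ n) (h n) (q n) (P n) (X n) (Y n) (θ n) (θ' n) (w n) (w' n) (lam₁ n)
    (lam₂ n) (lam' n) (K * Real.sqrt (2 * r * Real.log ((b n + 1 : ℕ) : ℝ) / n))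
    (c₀ / Real.sqrt n) (ε / 4 / Real.sqrt n) hn hm0 (hX n) (hind n) (hlaw n) (hY n) (hYm n) (hP n)
    (hh_pos n) (hh n) (hstat n) (hgap n) (hQ n) (hq n) (hM n) (hφ n) (hθ n) (hθs n) (hw n) (hws n)
    (hpd n) (hwn n hn) (by positivity) (by positivity) hc₀2 (by positivity) hε2 (by linarith)
    ?_ ?_ ?_ (hlam₁ n) (hlam₂ n) (hlam' n) h1le h12 h21 h13 h31 (hmin n) (hmin' n)
  · refine (measureReal_mono fun ω hω => ?_).trans key
    rw [Set.mem_ofPred_eq] at hω ⊢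
    rw [← mul_sub, abs_mul, abs_of_pos hs0] at hω
    refine lt_of_mul_lt_mul_left (lt_of_le_of_lt ?_ hω) hs0.le
    have e1 : (1 + 2 * K) * (2 * (c₀ / Real.sqrt n)) = (1 + 2 * K) * (2 * c₀) / Real.sqrt n := by
      ring
    have e2 : Real.sqrt n * (2 * (ε / 4 / Real.sqrt n)) = ε / 2 := by field_simp; norm_num
    rw [e1, mul_add, e2]
    linarith
  · have e1 : 8 * c₀ / Real.sqrt n = 8 * (c₀ / Real.sqrt n) := by ring
    linarith
  · refine le_trans (le_of_eq ?_) hη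
    ring
  · -- the lasso penalty is of the order of `lam₁`, which dominates `1 / √n`
    have e1 : C * (2 * ((1 + 2 * K) * (2 * c₀) * (1 + s * D))) / Real.sqrt n
        = C * (2 * ((1 + 2 * K) * (2 * (c₀ / Real.sqrt n)) * (1 + s * D))) := by ring
    rw [e1] at hηV
    have h0 : 0 < C := by
      rcases hC.lt_or_eq with h | h
      · exact h
      · rw [← h, zero_mul] at h13
        exact absurd (hlam₁ n) (not_lt.2 h13)
    have := le_of_mul_le_mul_left (hηV.trans h13) h0
    linarith

end ScaledRemainder

/-! ### Asymptotic normality -/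

section Normality

lemma measurable_decorrelatedScore {S : Type*} [Fintype S] [MeasurableSpace S]
    [MeasurableSingletonClass S] {Ω : Type*} [MeasurableSpace Ω] {b n m : ℕ}
    (φ : S → Fin (b + 1) → ℝ) {h : S → ℝ} (hh : ∀ s, 0 < h s) {X : Fin n → Ω → S}
    {Y : Fin m → Ω → S} (hX : ∀ i, Measurable (X i)) (hY : ∀ i, Measurable (Y i))
    {w : Ω → Fin b → ℝ} (hw : Measurable w) (α : ℝ) {β : Ω → Fin b → ℝ} (hβ : Measurable β) :
    Measurable fun ω => decorrelatedScore φ h (fun i => X i ω) (fun i => Y i ω) (w ω) α (β ω) := by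
  have h1 : ∀ i j, Measurable fun ω => φ (X i ω) j := fun i j =>
    (measurable_of_finite fun s => φ s j).comp (hX i)
  have h2 : ∀ i j, Measurable fun ω => φ (Y i ω) j := fun i j =>
    (measurable_of_finite fun s => φ s j).comp (hY i)
  have h3 : ∀ i, Measurable fun ω => h (Y i ω) := fun i => (measurable_of_finite h).comp (hY i)
  have h4 : ∀ j, Measurable fun ω => w ω j := fun j => (measurable_pi_apply j).comp hw
  have h5 : ∀ j, Measurable fun ω => β ω j := fun j => (measurable_pi_apply j).comp hβ
  simp only [decorrelatedScore, projectedScore_mcNegLogLik φ hh, wmean, importanceWeight,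
    dotProduct, Fin.sum_univ_succ, contrast, Fin.cons_zero, Fin.cons_succ, sampleMean,
    Pi.neg_apply]
  fun_prop

variable {S : ℕ → Type*} [∀ n, Fintype (S n)] [∀ n, Nonempty (S n)]
  [∀ n, MeasurableSpace (S n)] [∀ n, MeasurableSingletonClass (S n)]
  {Ω : ℕ → Type*} [∀ n, MeasurableSpace (Ω n)] {μ : (n : ℕ) → Measure (Ω n)}
  [∀ n, IsProbabilityMeasure (μ n)] {b : ℕ → ℕ}

/-- A statistic that agrees, up to a negligible remainder, with the exact score along contrasts of
bounded `ℓ₁`-norm is asymptotically normal after a bounded deterministic scaling. -/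
lemma tendstoInDistribution_of_score_approximation {φ : (n : ℕ) → S n → Fin (b n + 1) → ℝ}
    {θ : (n : ℕ) → Fin (b n + 1) → ℝ} {w : (n : ℕ) → Fin (b n) → ℝ}
    {X : (n : ℕ) → Fin n → Ω n → S n} (hX : ∀ n i, Measurable (X n i))
    (hind : ∀ n, iIndepFun (X n) (μ n))
    (hlaw : ∀ n i s, (μ n).real {ω | X n i ω = s} = pmf (φ n) (θ n) s)
    {K V T : ℝ} (hK : 0 ≤ K) (hφ : ∀ n s j, |φ n s j| ≤ K) (hV : ∀ n, l1 (contrast (w n)) ≤ V)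
    {U : (n : ℕ) → Ω n → ℝ} (hU : ∀ n, Measurable (U n))
    (hrem : ∀ ε > 0, Tendsto (fun n : ℕ => (μ n).real {ω | ε < |Real.sqrt n * U n ω
      - Real.sqrt n * (-(contrast (w n) ⬝ᵥ sampleMean (φ n) fun i => X n i ω)
        + contrast (w n) ⬝ᵥ meanVec (φ n) (θ n))|}) atTop (𝓝 0))
    {τ : ℕ → ℝ} (hτ0 : ∀ n, 0 < τ n) (hτ : ∀ n, τ n ≤ T) {v : ℝ≥0}
    (hlim : Tendsto (fun n => τ n ^ 2
      * (contrast (w n) ⬝ᵥ (covMat (φ n) (θ n) *ᵥ contrast (w n)))) atTop (𝓝 (v : ℝ))) :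
    TendstoInDistribution (fun n ω => τ n * (Real.sqrt n * U n ω)) atTop (id : ℝ → ℝ) μ
      (gaussianReal 0 v) := by
  have hT : 0 < T := (hτ0 0).trans_le (hτ 0)
  have hV0 : 0 ≤ V := (l1_nonneg _).trans (hV 0)
  let f : (n : ℕ) → S n → ℝ := fun n s =>
    τ n * -(contrast (w n) ⬝ᵥ φ n s - contrast (w n) ⬝ᵥ meanVec (φ n) (θ n))
  have hcφ : ∀ n s, |contrast (w n) ⬝ᵥ φ n s| ≤ V * K := fun n s =>
    (abs_dotProduct_le (hφ n s)).trans (mul_le_mul_of_nonneg_right (hV n) hK)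
  have hf : ∀ n s, |f n s| ≤ T * (2 * (V * K)) := fun n s => by
    have h1 : |contrast (w n) ⬝ᵥ meanVec (φ n) (θ n)| ≤ V * K := by
      rw [dotProduct_meanVec]
      exact abs_wmean_le (gibbsWeight_pos _ _) (hcφ n)
    simp only [f]
    rw [abs_mul, abs_neg, abs_of_pos (hτ0 n)]
    refine mul_le_mul (hτ n) ?_ (abs_nonneg _) hT.le
    have := abs_sub (contrast (w n) ⬝ᵥ φ n s) (contrast (w n) ⬝ᵥ meanVec (φ n) (θ n))
    linarith [hcφ n s]
  have hfm : ∀ n, Measurable (f n) := fun n => measurable_of_finite _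
  have hZm : ∀ n i, Measurable fun ω => f n (X n i ω) := fun n i => (hfm n).comp (hX n i)
  have hmean : ∀ n i, ∫ ω, f n (X n i ω) ∂μ n = 0 := fun n i => by
    rw [integral_comp_of_law (hX n i) (hlaw n i), sum_pmf_mul]
    simp only [f]
    have h1 := dotProduct_meanVec (φ n) (θ n) (contrast (w n))
    have h2 : (fun s => τ n * -(contrast (w n) ⬝ᵥ φ n s - contrast (w n) ⬝ᵥ meanVec (φ n) (θ n)))
        = fun s => -τ n * (contrast (w n) ⬝ᵥ φ n s - contrast (w n) ⬝ᵥ meanVec (φ n) (θ n)) := by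
      funext s; ring
    rw [h2, wmean_const_mul, wmean_sub, wmean_const (gibbsWeight_pos _ _), ← h1, sub_self, mul_zero]
  have hvar : ∀ n i, ∫ ω, f n (X n i ω) ^ 2 ∂μ n = τ n ^ 2
      * (contrast (w n) ⬝ᵥ (covMat (φ n) (θ n) *ᵥ contrast (w n))) := fun n i => by
    rw [integral_comp_of_law (hX n i) (hlaw n i) fun s => f n s ^ 2, sum_pmf_mul,
      dotProduct_covMat_mulVec, wcov_self_eq (gibbsWeight_pos _ _), ← wmean_const_mul,
      ← dotProduct_meanVec]
    congr 1
    funext s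
    simp only [f]
    ring
  have hchar := tendsto_charFun_sqrt_mul_mean (μ := μ) (Z := fun n i ω => f n (X n i ω)) hZm
    (fun n => (hind n).comp (fun _ => f n) fun _ => hfm n) (fun n i ω => hf n _) hmean hvar hlim
  have hA : ∀ (n : ℕ) (ω : Ω n), (Real.sqrt n)⁻¹ * ∑ i, f n (X n i ω)
      = τ n * (Real.sqrt n * (-(contrast (w n) ⬝ᵥ sampleMean (φ n) fun i => X n i ω)
        + contrast (w n) ⬝ᵥ meanVec (φ n) (θ n))) := fun n ω => by
    rcases Nat.eq_zero_or_pos n with rfl | hn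
    · simp
    · have hn0 : (0 : ℝ) < n := Nat.cast_pos.2 hn
      have hs : Real.sqrt n * Real.sqrt n = n := Real.mul_self_sqrt hn0.le
      have hs0 : 0 < Real.sqrt n := Real.sqrt_pos.2 hn0
      simp only [f, ← mean_dotProduct, ← Finset.mul_sum, Finset.sum_neg_distrib,
        Finset.sum_sub_distrib, Finset.sum_const, Finset.card_univ, Fintype.card_fin,
        nsmul_eq_mul]
      rw [show (Real.sqrt n)⁻¹ = Real.sqrt n * (1 / (n : ℝ)) by
        field_simp; rw [sq, hs]]
      field_simp
      ring
  refine tendstoInDistribution_gaussian_of_charFun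
    (A := fun n ω => (Real.sqrt n)⁻¹ * ∑ i, f n (X n i ω))
    (fun n => (Finset.measurable_fun_sum _ fun i _ => hZm n i).const_mul _)
    (fun n => ((hU n).const_mul _).const_mul _) hchar fun ε hε => ?_
  refine squeeze_zero (fun n => measureReal_nonneg) (fun n => measureReal_mono fun ω hω => ?_)
    (hrem (ε / T) (by positivity))
  have hω' : ε < |τ n * (Real.sqrt n * U n ω) - (Real.sqrt n)⁻¹ * ∑ i, f n (X n i ω)| := hω
  rw [hA, ← mul_sub, abs_mul, abs_of_pos (hτ0 n)] at hω'
  change ε / T < _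
  rw [div_lt_iff₀ hT, mul_comm]
  exact hω'.trans_le (mul_le_mul_of_nonneg_right (hτ n) (abs_nonneg _))

end Normality

end MRF

theorem mainTheorem2
    -- sample size `n`; all other sizes depend on `n`; the number of parameters is `p = b n + 1`
    (d r b m : ℕ → ℕ)
    -- the model and the true parameter
    (φ : (n : ℕ) → MRF.Config (d n) (r n) → Fin (b n + 1) → ℝ)
    (θstar : (n : ℕ) → Fin (b n + 1) → ℝ)
    -- transition matrix, stationary and initial mass function of the simulated chain
    (P : (n : ℕ) → MRF.Config (d n) (r n) → MRF.Config (d n) (r n) → ℝ)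
    (h q : (n : ℕ) → MRF.Config (d n) (r n) → ℝ)
    (hP : ∀ n, MRF.IsTransition (P n))
    (hh : ∀ n, MRF.IsMassFn (h n)) (hh_pos : ∀ n y, 0 < h n y)
    (hstat : ∀ n, MRF.IsStationary (P n) (h n))
    (hq : ∀ n, MRF.IsMassFn (q n))
    -- probability spaces, the i.i.d. sample and the chain
    (Ω : ℕ → Type*) [∀ n, MeasurableSpace (Ω n)]
    (μ : (n : ℕ) → Measure (Ω n)) [∀ n, IsProbabilityMeasure (μ n)]
    (X : (n : ℕ) → Fin n → Ω n → MRF.Config (d n) (r n))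
    (Y : (n : ℕ) → Fin (m n) → Ω n → MRF.Config (d n) (r n))
    (hX_meas : ∀ n i, Measurable (X n i)) (hY_meas : ∀ n i, Measurable (Y n i))
    (hX_indep : ∀ n, iIndepFun (X n) (μ n))
    (hX_law : ∀ n i x, (μ n).real {ω | X n i ω = x} = MRF.pmf (φ n) (θstar n) x)
    (hY : ∀ n, MRF.IsMarkovChain (μ n) (q n) (P n) (Y n))
    -- constants that do not depend on `n`
    (K Cmin B lamMin lamMax D kap M Q ζ r₁ : ℝ) (s₀ : ℕ)
    (hK : 0 < K) (hCmin : 0 < Cmin) (hlamMin : 0 < lamMin) (hkap : kap < 1)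
    (hζ : 1 < ζ) (hr₁ : 1 < r₁)
    -- uniformity of the simulated chains
    (hgap : ∀ n, MRF.kappa (P n) (h n) ≤ kap)
    (hM : ∀ n, MRF.chainM2 (φ n) (θstar n) (h n) ≤ M)
    (hQ : ∀ n y, q n y ≤ Q * h n y)
    -- boundedness of `φ`, compatibility, boundedness of `θ*`
    (hφ : ∀ n x j, |φ n x j| ≤ K)
    (hcompat : ∀ n (T : Finset (Fin (b n + 1))) (z : ℝ), 1 < z →
      (Cmin : EReal) ≤ MRF.compatFactor z T (MRF.covMat (φ n) (θstar n)))
    (hθ : ∀ n j, |θstar n j| ≤ B)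
    -- eigenvalues of `H*`
    (heig : ∀ n, ∀ ev ∈ spectrum ℝ (MRF.covMat (φ n) (θstar n)), lamMin ≤ ev ∧ ev ≤ lamMax)
    -- `w*` is the population projection of the `α`-score onto the `β`-scores, and is bounded
    (wstar : (n : ℕ) → Fin (b n) → ℝ)
    (hwstar : ∀ n, 1 ≤ n → IsMinOn
      (fun w : Fin (b n) → ℝ => ∫ ω, (MRF.projectedScore
        (MRF.negLogLik (φ n) fun i => X n i ω) w (θstar n)) ^ 2 ∂(μ n))
      Set.univ (wstar n))
    (hw_bdd : ∀ n j, |wstar n j| ≤ D)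
    -- sparsity
    (hs : ∀ n, MRF.l0 (θstar n) ≤ s₀) (hs' : ∀ n, MRF.l0 (wstar n) ≤ s₀)
    -- tuning parameters
    (lam₁ lam₂ lam' : ℕ → ℝ)
    (hlam₁ : ∀ n, 0 < lam₁ n) (hlam₂ : ∀ n, 0 < lam₂ n) (hlam' : ∀ n, 0 < lam' n)
    (hlam_rate : lam₁ =Θ[atTop] fun n => MRF.rate (b n + 1) n (m n))
    (hlam_const : ∀ᶠ n : ℕ in atTop,
      4 * K * (ζ + 1) / (ζ - 1) * Real.sqrt (2 * r₁ * Real.log ((b n + 1 : ℕ) : ℝ) / n) < lam₁ n)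
    (hlam₁₂ : lam₁ =Θ[atTop] lam₂) (hlam₂' : lam₂ =Θ[atTop] lam')
    (hlam_zero : Tendsto lam' atTop (𝓝 0))
    -- growth conditions
    (hp : Tendsto b atTop atTop)
    (hgrowth : Tendsto (fun n : ℕ =>
      Real.log ((b n + 1 : ℕ) : ℝ) / Real.sqrt n + Real.log ((b n + 1 : ℕ) : ℝ) / Real.sqrt (m n)
        + Real.log ((b n + 1 : ℕ) : ℝ) ^ (3 / 2 : ℝ) / m n) atTop (𝓝 0))
    (hmn : (fun n : ℕ => Real.log ((b n + 1 : ℕ) : ℝ)) =O[atTop] fun n : ℕ => (m n : ℝ) / n)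
    -- the elastic-net estimator and the Lasso-type estimator
    (θhat : (n : ℕ) → Ω n → Fin (b n + 1) → ℝ) (hθhat_meas : ∀ n, Measurable (θhat n))
    (hθhat : ∀ n ω, IsMinOn
      (MRF.elasticNetCriterion (φ n) (h n) (fun i => X n i ω) (fun i => Y n i ω)
        (lam₁ n) (lam₂ n)) Set.univ (θhat n ω))
    (what : (n : ℕ) → Ω n → Fin (b n) → ℝ) (hwhat_meas : ∀ n, Measurable (what n))
    (hwhat : ∀ n ω, IsMinOn
      (MRF.lassoCriterion (φ n) (h n) (fun i => X n i ω) (fun i => Y n i ω)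
        (lam' n) (θhat n ω)) Set.univ (what n ω))
    -- the null hypothesis
    (α₀ : ℕ → ℝ) (hnull : ∀ n, θstar n 0 = α₀ n) :
    -- the variance, in both of its forms
    (∀ n, 0 < MRF.schur (MRF.covMat (φ n) (θstar n))) ∧
    (∀ n, 1 ≤ n → MRF.schur (MRF.covMat (φ n) (θstar n)) =
      MRF.blockAA (MRF.covMat (φ n) (θstar n))
        - wstar n ⬝ᵥ MRF.blockAB (MRF.covMat (φ n) (θstar n))) ∧
    -- asymptotic normality, standardized by the variance, which may vary with `n`
    TendstoInDistribution
      (fun (n : ℕ) (ω : Ω n) => Real.sqrt n * MRF.decorrelatedScore (φ n) (h n) (fun i => X n i ω)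
          (fun i => Y n i ω) (what n ω) (α₀ n) (fun j => θhat n ω (Fin.succ j))
        / Real.sqrt (MRF.schur (MRF.covMat (φ n) (θstar n))))
      atTop (id : ℝ → ℝ) μ (gaussianReal 0 1) ∧
    -- asymptotic normality with the limiting variance
    (∀ v : ℝ≥0,
      Tendsto (fun n => MRF.schur (MRF.covMat (φ n) (θstar n))) atTop (𝓝 (v : ℝ)) →
      TendstoInDistribution
        (fun (n : ℕ) (ω : Ω n) => Real.sqrt n * MRF.decorrelatedScore (φ n) (h n) (fun i => X n i ω)
          (fun i => Y n i ω) (what n ω) (α₀ n) (fun j => θhat n ω (Fin.succ j)))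
        atTop (id : ℝ → ℝ) μ (gaussianReal 0 v)) := by
  have : ∀ n, Nonempty (MRF.Config (d n) (r n)) := fun n => (hh n).nonempty
  have hHerm : ∀ n, (MRF.covMat (φ n) (θstar n)).IsHermitian := fun n =>
    Matrix.IsHermitian.ext fun i j => by
      simpa using MRF.covMat_symm (φ n) (θstar n) j i
  have hpd : ∀ n (v : Fin (b n + 1) → ℝ),
      lamMin * ∑ j, v j ^ 2 ≤ v ⬝ᵥ (MRF.covMat (φ n) (θstar n) *ᵥ v) := fun n =>
    MRF.le_dotProduct_mulVec_of_spectrum (hHerm n) fun ev hev => (heig n ev hev).1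
  have hschur : ∀ n, lamMin ≤ MRF.schur (MRF.covMat (φ n) (θstar n)) := fun n =>
    MRF.le_schur hlamMin (MRF.covMat_symm (φ n) (θstar n)) (hpd n)
  have hpos : ∀ n, 0 < MRF.schur (MRF.covMat (φ n) (θstar n)) := fun n =>
    hlamMin.trans_le (hschur n)
  have hnormal : ∀ n, 1 ≤ n → MRF.blockBB (MRF.covMat (φ n) (θstar n)) *ᵥ wstar n
      = MRF.blockAB (MRF.covMat (φ n) (θstar n)) := fun n hn => by
    have hn0 : (0 : ℝ) < 1 / n := by
      have : (0 : ℝ) < n := Nat.cast_pos.2 hn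
      positivity
    refine MRF.blockBB_mulVec_of_isMinOn (MRF.covMat_symm (φ n) (θstar n)) fun w => ?_
    have h1 := hwstar n hn (Set.mem_univ w)
    rw [Set.mem_ofPred_eq] at h1
    beta_reduce at h1
    rw [MRF.integral_sq_projectedScore hn (hX_meas n) (hX_indep n) (hX_law n),
      MRF.integral_sq_projectedScore hn (hX_meas n) (hX_indep n) (hX_law n)] at h1
    exact le_of_mul_le_mul_left h1 hn0
  have hschur_eq : ∀ n, 1 ≤ n → MRF.schur (MRF.covMat (φ n) (θstar n))
      = MRF.blockAA (MRF.covMat (φ n) (θstar n))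
        - wstar n ⬝ᵥ MRF.blockAB (MRF.covMat (φ n) (θstar n)) := fun n hn =>
    MRF.schur_eq_of_blockBB_mulVec (MRF.det_blockBB_ne_zero hlamMin (hpd n)) (hnormal n hn)
  have hvar : ∀ n, 1 ≤ n → MRF.contrast (wstar n) ⬝ᵥ
      (MRF.covMat (φ n) (θstar n) *ᵥ MRF.contrast (wstar n))
      = MRF.schur (MRF.covMat (φ n) (θstar n)) := fun n hn => by
    rw [MRF.dotProduct_mulVec_contrast (MRF.covMat_symm (φ n) (θstar n)) (hnormal n hn),
      hschur_eq n hn]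
    simp [MRF.contrast]
  -- comparing total masses, `q ≤ Q h` forces `1 ≤ Q`
  have hQ0 : 0 ≤ Q := by
    have h1 := Finset.sum_le_sum fun y (_ : y ∈ Finset.univ) => hQ 0 y
    rw [← Finset.mul_sum, (hq 0).2, (hh 0).2] at h1
    linarith
  have hθs : ∀ n, (MRF.l0 (θstar n) : ℝ) ≤ s₀ := fun n => Nat.cast_le.2 (hs n)
  have hws : ∀ n, (MRF.l0 (wstar n) : ℝ) ≤ s₀ := fun n => Nat.cast_le.2 (hs' n)
  have hw : ∀ n j, |wstar n j| ≤ |D| := fun n j => (hw_bdd n j).trans (le_abs_self D)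
  have hrem := fun (ε : ℝ) (hε : 0 < ε) =>
    MRF.tendsto_measure_scaled_remainder hP hh hh_pos hstat hq hX_meas hY_meas hX_indep hX_law hY
      hK (abs_nonneg B) (abs_nonneg D) hlamMin (Nat.cast_nonneg s₀) (le_max_right kap 0)
      (max_lt hkap zero_lt_one) (le_max_right M 1) hQ0 hζ hr₁
      (fun n => (hgap n).trans (le_max_left _ _)) (fun n => (hM n).trans (le_max_left _ _)) hQ hφ
      (fun n j => (hθ n j).trans (le_abs_self B)) hpd hw hnormal hθs hws hlam₁ hlam₂ hlam'
      hlam_rate hlam_const hlam₁₂ hlam₂' hlam_zero hp hgrowth hmn hθhat hwhat (ε := ε) hε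
  have hU : ∀ n, Measurable fun ω => MRF.decorrelatedScore (φ n) (h n) (fun i => X n i ω)
      (fun i => Y n i ω) (what n ω) (α₀ n) (fun j => θhat n ω (Fin.succ j)) := fun n =>
    MRF.measurable_decorrelatedScore (φ n) (hh_pos n) (hX_meas n) (hY_meas n) (hwhat_meas n) (α₀ n)
      (measurable_pi_lambda _ fun j => (measurable_pi_apply _).comp (hθhat_meas n))
  simp only [hnull] at hrem
  refine ⟨hpos, hschur_eq, ?_, fun v hv => ?_⟩
  · have hmain := MRF.tendstoInDistribution_of_score_approximation hX_meas hX_indep hX_law hK.le hφ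
      (fun n => MRF.l1_contrast_le (abs_nonneg D) (hw n) (hws n)) hU hrem
      (τ := fun n => (Real.sqrt (MRF.schur (MRF.covMat (φ n) (θstar n))))⁻¹)
      (T := (Real.sqrt lamMin)⁻¹) (v := 1) (fun n => inv_pos.2 (Real.sqrt_pos.2 (hpos n)))
      (fun n => inv_anti₀ (Real.sqrt_pos.2 hlamMin) (Real.sqrt_le_sqrt (hschur n))) ?_
    · simpa only [div_eq_inv_mul] using hmain
    · refine tendsto_const_nhds.congr' ?_
      filter_upwards [eventually_ge_atTop 1] with n hn
      rw [hvar n hn, inv_pow, Real.sq_sqrt (hpos n).le, inv_mul_cancel₀ (hpos n).ne']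
      rfl
  · have hmain := MRF.tendstoInDistribution_of_score_approximation hX_meas hX_indep hX_law hK.le hφ
      (fun n => MRF.l1_contrast_le (abs_nonneg D) (hw n) (hws n)) hU hrem
      (τ := fun _ => 1) (T := 1) (v := v) (fun _ => one_pos) (fun _ => le_rfl) ?_
    · simpa only [one_mul] using hmain
    · refine hv.congr' ?_
      filter_upwards [eventually_ge_atTop 1] with n hn
      rw [hvar n hn, one_pow, one_mul]
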